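/- Let $D=\mathrm{diag}(d_1,\dots,d_p)$ with $d_1\ge d_2\ge\dots\ge d_p>0$, put $d_{p+1}:=0$, and let $J=\begin{bmatrix}0&I_p\\ I_p&0\end{bmatrix}$, $H_0=\begin{bmatrix}D&0\\0&0\end{bmatrix}$ (both $2p\times 2p$). Let $\varphi$ be a rational $p\times p$ matrix function, without poles in $\mathbb C_+$, such that $$\lim_{\lambda\to\infty}\varphi(\lambda)=\tfrac i2 D,\qquad \Im\varphi(\lambda)=\tfrac1{2i}(\varphi(\lambda)-\varphi(\lambda)^*)\ge0\quad(\lambda\in\mathbb C_+).$$ Then $\varphi$ has a realization $$\varphi(\lambda)=\tfrac i2D+\Theta_1^*(\beta-\lambda I_n)^{-1}\Theta_2\qquad(\lambda\notin\sigma(\beta)),\tag{1}$$ with some $n\ge1$, an $n\times n$ matrix $\beta$ and $n\times p$ matrices $\Theta_1,\Theta_2$. For any such realization define the following. * For $x\ge 0$: $s(x)=\tfrac12I_p+D^{-1}\Theta_2^*\int_0^x e^{iu\beta^*}du\,\Theta_1$, $\Phi_1(x)=\{d_is_{ij}(d_ix)\}_{i,j=1}^p$, $\Phi_2(x)\equiv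 I_p$. * $\mathcal A=i\,\mathrm{diag}(\beta^*,\beta)$, and $\mathcal A_m^\times=\mathcal A+\begin{bmatrix}-\Theta_1\\ \Theta_2\end{bmatrix}D^{-1}Q_m\begin{bmatrix}\Theta_2^*&\Theta_1^*\end{bmatrix}$ for $1\le m\le p$, where $Q_m$ is the diagonal projection onto the first $m$ coordinates. * For $l\ge0$, $U=U^{(l)}$ is the $2n\times2n$ matrix function on $[0,d_1l]$ with $U(0)=I_{2n}$ and $$U(y)=e^{-y\mathcal A}e^{(y-d_{m+1}l)\mathcal A_m^\times}e^{d_{m+1}l\mathcal A}U(d_{m+1}l)\qquad(d_{m+1}l\le y\le d_ml,\ 1\le m\le p).$$ * With $U_{21},U_{22}$ denoting the lower $n\times n$ blocks of $U$, $P^\times=\begin{bmatrix}0&0\\U_{22}(d_1l)^{-1}U_{21}(d_1l)&I_n\end{bmatrix}$. * For $0\le x,t\le l$, the $(i,j)$ entry of $T_l(x,t)$ is the $(i,j)$ entry of $$\begin{bmatrix}\Theta_2^*&\Theta_1^*\end{bmatrix}e^{d_ix\mathcal A}U(d_ix)\,K\,U(d_jt)^{-1}e^{-d_jt\mathcal A}\begin{bmatrix}-\Theta_1\\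 \Theta_2\end{bmatrix},$$ where $K=I_{2n}-P^\times$ if $d_ix>d_jt$ and $K=-P^\times$ if $d_ix<d_jt$ (the values for $d_ix=d_jt$ are immaterial). * For $x\ge0$: $\gamma(x)=[\Phi_1(x)\ \ \Phi_2(x)]+\int_0^xT_x(x,r)[\Phi_1(r)\ \ \Phi_2(r)]\,dr$ and $H(x)=\gamma(x)^*\gamma(x)$. Then, for every realization (1) and every $x\ge0$, all of this is well defined (the inverses exist and the integrand is integrable), and $$\gamma(x)J\gamma(x)^*=D.$$ Consequently, for each $x\ge 0$, the matrix $JH(x)$ is similar to the constant matrix $H_0=\mathrm{diag}(D,0)$: there is an invertible $L$ with $JH(x)=L^{-1}H_0L$. -/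

import Mathlib

open Matrix Filter Topology
open scoped ComplexOrder

namespace DKernel

noncomputable section

/-- `D = diag(d₁, …, d_p)` as a complex matrix. -/
def D {p : ℕ} (d : Fin p → ℝ) : Matrix (Fin p) (Fin p) ℂ :=
  Matrix.diagonal fun i => (d i : ℂ)

/-- `D⁻¹ = diag(1/d₁, …, 1/d_p)`. -/
def Dinv {p : ℕ} (d : Fin p → ℝ) : Matrix (Fin p) (Fin p) ℂ :=
  Matrix.diagonal fun i => ((d i : ℂ))⁻¹

/-- `J = [[0, I_p], [I_p, 0]]`. -/
def J (p : ℕ) : Matrix (Fin p ⊕ Fin p) (Fin p ⊕ Fin p) ℂ :=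
  Matrix.fromBlocks 0 1 1 0

/-- `H₀ = diag(D, 0)`. -/
def H0 {p : ℕ} (d : Fin p → ℝ) : Matrix (Fin p ⊕ Fin p) (Fin p ⊕ Fin p) ℂ :=
  Matrix.fromBlocks (D d) 0 0 0

/-- The value at `z` of a rational matrix function. -/
def evalAt {p : ℕ} (φ : Matrix (Fin p) (Fin p) (RatFunc ℂ)) (z : ℂ) :
    Matrix (Fin p) (Fin p) ℂ :=
  φ.map (RatFunc.eval (RingHom.id ℂ) z)

/-- The imaginary part `(M - M*) / (2i)` of a complex matrix. -/
def imPart {p : ℕ} (M : Matrix (Fin p) (Fin p) ℂ) : Matrix (Fin p) (Fin p) ℂ :=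
  (1 / (2 * Complex.I)) • (M - Mᴴ)

/-- A rational matrix function tending to `(i/2) D` at infinity and having a nonnegative imaginary
part on the open upper half-plane (in particular, it is finite there). -/
structure IsAdmissible {p : ℕ} (d : Fin p → ℝ) (φ : Matrix (Fin p) (Fin p) (RatFunc ℂ)) :
    Prop where
  tendsto_infty : Tendsto (evalAt φ) (Bornology.cobounded ℂ) (𝓝 ((Complex.I / 2) • D d))
  no_pole : ∀ z : ℂ, 0 < z.im → ∀ i j, (φ i j).denom.eval z ≠ 0
  im_nonneg : ∀ z : ℂ, 0 < z.im → (imPart (evalAt φ z)).PosSemidef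

/-- The realization `φ(z) = (i/2) D + Θ₁* (β - z I)⁻¹ Θ₂`, for every `z` outside the spectrum
of `β`. -/
def IsRealization {p n : ℕ} (d : Fin p → ℝ) (φ : Matrix (Fin p) (Fin p) (RatFunc ℂ))
    (β : Matrix (Fin n) (Fin n) ℂ) (Θ₁ Θ₂ : Matrix (Fin n) (Fin p) ℂ) : Prop :=
  ∀ z : ℂ, z ∉ spectrum ℂ β →
    evalAt φ z = (Complex.I / 2) • D d + Θ₁ᴴ * (β - z • (1 : Matrix (Fin n) (Fin n) ℂ))⁻¹ * Θ₂

/-- `𝒜 = i diag(β*, β)`. -/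
def calA {n : ℕ} (β : Matrix (Fin n) (Fin n) ℂ) : Matrix (Fin n ⊕ Fin n) (Fin n ⊕ Fin n) ℂ :=
  Complex.I • Matrix.fromBlocks βᴴ 0 0 β

/-- The column `[-Θ₁; Θ₂]`. -/
def colΘ {p n : ℕ} (Θ₁ Θ₂ : Matrix (Fin n) (Fin p) ℂ) : Matrix (Fin n ⊕ Fin n) (Fin p) ℂ :=
  Matrix.fromRows (-Θ₁) Θ₂

/-- The row `[Θ₂* Θ₁*]`. -/
def rowΘ {p n : ℕ} (Θ₁ Θ₂ : Matrix (Fin n) (Fin p) ℂ) : Matrix (Fin p) (Fin n ⊕ Fin n) ℂ :=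
  Matrix.fromCols Θ₂ᴴ Θ₁ᴴ

/-- The nodes `d₁ ≥ d₂ ≥ … ≥ d_p > 0` (numbered from `0`), followed by `0`. -/
def node {p : ℕ} (d : Fin p → ℝ) (m : ℕ) : ℝ :=
  if h : m < p then d ⟨m, h⟩ else 0

/-- The projection onto the coordinates `0, …, m`. -/
def proj {p : ℕ} (m : Fin p) : Matrix (Fin p) (Fin p) ℂ :=
  Matrix.diagonal fun i => if i ≤ m then 1 else 0

/-- `𝒜^× = 𝒜 + [-Θ₁; Θ₂] D⁻¹ P [Θ₂* Θ₁*]`, where `P` is the projection onto the coordinates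
`0, …, m`. It governs the interval between `d_{m+1} l` and `d_m l`. -/
def calAx {p n : ℕ} (d : Fin p → ℝ) (β : Matrix (Fin n) (Fin n) ℂ)
    (Θ₁ Θ₂ : Matrix (Fin n) (Fin p) ℂ) (m : Fin p) :
    Matrix (Fin n ⊕ Fin n) (Fin n ⊕ Fin n) ℂ :=
  calA β + colΘ Θ₁ Θ₂ * Dinv d * proj m * rowΘ Θ₁ Θ₂

/-- The matrix function `U` on `[0, d₁ l]`. It is `e^{-y𝒜}` times the product, with the rightmost
factors coming from the intervals closest to `0`, of the exponentials of `𝒜^×_m` times the length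
of the part of the `m`-th interval `[d_{m+1} l, d_m l]` lying below `y`. The lemmas `U_zero` and
`U_step` show that it is the function given by the usual interval by interval recursion (equal
consecutive `d`'s give intervals of length zero and factors equal to one). -/
def U {p n : ℕ} (d : Fin p → ℝ) (β : Matrix (Fin n) (Fin n) ℂ)
    (Θ₁ Θ₂ : Matrix (Fin n) (Fin p) ℂ) (l y : ℝ) :
    Matrix (Fin n ⊕ Fin n) (Fin n ⊕ Fin n) ℂ :=
  NormedSpace.exp ((-y : ℂ) • calA β) *
    (List.ofFn fun m : Fin p => NormedSpace.exp
      (((min y (node d m * l) - min y (node d (m + 1) * l) : ℝ) : ℂ) • calAx d β Θ₁ Θ₂ m)).prod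

/-- `P^× = [[0, 0], [U₂₂(a)⁻¹ U₂₁(a), I_n]]` with `a = d₁ l`. -/
def Px {p n : ℕ} (d : Fin p → ℝ) (β : Matrix (Fin n) (Fin n) ℂ)
    (Θ₁ Θ₂ : Matrix (Fin n) (Fin p) ℂ) (l : ℝ) :
    Matrix (Fin n ⊕ Fin n) (Fin n ⊕ Fin n) ℂ :=
  Matrix.fromBlocks 0 0
    ((U d β Θ₁ Θ₂ l (node d 0 * l)).toBlocks₂₂⁻¹ * (U d β Θ₁ Θ₂ l (node d 0 * l)).toBlocks₂₁) 1

/-- The factor of the kernel that depends on `x`: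
`[Θ₂* Θ₁*] e^{y𝒜} U(y)`. -/
def leftFactor {p n : ℕ} (d : Fin p → ℝ) (β : Matrix (Fin n) (Fin n) ℂ)
    (Θ₁ Θ₂ : Matrix (Fin n) (Fin p) ℂ) (l y : ℝ) : Matrix (Fin p) (Fin n ⊕ Fin n) ℂ :=
  rowΘ Θ₁ Θ₂ * NormedSpace.exp ((y : ℂ) • calA β) * U d β Θ₁ Θ₂ l y

/-- The factor of the kernel that depends on `t`:
`U(z)⁻¹ e^{-z𝒜} [-Θ₁; Θ₂]`. -/
def rightFactor {p n : ℕ} (d : Fin p → ℝ) (β : Matrix (Fin n) (Fin n) ℂ)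
    (Θ₁ Θ₂ : Matrix (Fin n) (Fin p) ℂ) (l z : ℝ) : Matrix (Fin n ⊕ Fin n) (Fin p) ℂ :=
  (U d β Θ₁ Θ₂ l z)⁻¹ * NormedSpace.exp ((-z : ℂ) • calA β) * colΘ Θ₁ Θ₂

/-- The kernel matrix `[Θ₂* Θ₁*] e^{y𝒜} U(y) (I - P^×) U(z)⁻¹ e^{-z𝒜} [-Θ₁; Θ₂]`, used for
`z < y`. -/
def lowerKernel {p n : ℕ} (d : Fin p → ℝ) (β : Matrix (Fin n) (Fin n) ℂ)
    (Θ₁ Θ₂ : Matrix (Fin n) (Fin p) ℂ) (l y z : ℝ) : Matrix (Fin p) (Fin p) ℂ :=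
  leftFactor d β Θ₁ Θ₂ l y * (1 - Px d β Θ₁ Θ₂ l) * rightFactor d β Θ₁ Θ₂ l z

/-- The kernel matrix `-[Θ₂* Θ₁*] e^{y𝒜} U(y) P^× U(z)⁻¹ e^{-z𝒜} [-Θ₁; Θ₂]`, used for
`y < z`. -/
def upperKernel {p n : ℕ} (d : Fin p → ℝ) (β : Matrix (Fin n) (Fin n) ℂ)
    (Θ₁ Θ₂ : Matrix (Fin n) (Fin p) ℂ) (l y z : ℝ) : Matrix (Fin p) (Fin p) ℂ :=
  -(leftFactor d β Θ₁ Θ₂ l y * Px d β Θ₁ Θ₂ l * rightFactor d β Θ₁ Θ₂ l z)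

/-- The kernel `T_l(x, t)` of the integral part of `S_l⁻¹`, for `0 ≤ x, t ≤ l`. On the lines
`d_i x = d_j t`, where the `(i, j)` entry jumps, the value is immaterial and set to `0`. -/
def T {p n : ℕ} (d : Fin p → ℝ) (β : Matrix (Fin n) (Fin n) ℂ)
    (Θ₁ Θ₂ : Matrix (Fin n) (Fin p) ℂ) (l x t : ℝ) : Matrix (Fin p) (Fin p) ℂ :=
  Matrix.of fun i j =>
    if d j * t < d i * x then lowerKernel d β Θ₁ Θ₂ l (d i * x) (d j * t) i j
    else if d i * x < d j * t then upperKernel d β Θ₁ Θ₂ l (d i * x) (d j * t) i j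
    else 0

/-- The operator `V_+^*`, applied columnwise to a matrix function `F`:
`(V_+^* F)(x) = F(x) + ∫₀ˣ T_x(x, r) F(r) dr` (the integral is taken entrywise). -/
def VplusStar {p n : ℕ} {ι : Type*} (d : Fin p → ℝ) (β : Matrix (Fin n) (Fin n) ℂ)
    (Θ₁ Θ₂ : Matrix (Fin n) (Fin p) ℂ) (F : ℝ → Matrix (Fin p) ι ℂ) (x : ℝ) :
    Matrix (Fin p) ι ℂ :=
  F x + Matrix.of fun i c => ∫ r in (0 : ℝ)..x, (T d β Θ₁ Θ₂ x x r * F r) i c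

/-- `s(x) = (1/2) I_p + D⁻¹ Θ₂* (∫₀ˣ exp(i u β*) du) Θ₁` for `x > 0`, extended by continuity to
`x = 0` (the integral is taken entrywise). -/
def s {p n : ℕ} (d : Fin p → ℝ) (β : Matrix (Fin n) (Fin n) ℂ)
    (Θ₁ Θ₂ : Matrix (Fin n) (Fin p) ℂ) (x : ℝ) : Matrix (Fin p) (Fin p) ℂ :=
  (1 / 2 : ℂ) • (1 : Matrix (Fin p) (Fin p) ℂ) +
    Dinv d * Θ₂ᴴ *
      (Matrix.of fun a b => ∫ u in (0 : ℝ)..x, NormedSpace.exp ((Complex.I * u) • βᴴ) a b) * Θ₁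

/-- `Φ₁(x) = {d_i s_{ij}(d_i x)}`. -/
def Phi1 {p n : ℕ} (d : Fin p → ℝ) (β : Matrix (Fin n) (Fin n) ℂ)
    (Θ₁ Θ₂ : Matrix (Fin n) (Fin p) ℂ) (x : ℝ) : Matrix (Fin p) (Fin p) ℂ :=
  Matrix.of fun i j => (d i : ℂ) * s d β Θ₁ Θ₂ (d i * x) i j

/-- `Π(x) = [Φ₁(x) Φ₂(x)]` with `Φ₂ ≡ I_p`. -/
def Pi0 {p n : ℕ} (d : Fin p → ℝ) (β : Matrix (Fin n) (Fin n) ℂ)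
    (Θ₁ Θ₂ : Matrix (Fin n) (Fin p) ℂ) (x : ℝ) : Matrix (Fin p) (Fin p ⊕ Fin p) ℂ :=
  Matrix.fromCols (Phi1 d β Θ₁ Θ₂ x) 1

/-- `γ(x) = (V_+^* [Φ₁ Φ₂])(x)`. -/
def gamma {p n : ℕ} (d : Fin p → ℝ) (β : Matrix (Fin n) (Fin n) ℂ)
    (Θ₁ Θ₂ : Matrix (Fin n) (Fin p) ℂ) (x : ℝ) : Matrix (Fin p) (Fin p ⊕ Fin p) ℂ :=
  VplusStar d β Θ₁ Θ₂ (Pi0 d β Θ₁ Θ₂) x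

/-- The formula for `γ(x)` makes sense: `U₂₂(a)` with `a = d₁ x` and the values of `U` on `[0, a]`
are invertible, and the entries of the integrand in `(V_+^* [Φ₁ Φ₂])(x)` are integrable. -/
structure IsWellDefined {p n : ℕ} (d : Fin p → ℝ) (β : Matrix (Fin n) (Fin n) ℂ)
    (Θ₁ Θ₂ : Matrix (Fin n) (Fin p) ℂ) (x : ℝ) : Prop where
  isUnit_U₂₂ : IsUnit (U d β Θ₁ Θ₂ x (node d 0 * x)).toBlocks₂₂
  isUnit_U : ∀ y ∈ Set.Icc 0 (node d 0 * x), IsUnit (U d β Θ₁ Θ₂ x y)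
  integrable : ∀ i c, IntervalIntegrable (fun r => (T d β Θ₁ Θ₂ x x r * Pi0 d β Θ₁ Θ₂ r) i c)
    MeasureTheory.volume 0 x

/-- The Hamiltonian `H(x) = γ(x)* γ(x)`. -/
def Ham {p n : ℕ} (d : Fin p → ℝ) (β : Matrix (Fin n) (Fin n) ℂ)
    (Θ₁ Θ₂ : Matrix (Fin n) (Fin p) ℂ) (x : ℝ) : Matrix (Fin p ⊕ Fin p) (Fin p ⊕ Fin p) ℂ :=
  (gamma d β Θ₁ Θ₂ x)ᴴ * gamma d β Θ₁ Θ₂ x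

/-- Similarity of square matrices: `M = L⁻¹ N L` for an invertible `L`. -/
def Similar {ι : Type*} [Fintype ι] [DecidableEq ι] (M N : Matrix ι ι ℂ) : Prop :=
  ∃ L : (Matrix ι ι ℂ)ˣ, M = (↑L⁻¹ : Matrix ι ι ℂ) * N * (L : Matrix ι ι ℂ)

theorem prod_ofFn_step {M : Type*} [Monoid M] : ∀ {p : ℕ} (m : Fin p) (f g : Fin p → M),
    (∀ j, j < m → f j = 1) → (∀ j, j < m → g j = 1) → g m = 1 → (∀ j, m < j → f j = g j) →
    (List.ofFn f).prod = f m * (List.ofFn g).prod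
  | 0, m, _, _ => m.elim0
  | p + 1, m, f, g => by
    intro hf hg hm hfg
    rw [List.ofFn_succ, List.ofFn_succ, List.prod_cons, List.prod_cons]
    induction m using Fin.cases with
    | zero =>
      rw [hm, one_mul]
      congr 3
      funext j
      exact hfg _ (Fin.succ_pos j)
    | succ m =>
      rw [hf 0 (Fin.succ_pos m), hg 0 (Fin.succ_pos m), one_mul, one_mul]
      exact prod_ofFn_step m (fun j => f j.succ) (fun j => g j.succ)
        (fun j hj => hf _ (Fin.succ_lt_succ_iff.2 hj))
        (fun j hj => hg _ (Fin.succ_lt_succ_iff.2 hj)) hm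
        (fun j hj => hfg _ (Fin.succ_lt_succ_iff.2 hj))

theorem node_nonneg {p : ℕ} {d : Fin p → ℝ} (hd : ∀ i, 0 < d i) (m : ℕ) : 0 ≤ node d m := by
  unfold node
  split_ifs with h
  · exact (hd _).le
  · exact le_rfl

theorem node_antitone {p : ℕ} {d : Fin p → ℝ} (hd : ∀ i, 0 < d i) (hanti : Antitone d) :
    Antitone (node d) := by
  intro a b hab
  by_cases hb : b < p
  · have ha : a < p := lt_of_le_of_lt hab hb
    simp only [node, ha, hb, dif_pos]
    exact hanti hab
  · have : node d b = 0 := by simp [node, hb]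
    rw [this]
    exact node_nonneg hd a

theorem U_zero {p n : ℕ} {d : Fin p → ℝ} (hd : ∀ i, 0 < d i) (β : Matrix (Fin n) (Fin n) ℂ)
    (Θ₁ Θ₂ : Matrix (Fin n) (Fin p) ℂ) {l : ℝ} (hl : 0 ≤ l) : U d β Θ₁ Θ₂ l 0 = 1 := by
  have h : ∀ m : ℕ, min 0 (node d m * l) = 0 := fun m =>
    min_eq_left (mul_nonneg (node_nonneg hd m) hl)
  simp [U, h]

theorem U_step {p n : ℕ} {d : Fin p → ℝ} (hd : ∀ i, 0 < d i) (hanti : Antitone d)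
    (β : Matrix (Fin n) (Fin n) ℂ) (Θ₁ Θ₂ : Matrix (Fin n) (Fin p) ℂ) {l : ℝ} (hl : 0 ≤ l)
    (m : Fin p) {y : ℝ} (h1 : node d (m + 1) * l ≤ y) (h2 : y ≤ node d m * l) :
    U d β Θ₁ Θ₂ l y =
      NormedSpace.exp ((-y : ℂ) • calA β) *
        NormedSpace.exp (((y - node d (m + 1) * l : ℝ) : ℂ) • calAx d β Θ₁ Θ₂ m) *
        NormedSpace.exp (((node d (m + 1) * l : ℝ) : ℂ) • calA β) *
        U d β Θ₁ Θ₂ l (node d (m + 1) * l) := by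
  have mono : ∀ {a b : ℕ}, a ≤ b → node d b * l ≤ node d a * l := fun hab =>
    mul_le_mul_of_nonneg_right (node_antitone hd hanti hab) hl
  set e := node d (m + 1) * l with he
  have key := prod_ofFn_step m
    (fun j : Fin p => NormedSpace.exp
      (((min y (node d j * l) - min y (node d (j + 1) * l) : ℝ) : ℂ) • calAx d β Θ₁ Θ₂ j))
    (fun j : Fin p => NormedSpace.exp
      (((min e (node d j * l) - min e (node d (j + 1) * l) : ℝ) : ℂ) • calAx d β Θ₁ Θ₂ j))
    ?_ ?_ ?_ ?_
  · unfold U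
    rw [key]
    have hm : min y (node d m * l) - min y (node d (m + 1) * l) = y - e := by
      rw [min_eq_left h2, min_eq_right h1]
    have hinv : NormedSpace.exp ((e : ℂ) • calA β) * NormedSpace.exp ((-e : ℂ) • calA β) = 1 := by
      rw [neg_smul, ← Matrix.exp_add_of_commute _ _ (Commute.refl ((e : ℂ) • calA β)).neg_right]
      simp
    simp only [hm]
    have := congrArg (fun X : Matrix (Fin n ⊕ Fin n) (Fin n ⊕ Fin n) ℂ => NormedSpace.exp ((-y : ℂ) • calA β) *
        NormedSpace.exp (((y - e : ℝ) : ℂ) • calAx d β Θ₁ Θ₂ m) * X *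
        (List.ofFn fun j : Fin p => NormedSpace.exp
      (((min e (node d j * l) - min e (node d (j + 1) * l) : ℝ) : ℂ) • calAx d β Θ₁ Θ₂ j)).prod)
        hinv
    simp only [mul_one, Matrix.mul_assoc] at this ⊢
    exact this.symm
  · intro j hj
    have hj' : (j : ℕ) + 1 ≤ m := hj
    have a1 : y ≤ node d (j + 1) * l := h2.trans (mono hj')
    have a2 : y ≤ node d j * l := a1.trans (mono (Nat.le_succ _))
    simp [min_eq_left a1, min_eq_left a2]
  · intro j hj
    have hj' : (j : ℕ) + 1 ≤ m := hj
    have a1 : e ≤ node d (j + 1) * l := (h1.trans h2).trans (mono hj')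
    have a2 : e ≤ node d j * l := a1.trans (mono (Nat.le_succ _))
    simp [min_eq_left a1, min_eq_left a2]
  · have a1 : e ≤ node d m * l := h1.trans h2
    simp [min_eq_left a1, ← he]
  · intro j hj
    have hj' : (m : ℕ) + 1 ≤ j := hj
    have a1 : node d j * l ≤ e := mono hj'
    have a2 : node d (j + 1) * l ≤ e := (mono (Nat.le_succ _)).trans a1
    simp only [min_eq_right a1, min_eq_right a2, min_eq_right (a1.trans h1),
      min_eq_right (a2.trans h1)]

end

end DKernel

/-! Everything is reduced to a two-point boundary value problem in the rescaled variable y = d_j r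
on [0, a], a = d_1 x. Row i of γ(x) integrates [D/2 + K(y), I], with K(y) = ∫_0^y Θ₂* e^{iuβ*} Θ₁
du, against a unit mass at d_i x plus a density g_i. The density comes from a row state ρ_i: it
solves ρ' = -ρ𝒜^× on both sides of d_i x, jumps there by row i of [Θ₂* Θ₁*], has no second half at 0
and no first half at a (`rowState_kernelRow`). With m_i = e_i + ∫ g_i and κ_i = e_i K(d_i x) + ∫ g_i
K, the row is [m_i D/2 + κ_i, m_i] (`unitRow_mul_gamma`). The (j, i) entry of γJγ* is therefore m_j
D m_i* + κ_j m_i* + m_j κ_i*, and `RowState.pairing` identifies it as D_ji.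

For the pairing, ρ_j is integrated to a row θ_j under the same boundary conditions. The integrated
equation (`RowState.tailMass_sub_integratedRow`) expresses m_j D + κ_j + m_j K(y)* through θ_j and
the density remaining beyond y. Green's identity for θ_j and ρ_i in the skew form [[0, I], [-I, 0]]
(`RowState.green`) turns the integral of this row against g_i into a value of θ_j at d_i x. That
value cancels against the contribution of the unit mass, and only D_ji remains.

The substantial point is the invertibility of U₂₂(a) (`isUnit_toBlocks₂₂`), which uses Im φ ≥ 0. A
null vector v starts a state whose input H makes the real part of the quadratic form of D δ + 2k
vanish, where k(t) = Θ₁* e^{itβ} Θ₂ for t < 0. On the Fourier side, after damping by η > 0, this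
form has symbol -2iφ(2πξ + iη). Its real part is nonnegative, and uniformly positive for large ξ
because φ tends to iD/2. Hence the Fourier transform of H vanishes on a half-line; being entire, it
is zero. So H = 0 and v = 0 (`ae_eq_zero_of_dampedForm_nonpos`).

The realization is arbitrary, so β may have eigenvalues in the upper half-plane that φ does not see.
A common denominator q of φ satisfies Θ₁* q(β) β^k Θ₂ = 0, and all roots of q lie in the closed
lower half-plane. The kernel Θ₁* e^{-iuβ} Θ₂ therefore grows more slowly than any exponential
(`exp_growth`), which justifies its Laplace transform.

Finally γJγ* = D shows that Jγ* maps into eigenvectors of Jγ*γ with eigenvalues d_i; together with a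
basis of ker γ they diagonalize it (`similar_of_mul_J_mul`). Existence of a realization is the block
companion construction (`exists_isRealization`). -/

namespace DKernel

noncomputable section

/-! ### Entrywise differentiation of matrix functions. -/

section EntryCalculus

variable {ι κ μ : Type*} [Fintype κ]

/-- Entrywise derivative of a matrix function. -/
def EntryDeriv {ι κ : Type*} (F : ℝ → Matrix ι κ ℂ) (F' : Matrix ι κ ℂ) (y : ℝ) : Prop :=
  ∀ i j, HasDerivAt (fun t => F t i j) (F' i j) y

theorem EntryDeriv.mul {F : ℝ → Matrix ι κ ℂ} {G : ℝ → Matrix κ μ ℂ} {F' : Matrix ι κ ℂ}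
    {G' : Matrix κ μ ℂ} {y : ℝ} (hF : EntryDeriv F F' y) (hG : EntryDeriv G G' y) :
    EntryDeriv (fun t => F t * G t) (F' * G y + F y * G') y := by
  intro i j
  simp only [Matrix.mul_apply, Matrix.add_apply, ← Finset.sum_add_distrib]
  exact HasDerivAt.fun_sum fun k _ => (hF i k).mul (hG k j)

theorem EntryDeriv.const {ι κ : Type*} (M : Matrix ι κ ℂ) (y : ℝ) :
    EntryDeriv (fun _ => M) 0 y :=
  fun _ _ => hasDerivAt_const _ _

theorem EntryDeriv.const_mul (M : Matrix ι κ ℂ) {G : ℝ → Matrix κ μ ℂ}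
    {G' : Matrix κ μ ℂ} {y : ℝ} (hG : EntryDeriv G G' y) :
    EntryDeriv (fun t => M * G t) (M * G') y := by
  simpa using (EntryDeriv.const M y).mul hG

theorem EntryDeriv.mul_const {F : ℝ → Matrix ι κ ℂ} {F' : Matrix ι κ ℂ} {y : ℝ}
    (hF : EntryDeriv F F' y) (M : Matrix κ μ ℂ) :
    EntryDeriv (fun t => F t * M) (F' * M) y := by
  simpa using hF.mul (EntryDeriv.const M y)

theorem EntryDeriv.add {ι κ : Type*} {F G : ℝ → Matrix ι κ ℂ} {F' G' : Matrix ι κ ℂ} {y : ℝ}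
    (hF : EntryDeriv F F' y) (hG : EntryDeriv G G' y) :
    EntryDeriv (fun t => F t + G t) (F' + G') y :=
  fun i j => (hF i j).add (hG i j)

theorem EntryDeriv.sub {ι κ : Type*} {F G : ℝ → Matrix ι κ ℂ} {F' G' : Matrix ι κ ℂ} {y : ℝ}
    (hF : EntryDeriv F F' y) (hG : EntryDeriv G G' y) :
    EntryDeriv (fun t => F t - G t) (F' - G') y :=
  fun i j => (hF i j).sub (hG i j)

theorem EntryDeriv.neg {ι κ : Type*} {F : ℝ → Matrix ι κ ℂ} {F' : Matrix ι κ ℂ} {y : ℝ}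
    (hF : EntryDeriv F F' y) : EntryDeriv (fun t => -F t) (-F') y :=
  fun i j => (hF i j).neg

theorem EntryDeriv.conjTranspose {ι κ : Type*} {F : ℝ → Matrix ι κ ℂ} {F' : Matrix ι κ ℂ} {y : ℝ}
    (hF : EntryDeriv F F' y) : EntryDeriv (fun t => (F t)ᴴ) F'ᴴ y :=
  fun i j => (hF j i).star

theorem EntryDeriv.congr_of_eventuallyEq {ι κ : Type*} {F G : ℝ → Matrix ι κ ℂ}
    {F' : Matrix ι κ ℂ} {y : ℝ} (hF : EntryDeriv F F' y) (h : G =ᶠ[𝓝 y] F) : EntryDeriv G F' y :=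
  fun i j => (hF i j).congr_of_eventuallyEq (h.mono fun t ht => by simp [ht])

end EntryCalculus

/-! ### Matrix exponentials and inverses. -/

section ExpCalculus

variable {ι : Type*} [Fintype ι] [DecidableEq ι]

-- The real variable is separated from a complex constant so that e^{t𝒜}, e^{-t𝒜} and e^{-itβ} are
-- all covered by one rule.
open Matrix.Norms.Operator in
theorem entryDeriv_exp_smul (A : Matrix ι ι ℂ) (c : ℂ) (y : ℝ) :
    EntryDeriv (fun t : ℝ => NormedSpace.exp (((t : ℂ) * c) • A))
      ((c • A) * NormedSpace.exp (((y : ℂ) * c) • A)) y := by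
  have h := hasDerivAt_exp_smul_const' (𝕂 := ℂ) (c • A) (y : ℂ)
  have h1 := h.scomp y Complex.ofRealCLM.hasDerivAt
  simp only [Complex.ofRealCLM_apply, Complex.ofReal_one, one_smul] at h1
  intro i j
  have h2 : HasDerivAt (fun t : ℝ => NormedSpace.exp ((t : ℂ) • c • A) i j)
      ((c • A * NormedSpace.exp ((y : ℂ) • c • A)) i j) y := by
    have e := ((Matrix.entryLinearMap ℝ ℂ i j).toContinuousLinearMap :
      Matrix ι ι ℂ →L[ℝ] ℂ).hasFDerivAt.comp_hasDerivAt y h1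
    exact e
  simpa only [smul_smul] using h2

theorem exp_smul_comm (A : Matrix ι ι ℂ) (c : ℂ) :
    A * NormedSpace.exp (c • A) = NormedSpace.exp (c • A) * A :=
  (((Commute.refl A).smul_right c).exp_right).eq

theorem exp_smul_mul_exp_neg (A : Matrix ι ι ℂ) (c : ℂ) :
    NormedSpace.exp (c • A) * NormedSpace.exp ((-c) • A) = 1 := by
  rw [neg_smul, ← Matrix.exp_add_of_commute _ _ (Commute.refl (c • A)).neg_right]
  simp

theorem exp_neg_mul_exp_smul (A : Matrix ι ι ℂ) (c : ℂ) :
    NormedSpace.exp ((-c) • A) * NormedSpace.exp (c • A) = 1 := by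
  simpa using exp_smul_mul_exp_neg A (-c)

open Matrix.Norms.Operator in
theorem entryDeriv_inv {F : ℝ → Matrix ι ι ℂ} {F' : Matrix ι ι ℂ} {y : ℝ}
    (hF : EntryDeriv F F' y) (hu : IsUnit (F y)) :
    EntryDeriv (fun t => (F t)⁻¹) (-((F y)⁻¹ * F' * (F y)⁻¹)) y := by
  obtain ⟨u, hu⟩ := hu
  have hF1 : HasDerivAt F F' y := by
    have : HasDerivAt (fun t => ∑ i, ∑ j, Matrix.single i j (F t i j))
        (∑ i, ∑ j, Matrix.single i j (F' i j)) y := by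
      refine HasDerivAt.fun_sum fun i _ => HasDerivAt.fun_sum fun j _ => ?_
      have e := ((Matrix.singleLinearMap ℝ i j).toContinuousLinearMap :
        ℂ →L[ℝ] Matrix ι ι ℂ).hasFDerivAt.comp_hasDerivAt y (hF i j)
      exact e
    simpa only [← Matrix.matrix_eq_sum_single] using this
  have h := (hasFDerivAt_ringInverse (𝕜 := ℝ) u)
  rw [hu] at h
  have h2 := h.comp_hasDerivAt y hF1
  intro i j
  have e := ((Matrix.entryLinearMap ℝ ℂ i j).toContinuousLinearMap :
      Matrix ι ι ℂ →L[ℝ] ℂ).hasFDerivAt.comp_hasDerivAt y h2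
  simp only [Matrix.nonsing_inv_eq_ringInverse, ← hu, Ring.inverse_unit]
  exact e

theorem continuous_matrix_inv {F : ℝ → Matrix ι ι ℂ} (hF : Continuous F)
    (hu : ∀ y, IsUnit (F y)) : Continuous fun t => (F t)⁻¹ := by
  have : (fun t => (F t)⁻¹) = fun t => (F t).det⁻¹ • (F t).adjugate := by
    funext t
    rw [Matrix.inv_def, Ring.inverse_eq_inv]
  rw [this]
  refine Continuous.smul (Continuous.inv₀ hF.matrix_det fun t => ?_) hF.matrix_adjugate
  exact ((Matrix.isUnit_iff_isUnit_det _).1 (hu t)).ne_zero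

open Matrix.Norms.Operator in
theorem continuous_matrix_exp : Continuous (fun M : Matrix ι ι ℂ => NormedSpace.exp M) :=
  NormedSpace.exp_continuous

end ExpCalculus

/-! ### Scalar functions with finitely many possible jumps. -/

section PiecewiseContinuous

/-- Measurable, locally bounded, and continuous off `N`. -/
structure PwCont (N : Set ℝ) (f : ℝ → ℂ) : Prop where
  meas : Measurable f
  bdd : ∀ R : ℝ, ∃ C : ℝ, ∀ y, |y| ≤ R → ‖f y‖ ≤ C
  cont : ∀ y, y ∉ N → ContinuousAt f y

theorem PwCont.of_continuous {N : Set ℝ} {f : ℝ → ℂ} (hf : Continuous f) : PwCont N f where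
  meas := hf.measurable
  bdd R := by
    obtain ⟨C, hC⟩ := (isCompact_Icc (a := -R) (b := R)).exists_bound_of_continuousOn hf.continuousOn
    exact ⟨C, fun y hy => hC y (abs_le.1 hy)⟩
  cont y _ := hf.continuousAt

theorem PwCont.add {N : Set ℝ} {f g : ℝ → ℂ} (hf : PwCont N f) (hg : PwCont N g) :
    PwCont N fun y => f y + g y where
  meas := hf.meas.add hg.meas
  bdd R := by
    obtain ⟨C, hC⟩ := hf.bdd R
    obtain ⟨C', hC'⟩ := hg.bdd R
    exact ⟨C + C', fun y hy => (norm_add_le _ _).trans (add_le_add (hC y hy) (hC' y hy))⟩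
  cont y hy := (hf.cont y hy).add (hg.cont y hy)

theorem PwCont.mul {N : Set ℝ} {f g : ℝ → ℂ} (hf : PwCont N f) (hg : PwCont N g) :
    PwCont N fun y => f y * g y where
  meas := hf.meas.mul hg.meas
  bdd R := by
    obtain ⟨C, hC⟩ := hf.bdd R
    obtain ⟨C', hC'⟩ := hg.bdd R
    refine ⟨C * C', fun y hy => ?_⟩
    rw [norm_mul]
    exact mul_le_mul (hC y hy) (hC' y hy) (norm_nonneg _) ((norm_nonneg _).trans (hC y hy))
  cont y hy := (hf.cont y hy).mul (hg.cont y hy)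

theorem PwCont.neg {N : Set ℝ} {f : ℝ → ℂ} (hf : PwCont N f) : PwCont N fun y => -f y where
  meas := hf.meas.neg
  bdd R := by simpa using hf.bdd R
  cont y hy := (hf.cont y hy).neg

theorem PwCont.sub {N : Set ℝ} {f g : ℝ → ℂ} (hf : PwCont N f) (hg : PwCont N g) :
    PwCont N fun y => f y - g y := by
  simpa only [sub_eq_add_neg] using hf.add hg.neg

theorem PwCont.star {N : Set ℝ} {f : ℝ → ℂ} (hf : PwCont N f) : PwCont N fun y => star (f y) where
  meas := continuous_star.measurable.comp hf.meas
  bdd R := by simpa using hf.bdd R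
  cont y hy := (hf.cont y hy).star

theorem PwCont.sum {N : Set ℝ} {ι : Type*} (s : Finset ι) {f : ι → ℝ → ℂ}
    (hf : ∀ i ∈ s, PwCont N (f i)) : PwCont N fun y => ∑ i ∈ s, f i y := by
  classical
  induction s using Finset.induction_on with
  | empty => simpa using PwCont.of_continuous continuous_const
  | insert a s ha ih =>
    simp only [Finset.sum_insert ha]
    exact (hf a (Finset.mem_insert_self a s)).add
      (ih fun i hi => hf i (Finset.mem_insert_of_mem hi))

theorem PwCont.ite {N : Set ℝ} {f g : ℝ → ℂ} (hf : PwCont N f) (hg : PwCont N g) {c : ℝ}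
    (hc : c ∈ N) : PwCont N fun y => if y < c then f y else g y where
  meas := Measurable.ite measurableSet_Iio hf.meas hg.meas
  bdd R := by
    obtain ⟨C, hC⟩ := hf.bdd R
    obtain ⟨C', hC'⟩ := hg.bdd R
    refine ⟨max C C', fun y hy => ?_⟩
    split_ifs
    · exact (hC y hy).trans (le_max_left _ _)
    · exact (hC' y hy).trans (le_max_right _ _)
  cont y hy := by
    have hne : y ≠ c := fun h => hy (h ▸ hc)
    rcases lt_or_gt_of_ne hne with h | h
    · refine (hf.cont y hy).congr ?_
      filter_upwards [Iio_mem_nhds h] with t ht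
      exact (if_pos ht).symm
    · refine (hg.cont y hy).congr ?_
      filter_upwards [Ioi_mem_nhds h] with t ht
      exact (if_neg (not_lt.2 (le_of_lt ht))).symm

theorem PwCont.intervalIntegrable {N : Set ℝ} {f : ℝ → ℂ} (hf : PwCont N f) (a b : ℝ) :
    IntervalIntegrable f MeasureTheory.volume a b := by
  obtain ⟨C, hC⟩ := hf.bdd (max |a| |b|)
  rw [intervalIntegrable_iff]
  refine MeasureTheory.Measure.integrableOn_of_bounded (M := C) (by simp)
    hf.meas.aestronglyMeasurable ?_
  refine (MeasureTheory.ae_restrict_iff' measurableSet_uIoc).2 (Filter.Eventually.of_forall ?_)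
  intro y hy
  apply hC
  have := Set.uIoc_subset_uIcc hy
  rw [Set.mem_uIcc] at this
  rcases this with h | h
  · exact abs_le_max_abs_abs h.1 h.2
  · rw [max_comm]; exact abs_le_max_abs_abs h.1 h.2

theorem PwCont.continuous_integral {N : Set ℝ} {f : ℝ → ℂ} (hf : PwCont N f) (a : ℝ) :
    Continuous fun y => ∫ t in a..y, f t :=
  intervalIntegral.continuous_primitive (fun _ _ => hf.intervalIntegrable _ _) a

theorem PwCont.hasDerivAt_integral {N : Set ℝ} {f : ℝ → ℂ} (hf : PwCont N f) (a : ℝ) {y : ℝ}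
    (hy : y ∉ N) : HasDerivAt (fun y => ∫ t in a..y, f t) (f y) y :=
  intervalIntegral.integral_hasDerivAt_right (hf.intervalIntegrable _ _)
    hf.meas.stronglyMeasurable.stronglyMeasurableAtFilter (hf.cont y hy)

/-- The fundamental theorem of calculus tolerates a countable exceptional set as long as the
function is continuous across it. The conserved quantities below are differentiable only off the
jumps of 𝒜^×, and this is how they are shown to be constant. -/
theorem continuousOn_eq_of_deriv_zero {N : Set ℝ} (hN : N.Finite) {a b : ℝ} {f : ℝ → ℂ}
    (hf : ContinuousOn f (Set.Icc a b)) (hd : ∀ y ∈ Set.Ioo a b \ N, HasDerivAt f 0 y) {x y : ℝ}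
    (hx : x ∈ Set.Icc a b) (hy : y ∈ Set.Icc a b) : f x = f y := by
  have key : ∀ z ∈ Set.Icc a b, f z = f a := by
    intro z hz
    have := MeasureTheory.integral_eq_of_hasDerivAt_off_countable_of_le f (fun _ => 0) hz.1
      hN.countable (hf.mono (Set.Icc_subset_Icc_right hz.2))
      (fun t ht => hd t ⟨⟨ht.1.1, ht.1.2.trans_le hz.2⟩, ht.2⟩) (by simp)
    simp only [intervalIntegral.integral_zero] at this
    exact (sub_eq_zero.1 this.symm)
  rw [key x hx, key y hy]

end PiecewiseContinuous

/-! ### Entrywise integration of matrix functions. -/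

section MatrixIntegral

variable {ι κ μ : Type*} [Fintype κ]

/-- Entrywise integral of a matrix function. -/
def entryInt {ι κ : Type*} (F : ℝ → Matrix ι κ ℂ) (a b : ℝ) : Matrix ι κ ℂ :=
  Matrix.of fun i j => ∫ y in a..b, F y i j

/-- Entrywise piecewise continuity. -/
def MPwCont {ι κ : Type*} (N : Set ℝ) (F : ℝ → Matrix ι κ ℂ) : Prop :=
  ∀ i j, PwCont N fun y => F y i j

theorem MPwCont.of_continuous {ι κ : Type*} {N : Set ℝ} {F : ℝ → Matrix ι κ ℂ} (hF : Continuous F) :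
    MPwCont N F :=
  fun i j => PwCont.of_continuous (hF.matrix_elem i j)

theorem MPwCont.const {ι κ : Type*} {N : Set ℝ} (M : Matrix ι κ ℂ) : MPwCont N fun _ => M :=
  MPwCont.of_continuous continuous_const

theorem MPwCont.add {ι κ : Type*} {N : Set ℝ} {F G : ℝ → Matrix ι κ ℂ} (hF : MPwCont N F)
    (hG : MPwCont N G) : MPwCont N fun y => F y + G y :=
  fun i j => (hF i j).add (hG i j)

theorem MPwCont.sub {ι κ : Type*} {N : Set ℝ} {F G : ℝ → Matrix ι κ ℂ} (hF : MPwCont N F)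
    (hG : MPwCont N G) : MPwCont N fun y => F y - G y :=
  fun i j => (hF i j).sub (hG i j)

theorem MPwCont.mul {N : Set ℝ} {F : ℝ → Matrix ι κ ℂ} {G : ℝ → Matrix κ μ ℂ} (hF : MPwCont N F)
    (hG : MPwCont N G) : MPwCont N fun y => F y * G y := fun i j => by
  simp only [Matrix.mul_apply]
  exact PwCont.sum _ fun k _ => (hF i k).mul (hG k j)

theorem MPwCont.conjTranspose {ι κ : Type*} {N : Set ℝ} {F : ℝ → Matrix ι κ ℂ}
    (hF : MPwCont N F) : MPwCont N fun y => (F y)ᴴ :=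
  fun i j => (hF j i).star

theorem MPwCont.ite {ι κ : Type*} {N : Set ℝ} {F G : ℝ → Matrix ι κ ℂ} (hF : MPwCont N F)
    (hG : MPwCont N G) {c : ℝ} (hc : c ∈ N) : MPwCont N fun y => if y < c then F y else G y :=
  fun i j => by
    have := (hF i j).ite (hG i j) hc
    refine cast ?_ this
    congr 1
    funext y
    split_ifs with h <;> simp [h]

theorem MPwCont.intervalIntegrable {ι κ : Type*} {N : Set ℝ} {F : ℝ → Matrix ι κ ℂ}
    (hF : MPwCont N F) (a b : ℝ) (i : ι) (j : κ) :
    IntervalIntegrable (fun y => F y i j) MeasureTheory.volume a b :=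
  (hF i j).intervalIntegrable a b

theorem MPwCont.continuous_entryInt {ι κ : Type*} {N : Set ℝ} {F : ℝ → Matrix ι κ ℂ}
    (hF : MPwCont N F) (a : ℝ) : Continuous fun y => entryInt F a y :=
  continuous_matrix fun i j => (hF i j).continuous_integral a

theorem MPwCont.entryDeriv_entryInt {ι κ : Type*} {N : Set ℝ} {F : ℝ → Matrix ι κ ℂ}
    (hF : MPwCont N F) (a : ℝ) {y : ℝ} (hy : y ∉ N) :
    EntryDeriv (fun y => entryInt F a y) (F y) y :=
  fun i j => (hF i j).hasDerivAt_integral a hy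

theorem entryInt_same {ι κ : Type*} (F : ℝ → Matrix ι κ ℂ) (a : ℝ) : entryInt F a a = 0 := by
  ext i j; simp [entryInt]

theorem MPwCont.entryInt_add_adjacent {ι κ : Type*} {N : Set ℝ} {F : ℝ → Matrix ι κ ℂ}
    (hF : MPwCont N F) (a b c : ℝ) : entryInt F a b + entryInt F b c = entryInt F a c := by
  ext i j
  exact intervalIntegral.integral_add_adjacent_intervals (hF.intervalIntegrable a b i j)
    (hF.intervalIntegrable b c i j)

theorem MPwCont.entryInt_add {ι κ : Type*} {N : Set ℝ} {F G : ℝ → Matrix ι κ ℂ}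
    (hF : MPwCont N F) (hG : MPwCont N G) (a b : ℝ) :
    entryInt (fun y => F y + G y) a b = entryInt F a b + entryInt G a b := by
  ext i j
  exact intervalIntegral.integral_add (hF.intervalIntegrable a b i j)
    (hG.intervalIntegrable a b i j)

theorem MPwCont.entryInt_sub {ι κ : Type*} {N : Set ℝ} {F G : ℝ → Matrix ι κ ℂ}
    (hF : MPwCont N F) (hG : MPwCont N G) (a b : ℝ) :
    entryInt (fun y => F y - G y) a b = entryInt F a b - entryInt G a b := by
  ext i j
  exact intervalIntegral.integral_sub (hF.intervalIntegrable a b i j)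
    (hG.intervalIntegrable a b i j)

theorem entryInt_neg {ι κ : Type*} (F : ℝ → Matrix ι κ ℂ) (a b : ℝ) :
    entryInt (fun y => -F y) a b = -entryInt F a b := by
  ext i j
  exact intervalIntegral.integral_neg

theorem entryInt_conjTranspose {ι κ : Type*} (F : ℝ → Matrix ι κ ℂ) (a b : ℝ) :
    entryInt (fun y => (F y)ᴴ) a b = (entryInt F a b)ᴴ := by
  ext i j
  simp only [entryInt, Matrix.of_apply, Matrix.conjTranspose_apply]
  exact intervalIntegral.intervalIntegral_conj (f := fun y => F y j i)

theorem MPwCont.entryInt_mul_const {N : Set ℝ} {F : ℝ → Matrix ι κ ℂ}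
    (hF : MPwCont N F) (M : Matrix κ μ ℂ) (a b : ℝ) :
    entryInt (fun y => F y * M) a b = entryInt F a b * M := by
  ext i j
  simp only [entryInt, Matrix.of_apply, Matrix.mul_apply]
  rw [intervalIntegral.integral_finsetSum
    fun k _ => (hF.intervalIntegrable a b i k).mul_const _]
  simp

theorem MPwCont.entryInt_const_mul {N : Set ℝ} {F : ℝ → Matrix κ μ ℂ}
    (M : Matrix ι κ ℂ) (hF : MPwCont N F) (a b : ℝ) :
    entryInt (fun y => M * F y) a b = M * entryInt F a b := by
  ext i j
  simp only [entryInt, Matrix.of_apply, Matrix.mul_apply]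
  rw [intervalIntegral.integral_finsetSum
    fun k _ => (hF.intervalIntegrable a b k j).const_mul _]
  simp

theorem entryInt_congr {ι κ : Type*} {F G : ℝ → Matrix ι κ ℂ} {a b : ℝ} (hab : a ≤ b)
    {N : Set ℝ} (hN : N.Finite) (h : ∀ y ∈ Set.Ioo a b \ N, F y = G y) :
    entryInt F a b = entryInt G a b := by
  ext i j
  refine intervalIntegral.integral_congr_ae ?_
  have h0 : ∀ᵐ y ∂(MeasureTheory.volume : MeasureTheory.Measure ℝ), y ∉ N ∪ {b} :=
    ((hN.union (Set.finite_singleton b)).countable.ae_notMem _)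
  filter_upwards [h0] with y hy hy'
  rw [Set.uIoc_of_le hab] at hy'
  rw [h y ⟨⟨hy'.1, lt_of_le_of_ne hy'.2 fun e => hy (Or.inr e)⟩, fun e => hy (Or.inl e)⟩]

/-- Fundamental theorem of calculus for matrix functions differentiable off a finite set. -/
theorem entryInt_eq_sub {ι κ : Type*} {N : Set ℝ} (hN : N.Finite) {a b : ℝ} (hab : a ≤ b)
    {F F' : ℝ → Matrix ι κ ℂ} (hF : Continuous F) (hF' : MPwCont N F')
    (hd : ∀ y ∈ Set.Ioo a b \ N, EntryDeriv F (F' y) y) :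
    entryInt F' a b = F b - F a := by
  ext i j
  exact MeasureTheory.integral_eq_of_hasDerivAt_off_countable_of_le _ _ hab hN.countable
    (hF.matrix_elem i j).continuousOn (fun y hy => hd y hy i j) (hF'.intervalIntegrable a b i j)

theorem eq_of_entryDeriv_zero {ι κ : Type*} {N : Set ℝ} (hN : N.Finite) {a b : ℝ}
    {F : ℝ → Matrix ι κ ℂ} (hF : Continuous F) (hd : ∀ y ∈ Set.Ioo a b \ N, EntryDeriv F 0 y)
    {x y : ℝ} (hx : x ∈ Set.Icc a b) (hy : y ∈ Set.Icc a b) : F x = F y := by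
  ext i j
  exact continuousOn_eq_of_deriv_zero hN (hF.matrix_elem i j).continuousOn
    (fun y hy => hd y hy i j) hx hy

end MatrixIntegral

/-! ### Plancherel's identity on L¹ ∩ L². -/

section Plancherel

open MeasureTheory FourierTransform SchwartzMap

/-- Both transforms have the same pairing with every test function: the L² one because it agrees
with the distributional transform, the integral one by the multiplication formula ∫ ĝ f = ∫ g f̂. -/
theorem toLp_fourier_ae_eq {f : ℝ → ℂ} (hf : Integrable f) (hf2 : MemLp f 2) :
    ((𝓕 (hf2.toLp f) : Lp ℂ 2 (volume : Measure ℝ)) : ℝ → ℂ) =ᵐ[volume] 𝓕 f := by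
  have hcont : Continuous (𝓕 f) := VectorFourier.fourierIntegral_continuous
    Real.continuous_fourierChar (by exact continuous_inner) hf
  refine ae_eq_of_integral_contDiff_smul_eq
    ((Lp.memLp _).locallyIntegrable (by norm_num)) hcont.locallyIntegrable ?_
  intro g hg hgs
  have hgs' : HasCompactSupport (fun x => (g x : ℂ)) := hgs.comp_left (g := Complex.ofReal) rfl
  have hg' : ContDiff ℝ (⊤ : ℕ∞) (fun x => (g x : ℂ)) := Complex.ofRealCLM.contDiff.comp hg
  set G : 𝓢(ℝ, ℂ) := hgs'.toSchwartzMap hg' with hG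
  have h1 := congrArg (fun T => T G) (Lp.fourier_toTemperedDistribution_eq (hf2.toLp f))
  simp only [TemperedDistribution.fourier_apply, Lp.toTemperedDistribution_apply] at h1
  have hGx : ∀ x, G x = (g x : ℂ) := fun x => rfl
  have h2 : ∫ x, (𝓕 G) x • (hf2.toLp f) x = ∫ x, (𝓕 G) x • f x := by
    refine integral_congr_ae ?_
    filter_upwards [hf2.coeFn_toLp] with x hx
    rw [hx]
  have h3 : ∫ ξ, (𝓕 (G : ℝ → ℂ)) ξ • f ξ = ∫ x, G x • 𝓕 f x := by
    have := VectorFourier.integral_fourierIntegral_smul_eq_flip (e := Real.fourierChar)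
      (L := innerₗ ℝ) (μ := volume) (ν := volume) Real.continuous_fourierChar
      (by exact continuous_inner) (G.integrable (μ := volume)) hf
    simpa using! this
  rw [h2, SchwartzMap.fourier_coe] at h1
  rw [h3] at h1
  simpa [hGx] using h1.symm

theorem memLp_fourier {f : ℝ → ℂ} (hf : Integrable f) (hf2 : MemLp f 2) : MemLp (𝓕 f) 2 :=
  (memLp_congr_ae (toLp_fourier_ae_eq hf hf2)).1 (Lp.memLp _)

/-- Plancherel's identity for functions in `L¹ ∩ L²`. -/
theorem integral_star_fourier_mul_fourier {f g : ℝ → ℂ} (hf : Integrable f) (hf2 : MemLp f 2)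
    (hg : Integrable g) (hg2 : MemLp g 2) :
    ∫ ξ, star (𝓕 f ξ) * 𝓕 g ξ = ∫ x, star (f x) * g x := by
  have h := Lp.inner_fourier_eq (hf2.toLp f) (hg2.toLp g)
  rw [L2.inner_def, L2.inner_def] at h
  have h1 : ∫ ξ, inner ℂ ((𝓕 (hf2.toLp f) : Lp ℂ 2 (volume : Measure ℝ)) ξ)
      ((𝓕 (hg2.toLp g) : Lp ℂ 2 (volume : Measure ℝ)) ξ) = ∫ ξ, star (𝓕 f ξ) * 𝓕 g ξ := by
    refine integral_congr_ae ?_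
    filter_upwards [toLp_fourier_ae_eq hf hf2, toLp_fourier_ae_eq hg hg2] with x hx hx'
    rw [hx, hx', RCLike.inner_apply', Complex.star_def]
  have h2 : ∫ ξ, inner ℂ ((hf2.toLp f) ξ) ((hg2.toLp g) ξ) = ∫ ξ, star (f ξ) * g ξ := by
    refine integral_congr_ae ?_
    filter_upwards [hf2.coeFn_toLp, hg2.coeFn_toLp] with x hx hx'
    rw [hx, hx', RCLike.inner_apply', Complex.star_def]
  rw [← h1, ← h2, h]

theorem integrable_star_mul {f g : ℝ → ℂ} (hf : MemLp f 2) (hg : MemLp g 2) :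
    Integrable fun x => star (f x) * g x := by
  have := hf.star.integrable_mul hg
  exact this

end Plancherel

/-! ### What an arbitrary realization inherits from the poles of φ. -/

section Resolvent

open Polynomial

theorem tendsto_eval_div_pow (P : ℂ[X]) {N : ℕ} (hN : P.natDegree ≤ N) :
    Tendsto (fun z => P.eval z / z ^ N) (Bornology.cobounded ℂ) (𝓝 (P.coeff N)) := by
  have h1 : Tendsto (fun z : ℂ => ∑ k ∈ Finset.range (N + 1), P.coeff k * (z⁻¹) ^ (N - k))
      (Bornology.cobounded ℂ) (𝓝 (∑ k ∈ Finset.range (N + 1), P.coeff k * (0 : ℂ) ^ (N - k))) :=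
    tendsto_finsetSum _ fun k _ => (tendsto_inv₀_cobounded.pow _).const_mul _
  have h2 : ∑ k ∈ Finset.range (N + 1), P.coeff k * (0 : ℂ) ^ (N - k) = P.coeff N := by
    rw [Finset.sum_range_succ, Finset.sum_eq_zero]
    · simp
    · intro k hk
      rw [zero_pow (Nat.sub_ne_zero_of_lt (Finset.mem_range.1 hk)), mul_zero]
  rw [h2] at h1
  refine h1.congr' ?_
  filter_upwards [Bornology.eventually_ne_cobounded (0 : ℂ)] with z hz
  rw [Polynomial.eval_eq_sum_range' (Nat.lt_succ_of_le hN), Finset.sum_div]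
  refine Finset.sum_congr rfl fun k hk => ?_
  have hk' : k ≤ N := Nat.lt_succ_iff.1 (Finset.mem_range.1 hk)
  rw [mul_div_assoc, inv_pow]
  congr 1
  rw [eq_div_iff (pow_ne_zero _ hz), ← Nat.sub_add_cancel hk', pow_add,
    ← mul_assoc, Nat.sub_add_cancel hk', inv_mul_cancel₀ (pow_ne_zero _ hz), one_mul]

theorem eventually_eval_ne_zero {q : ℂ[X]} (hq : q ≠ 0) :
    ∀ᶠ z in Bornology.cobounded ℂ, q.eval z ≠ 0 := by
  have : {z | q.eval z = 0}.Finite := by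
    refine (q.roots.toFinset.finite_toSet).subset fun z hz => ?_
    simpa [hq] using hz
  filter_upwards [Bornology.isBounded_def.1 this.isBounded] with z hz using hz

/-- If N = deg P were at least deg q, then q/z^N would converge, so P/z^N = (P/q)(q/z^N) would tend
to 0. Its limit is the leading coefficient of P. -/
theorem degree_lt_of_tendsto_div {P q : ℂ[X]} (hq : q ≠ 0)
    (h : Tendsto (fun z => P.eval z / q.eval z) (Bornology.cobounded ℂ) (𝓝 0)) :
    P.degree < q.degree := by
  by_contra hlt
  rw [not_lt] at hlt
  have hP : P ≠ 0 := by
    rintro rfl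
    simp only [degree_zero, le_bot_iff, degree_eq_bot] at hlt
    exact hq hlt
  have hnd : q.natDegree ≤ P.natDegree := natDegree_le_natDegree hlt
  have h1 := h.mul (tendsto_eval_div_pow q hnd)
  rw [zero_mul] at h1
  have h2 : Tendsto (fun z => P.eval z / z ^ P.natDegree) (Bornology.cobounded ℂ) (𝓝 0) := by
    refine h1.congr' ?_
    filter_upwards [eventually_eval_ne_zero hq] with z hz
    field_simp
  have := tendsto_nhds_unique h2 (tendsto_eval_div_pow P le_rfl)
  exact hP (leadingCoeff_eq_zero.1 this.symm)

theorem eq_zero_of_tendsto_eval {P : ℂ[X]}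
    (h : Tendsto (fun z => P.eval z) (Bornology.cobounded ℂ) (𝓝 0)) : P = 0 := by
  have := degree_lt_of_tendsto_div (P := P) (q := 1) one_ne_zero (by simpa using h)
  rw [degree_one] at this
  by_contra hP
  have h0 := zero_le_degree_iff.2 hP
  exact absurd this (not_lt.2 h0)

variable {n p m : ℕ}

theorem isUnit_sub_smul_one_iff (β : Matrix (Fin n) (Fin n) ℂ) (z : ℂ) :
    z ∉ spectrum ℂ β ↔ IsUnit (β - z • (1 : Matrix (Fin n) (Fin n) ℂ)) := by
  rw [spectrum.notMem_iff, Algebra.algebraMap_eq_smul_one, ← IsUnit.neg_iff, neg_sub]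

theorem eventually_notMem_spectrum (β : Matrix (Fin n) (Fin n) ℂ) :
    ∀ᶠ z in Bornology.cobounded ℂ, z ∉ spectrum ℂ β := by
  have h := Bornology.isBounded_def.1 (Matrix.finite_spectrum β).isBounded
  filter_upwards [h] with z hz using hz

open Matrix.Norms.Operator in
theorem tendsto_resolvent_entry (β : Matrix (Fin n) (Fin n) ℂ) (Y : Matrix (Fin m) (Fin n) ℂ)
    (Θ : Matrix (Fin n) (Fin p) ℂ) (i : Fin m) (j : Fin p) :
    Tendsto (fun z => (Y * (β - z • (1 : Matrix (Fin n) (Fin n) ℂ))⁻¹ * Θ) i j)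
      (Bornology.cobounded ℂ) (𝓝 0) := by
  have h := spectrum.resolvent_tendsto_cobounded (𝕜 := ℂ) β
  have h2 : Continuous fun M : Matrix (Fin n) (Fin n) ℂ => (Y * (-M) * Θ) i j :=
    ((continuous_const.matrix_mul continuous_neg).matrix_mul continuous_const).matrix_elem i j
  have h3 := (h2.tendsto 0).comp h
  simp only [neg_zero, Matrix.mul_zero, Matrix.zero_mul, Matrix.zero_apply] at h3
  refine h3.congr fun z => ?_
  simp only [Function.comp, resolvent, Algebra.algebraMap_eq_smul_one]
  rw [← Matrix.nonsing_inv_eq_ringInverse, ← neg_sub, ← neg_one_smul ℂ (β - _)]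
  by_cases hz : IsUnit (β - z • (1 : Matrix (Fin n) (Fin n) ℂ))
  · have : (-1 : ℂ) • (β - z • (1 : Matrix (Fin n) (Fin n) ℂ)) =
        -(β - z • (1 : Matrix (Fin n) (Fin n) ℂ)) := by simp
    rw [this]
    have e : (-(β - z • (1 : Matrix (Fin n) (Fin n) ℂ)))⁻¹ =
        -(β - z • (1 : Matrix (Fin n) (Fin n) ℂ))⁻¹ := by
      refine Matrix.inv_eq_left_inv ?_
      rw [neg_mul_neg, Matrix.nonsing_inv_mul _ ((Matrix.isUnit_iff_isUnit_det _).1 hz)]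
    rw [e, neg_neg]
  -- At an eigenvalue both inverses are 0 by convention, so the sign change still holds.
  · have hz' : ¬ IsUnit ((-1 : ℂ) • (β - z • (1 : Matrix (Fin n) (Fin n) ℂ))) := by
      rwa [neg_one_smul, IsUnit.neg_iff]
    rw [Matrix.isUnit_iff_isUnit_det] at hz hz'
    rw [Matrix.nonsing_inv_apply_not_isUnit _ hz, Matrix.nonsing_inv_apply_not_isUnit _ hz']
    simp

theorem mul_inv_sub_smul {β : Matrix (Fin n) (Fin n) ℂ} {z : ℂ} (hz : z ∉ spectrum ℂ β) :
    β * (β - z • (1 : Matrix (Fin n) (Fin n) ℂ))⁻¹ =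
      1 + z • (β - z • (1 : Matrix (Fin n) (Fin n) ℂ))⁻¹ := by
  have h := Matrix.mul_nonsing_inv _
    ((Matrix.isUnit_iff_isUnit_det _).1 ((isUnit_sub_smul_one_iff β z).1 hz))
  rw [Matrix.sub_mul, Matrix.smul_mul, Matrix.one_mul] at h
  exact sub_eq_iff_eq_add.1 h

/-- `Y r(β) (β - z)⁻¹ Θ = r(z) Y (β - z)⁻¹ Θ` up to a polynomial in `z`. -/
theorem exists_polynomial_resolvent (β : Matrix (Fin n) (Fin n) ℂ) (Y : Matrix (Fin m) (Fin n) ℂ)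
    (Θ : Matrix (Fin n) (Fin p) ℂ) (i : Fin m) (j : Fin p) (r : ℂ[X]) :
    ∃ T : ℂ[X], ∀ z, z ∉ spectrum ℂ β →
      (Y * aeval β r * (β - z • (1 : Matrix (Fin n) (Fin n) ℂ))⁻¹ * Θ) i j =
        r.eval z * (Y * (β - z • (1 : Matrix (Fin n) (Fin n) ℂ))⁻¹ * Θ) i j + T.eval z := by
  induction r using Polynomial.induction_on with
  | C a =>
    refine ⟨0, fun z _ => ?_⟩
    simp [Algebra.algebraMap_eq_smul_one]
  | add r₁ r₂ h₁ h₂ =>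
    obtain ⟨T₁, h₁⟩ := h₁
    obtain ⟨T₂, h₂⟩ := h₂
    refine ⟨T₁ + T₂, fun z hz => ?_⟩
    rw [map_add, Matrix.mul_add, Matrix.add_mul, Matrix.add_mul, Matrix.add_apply, h₁ z hz,
      h₂ z hz, eval_add, eval_add]
    ring
  | monomial k a h =>
    obtain ⟨T, h⟩ := h
    -- Since β(β - z)⁻¹ = 1 + z(β - z)⁻¹, one more factor β multiplies the old remainder by z and
    -- adds a constant.
    refine ⟨X * T + C ((Y * aeval β (C a * X ^ k) * Θ) i j), fun z hz => ?_⟩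
    have e : Y * aeval β (C a * X ^ (k + 1)) * (β - z • (1 : Matrix (Fin n) (Fin n) ℂ))⁻¹ * Θ =
        Y * aeval β (C a * X ^ k) * Θ +
          z • (Y * aeval β (C a * X ^ k) * (β - z • (1 : Matrix (Fin n) (Fin n) ℂ))⁻¹ * Θ) := by
      rw [pow_succ, ← mul_assoc, map_mul (aeval β) (C a * X ^ k) X, aeval_X]
      simp only [Matrix.mul_assoc]
      rw [← Matrix.mul_assoc β, mul_inv_sub_smul hz]
      simp only [Matrix.add_mul, Matrix.mul_add, Matrix.one_mul, Matrix.smul_mul, Matrix.mul_smul]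
    rw [e, Matrix.add_apply, Matrix.smul_apply, h z hz]
    simp only [eval_add, eval_mul, eval_C, eval_pow, eval_X, smul_eq_mul]
    ring

/-- Y β (β - z)⁻¹ Θ equals YΘ wherever Y (β - z)⁻¹ Θ vanishes, and it tends to 0 at infinity. So YΘ
= 0, and Yβ satisfies the hypothesis that Y satisfied; the moments follow one after another. -/
theorem mul_pow_mul_eq_zero {β : Matrix (Fin n) (Fin n) ℂ} {Θ : Matrix (Fin n) (Fin p) ℂ} (k : ℕ) :
    ∀ {Y : Matrix (Fin m) (Fin n) ℂ},
    (∀ᶠ z in Bornology.cobounded ℂ, Y * (β - z • (1 : Matrix (Fin n) (Fin n) ℂ))⁻¹ * Θ = 0) →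
      Y * β ^ k * Θ = 0 := by
  have base : ∀ {Y : Matrix (Fin m) (Fin n) ℂ},
    (∀ᶠ z in Bornology.cobounded ℂ, Y * (β - z • (1 : Matrix (Fin n) (Fin n) ℂ))⁻¹ * Θ = 0) →
      Y * Θ = 0 ∧ (∀ᶠ z in Bornology.cobounded ℂ,
        Y * β * (β - z • (1 : Matrix (Fin n) (Fin n) ℂ))⁻¹ * Θ = 0) := by
    intro Y hY
    have h1 : ∀ᶠ z in Bornology.cobounded ℂ,
        Y * β * (β - z • (1 : Matrix (Fin n) (Fin n) ℂ))⁻¹ * Θ = Y * Θ := by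
      filter_upwards [hY, eventually_notMem_spectrum β] with z hz hz'
      rw [Matrix.mul_assoc Y, mul_inv_sub_smul hz', Matrix.mul_add, Matrix.mul_smul, Matrix.add_mul,
        Matrix.smul_mul, hz, smul_zero, add_zero, Matrix.mul_one]
    have h0 : Y * Θ = 0 := by
      ext i j
      refine tendsto_nhds_unique (f := fun _ : ℂ => (Y * Θ) i j) tendsto_const_nhds
        ((tendsto_resolvent_entry β (Y * β) Θ i j).congr' ?_)
      filter_upwards [h1] with z hz
      rw [hz]
    exact ⟨h0, h1.mono fun z hz => hz.trans h0⟩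
  induction k with
  | zero => intro Y hY; simpa using (base hY).1
  | succ k ih =>
    intro Y hY
    have := ih (base hY).2
    rwa [pow_succ', ← Matrix.mul_assoc]

variable {d : Fin p → ℝ} {φ : Matrix (Fin p) (Fin p) (RatFunc ℂ)}
  {β : Matrix (Fin n) (Fin n) ℂ} {Θ₁ Θ₂ : Matrix (Fin n) (Fin p) ℂ}

theorem exists_polynomial_of_denom_dvd {f : RatFunc ℂ} {q : ℂ[X]} (h : f.denom ∣ q) :
    ∃ P : ℂ[X], ∀ z, q.eval z ≠ 0 → f.eval (RingHom.id ℂ) z = P.eval z / q.eval z := by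
  obtain ⟨c, rfl⟩ := h
  refine ⟨c * f.num, fun z hz => ?_⟩
  rw [eval_mul] at hz
  simp only [RatFunc.eval, eval_mul, eval₂_id]
  rw [mul_comm (eval z c), mul_div_mul_right _ _ (right_ne_zero_of_mul hz)]

/-- Up to a polynomial the expression is q(z)(φ(z) - iD/2), itself a polynomial because q clears the
denominators. It tends to 0 at infinity, hence is zero. This replaces minimality: only the poles of
φ matter, not the spectrum of β. -/
theorem IsRealization.aeval_mul_resolvent_eq_zero (hR : IsRealization d φ β Θ₁ Θ₂) {q : ℂ[X]}
    (hq : q ≠ 0) (hden : ∀ i j, (φ i j).denom ∣ q) {z : ℂ} (hz : z ∉ spectrum ℂ β)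
    (hqz : q.eval z ≠ 0) :
    Θ₁ᴴ * aeval β q * (β - z • (1 : Matrix (Fin n) (Fin n) ℂ))⁻¹ * Θ₂ = 0 := by
  ext i j
  obtain ⟨P, hP⟩ := exists_polynomial_of_denom_dvd (hden i j)
  obtain ⟨T, hT⟩ := exists_polynomial_resolvent β Θ₁ᴴ Θ₂ i j q
  set S : ℂ[X] := P - C (((Complex.I / 2) • D d) i j) * q + T with hS
  have key : ∀ z, z ∉ spectrum ℂ β → q.eval z ≠ 0 →
      (Θ₁ᴴ * aeval β q * (β - z • (1 : Matrix (Fin n) (Fin n) ℂ))⁻¹ * Θ₂) i j = S.eval z := by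
    intro z hz hqz
    have h1 := congrFun (congrFun (hR z hz) i) j
    rw [Matrix.add_apply] at h1
    have h2 : evalAt φ z i j = P.eval z / q.eval z := hP z hqz
    rw [hT z hz, hS, eval_add, eval_sub, eval_mul, eval_C]
    rw [h2, div_eq_iff hqz] at h1
    rw [h1]; ring
  have hS0 : S = 0 := by
    refine eq_zero_of_tendsto_eval ((tendsto_resolvent_entry β (Θ₁ᴴ * aeval β q) Θ₂ i j).congr' ?_)
    filter_upwards [eventually_notMem_spectrum β, eventually_eval_ne_zero hq] with z hz hqz
    exact key z hz hqz
  rw [key z hz hqz, hS0, eval_zero, Matrix.zero_apply]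

theorem IsRealization.aeval_mul_pow_eq_zero (hR : IsRealization d φ β Θ₁ Θ₂) {q : ℂ[X]}
    (hq : q ≠ 0) (hden : ∀ i j, (φ i j).denom ∣ q) (k : ℕ) :
    Θ₁ᴴ * aeval β q * β ^ k * Θ₂ = 0 := by
  refine mul_pow_mul_eq_zero k ?_
  filter_upwards [eventually_notMem_spectrum β, eventually_eval_ne_zero hq] with z hz hqz
  exact hR.aeval_mul_resolvent_eq_zero hq hden hz hqz

/-- The resolvent commutes with polynomials in β, so it can be moved to the right, where the
preceding facts apply. The extra resolvent is needed to control the antiderivative in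
`integral_laplace`. -/
theorem IsRealization.inv_mul_aeval_mul_pow_eq_zero (hR : IsRealization d φ β Θ₁ Θ₂) {q : ℂ[X]}
    (hq : q ≠ 0) (hden : ∀ i j, (φ i j).denom ∣ q) {z : ℂ} (hz : z ∉ spectrum ℂ β)
    (hqz : q.eval z ≠ 0) (k : ℕ) :
    Θ₁ᴴ * (β - z • (1 : Matrix (Fin n) (Fin n) ℂ))⁻¹ * aeval β q * β ^ k * Θ₂ = 0 := by
  set R := (β - z • (1 : Matrix (Fin n) (Fin n) ℂ))⁻¹ with hRdef
  have hu := (Matrix.isUnit_iff_isUnit_det _).1 ((isUnit_sub_smul_one_iff β z).1 hz)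
  have hc : Commute R β := by
    have h1 : Commute (β - z • (1 : Matrix (Fin n) (Fin n) ℂ)) β :=
      (Commute.refl β).sub_left ((Commute.one_left β).smul_left z)
    calc R * β = R * β * ((β - z • (1 : Matrix (Fin n) (Fin n) ℂ)) * R) := by
          rw [Matrix.mul_nonsing_inv _ hu, Matrix.mul_one]
      _ = R * (β - z • (1 : Matrix (Fin n) (Fin n) ℂ)) * β * R := by
          rw [Matrix.mul_assoc R, ← Matrix.mul_assoc β, ← h1.eq]
          simp only [Matrix.mul_assoc]
      _ = β * R := by rw [Matrix.nonsing_inv_mul _ hu, Matrix.one_mul]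
  have hcq : R * aeval β q = aeval β q * R := by
    have : aeval β q ∈ Algebra.adjoin ℂ {β} := Polynomial.aeval_mem_adjoin_singleton ℂ β
    exact (Algebra.commute_of_mem_adjoin_singleton_of_commute this hc).eq
  have hk : ∀ k, Θ₁ᴴ * aeval β q * β ^ k * R * Θ₂ = 0 := by
    intro k
    induction k with
    | zero => simpa using hR.aeval_mul_resolvent_eq_zero hq hden hz hqz
    | succ k ih =>
      rw [pow_succ, ← Matrix.mul_assoc, Matrix.mul_assoc _ β R, mul_inv_sub_smul hz,
        Matrix.mul_add, Matrix.add_mul, Matrix.mul_one, hR.aeval_mul_pow_eq_zero hq hden k,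
        Matrix.mul_smul, Matrix.smul_mul, ih, smul_zero, add_zero]
  have := hk k
  rw [Matrix.mul_assoc _ (β ^ k) R, ← (hc.pow_right k).eq, ← Matrix.mul_assoc,
    Matrix.mul_assoc Θ₁ᴴ, ← hcq, ← Matrix.mul_assoc] at this
  exact this

end Resolvent

/-! ### Subexponential growth of the kernel and its Laplace transform. -/

section Growth

open Polynomial

variable {n p m : ℕ}

open Matrix.Norms.Operator in
theorem mul_exp_mul_eq_zero {β : Matrix (Fin n) (Fin n) ℂ} {Θ : Matrix (Fin n) (Fin p) ℂ}
    {Y : Matrix (Fin m) (Fin n) ℂ} (h : ∀ k, Y * β ^ k * Θ = 0) (c : ℂ) :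
    Y * NormedSpace.exp (c • β) * Θ = 0 := by
  ext i j
  have h1 := NormedSpace.exp_series_hasSum_exp' (𝕂 := ℂ) (c • β)
  have hcont : Continuous fun M : Matrix (Fin n) (Fin n) ℂ => (Y * M * Θ) i j :=
    ((continuous_const.matrix_mul continuous_id).matrix_mul continuous_const).matrix_elem i j
  let L : Matrix (Fin n) (Fin n) ℂ →+ ℂ :=
    { toFun := fun M => (Y * M * Θ) i j
      map_zero' := by simp
      map_add' := fun M N => by simp [Matrix.mul_add, Matrix.add_mul] }
  have h2 := h1.map L hcont
  have h3 : (L ∘ fun k : ℕ => ((k.factorial : ℂ)⁻¹) • (c • β) ^ k) = fun _ => 0 := by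
    funext k
    have := congrFun (congrFun (h k) i) j
    change (Y * ((k.factorial : ℂ)⁻¹ • (c • β) ^ k) * Θ) i j = 0
    rw [_root_.smul_pow, smul_smul, Matrix.mul_smul, Matrix.smul_mul, Matrix.smul_apply, this]
    simp
  rw [h3] at h2
  exact h2.unique hasSum_zero

/-- If a polynomial with all its roots in the closed lower half-plane annihilates `Y e^{-iuβ} Θ`,
then this function grows slower than any exponential. -/
theorem exp_growth {β : Matrix (Fin n) (Fin n) ℂ} {Θ : Matrix (Fin n) (Fin p) ℂ}
    (s : Multiset ℂ) (hs : ∀ μ ∈ s, μ.im ≤ 0) :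
    ∀ (Y : Matrix (Fin m) (Fin n) ℂ),
      (∀ k, Y * aeval β (s.map fun μ => X - C μ).prod * β ^ k * Θ = 0) →
      ∀ ε : ℝ, 0 < ε → ∀ i j, ∃ K : ℝ, 0 ≤ K ∧ ∀ u : ℝ, 0 ≤ u →
        ‖(Y * NormedSpace.exp (((u : ℂ) * -Complex.I) • β) * Θ) i j‖ ≤ K * Real.exp (ε * u) := by
  induction s using Multiset.induction_on with
  | empty =>
    intro Y h ε _ i j
    refine ⟨0, le_rfl, fun u _ => ?_⟩
    rw [mul_exp_mul_eq_zero (fun k => by simpa using h k)]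
    simp
  | cons μ s ih =>
    intro Y h ε hε i j
    -- One linear factor is absorbed into Y. Half of ε is kept back to pay for the integration
    -- below.
    obtain ⟨K, hK0, hK⟩ := ih (fun ν hν => hs ν (Multiset.mem_cons_of_mem hν)) (Y * (β - μ • (1 : Matrix (Fin n) (Fin n) ℂ)))
      (fun k => by
        have := h k
        rw [Multiset.map_cons, Multiset.prod_cons, map_mul, map_sub, aeval_X, aeval_C,
          Algebra.algebraMap_eq_smul_one] at this
        rwa [Matrix.mul_assoc Y])
      (ε / 2) (by positivity) i j
    have hμ : μ.im ≤ 0 := hs μ (Multiset.mem_cons_self _ _)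
    set f : ℝ → ℂ := fun u => (Y * NormedSpace.exp (((u : ℂ) * -Complex.I) • β) * Θ) i j with hf
    set f1 : ℝ → ℂ := fun u =>
      (Y * (β - μ • (1 : Matrix (Fin n) (Fin n) ℂ)) *
      NormedSpace.exp (((u : ℂ) * -Complex.I) • β) * Θ) i j with hf1
    have hfd : ∀ u : ℝ, HasDerivAt f (-Complex.I * f1 u - Complex.I * μ * f u) u := by
      intro u
      have h1 := ((entryDeriv_exp_smul β (-Complex.I) u).const_mul Y).mul_const Θ i j
      refine h1.congr_deriv ?_
      simp only [hf, hf1, Matrix.mul_sub, Matrix.sub_mul, Matrix.sub_apply, Matrix.mul_smul,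
        Matrix.smul_mul, Matrix.smul_apply, smul_eq_mul, Matrix.mul_one, Matrix.mul_assoc]
      ring
    -- An integrating factor for f' = -i f₁ - iμ f. Its modulus e^{-u Im μ} is nondecreasing and at
    -- least 1, because Im μ ≤ 0; so a bound on g over [0, u] can be divided by it.
    set g : ℝ → ℂ := fun u => Complex.exp (Complex.I * μ * u) * f u with hg
    have hgd : ∀ u : ℝ, HasDerivAt g (-Complex.I * (Complex.exp (Complex.I * μ * u) * f1 u)) u := by
      intro u
      have h1 : HasDerivAt (fun u : ℝ => Complex.exp (Complex.I * μ * u))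
          (Complex.exp (Complex.I * μ * u) * (Complex.I * μ)) u := by
        have := ((Complex.ofRealCLM.hasDerivAt (x := u)).const_mul (Complex.I * μ)).cexp
        simpa using this
      refine (h1.mul (hfd u)).congr_deriv ?_
      ring
    have hnorm : ∀ u : ℝ, ‖Complex.exp (Complex.I * μ * u)‖ = Real.exp (-μ.im * u) := by
      intro u
      rw [Complex.norm_exp]
      simp
    -- The length u of the interval of integration is bounded by (2/ε) e^{εu/2}.
    refine ⟨‖f 0‖ + K * (2 / ε), by positivity, fun u hu => ?_⟩
    have hb : ‖g u - g 0‖ ≤ Real.exp (-μ.im * u) * (K * Real.exp (ε / 2 * u)) * (u - 0) := by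
      refine norm_image_sub_le_of_norm_deriv_le_segment' (f := g) (a := 0) (b := u)
        (fun x _ => (hgd x).hasDerivWithinAt) (fun x hx => ?_) u ⟨hu, le_rfl⟩
      rw [norm_mul, norm_neg, Complex.norm_I, one_mul, norm_mul, hnorm]
      refine mul_le_mul (Real.exp_le_exp.2 ?_) ((hK x hx.1).trans ?_) (norm_nonneg _)
        (Real.exp_pos _).le
      · exact mul_le_mul_of_nonneg_left hx.2.le (by linarith)
      · exact mul_le_mul_of_nonneg_left (Real.exp_le_exp.2
          (mul_le_mul_of_nonneg_left hx.2.le (by positivity))) hK0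
    have h0 : g 0 = f 0 := by simp [hg]
    have hgu : ‖g u‖ = Real.exp (-μ.im * u) * ‖f u‖ := by rw [hg, norm_mul, hnorm]
    have h2 : Real.exp (-μ.im * u) * ‖f u‖ ≤
        ‖f 0‖ + Real.exp (-μ.im * u) * (K * Real.exp (ε / 2 * u)) * u := by
      rw [← hgu, ← h0]
      calc ‖g u‖ = ‖g 0 + (g u - g 0)‖ := by congr 1; ring
        _ ≤ ‖g 0‖ + ‖g u - g 0‖ := norm_add_le _ _
        _ ≤ _ := by rw [sub_zero] at hb; gcongr
    have hE : 1 ≤ Real.exp (-μ.im * u) := Real.one_le_exp (mul_nonneg (by linarith) hu)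
    have h3 : u ≤ 2 / ε * Real.exp (ε / 2 * u) := by
      have : ε / 2 * u ≤ Real.exp (ε / 2 * u) := by
        have := Real.add_one_le_exp (ε / 2 * u); linarith
      calc u = 2 / ε * (ε / 2 * u) := by field_simp
        _ ≤ _ := by gcongr
    have h4 : Real.exp (ε / 2 * u) * Real.exp (ε / 2 * u) = Real.exp (ε * u) := by
      rw [← Real.exp_add]; congr 1; ring
    have h5 : ‖f u‖ ≤ ‖f 0‖ + K * Real.exp (ε / 2 * u) * u := by
      have hfle : ‖f 0‖ ≤ Real.exp (-μ.im * u) * ‖f 0‖ :=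
        le_mul_of_one_le_left (norm_nonneg _) hE
      refine le_of_mul_le_mul_left ?_ (Real.exp_pos (-μ.im * u))
      calc _ ≤ _ := h2
        _ ≤ Real.exp (-μ.im * u) * ‖f 0‖ +
            Real.exp (-μ.im * u) * (K * Real.exp (ε / 2 * u)) * u := by gcongr
        _ = _ := by ring
    have h6 : 1 ≤ Real.exp (ε * u) := Real.one_le_exp (by positivity)
    calc ‖f u‖ ≤ ‖f 0‖ + K * Real.exp (ε / 2 * u) * u := h5
      _ ≤ ‖f 0‖ * Real.exp (ε * u) +
          K * Real.exp (ε / 2 * u) * (2 / ε * Real.exp (ε / 2 * u)) := by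
        gcongr
        exact le_mul_of_one_le_right (norm_nonneg _) h6
      _ = (‖f 0‖ + K * (2 / ε)) * Real.exp (ε * u) := by rw [← h4]; ring

/-- The kernel `Θ₁* e^{-iuβ} Θ₂`. -/
def kernelExp (β : Matrix (Fin n) (Fin n) ℂ) (Θ₁ Θ₂ : Matrix (Fin n) (Fin p) ℂ) (u : ℝ) :
    Matrix (Fin p) (Fin p) ℂ :=
  Θ₁ᴴ * NormedSpace.exp (((u : ℂ) * -Complex.I) • β) * Θ₂

theorem continuous_kernelExp (β : Matrix (Fin n) (Fin n) ℂ) (Θ₁ Θ₂ : Matrix (Fin n) (Fin p) ℂ) :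
    Continuous (kernelExp β Θ₁ Θ₂) := by
  unfold kernelExp
  refine (continuous_const.matrix_mul (continuous_matrix_exp.comp ?_)).matrix_mul continuous_const
  fun_prop

variable {d : Fin p → ℝ} {φ : Matrix (Fin p) (Fin p) (RatFunc ℂ)}
  {β : Matrix (Fin n) (Fin n) ℂ} {Θ₁ Θ₂ : Matrix (Fin n) (Fin p) ℂ}

theorem exists_common_denom (φ : Matrix (Fin p) (Fin p) (RatFunc ℂ)) :
    ∃ q : ℂ[X], q ≠ 0 ∧ (∀ i j, (φ i j).denom ∣ q) ∧
      ∀ z, (∀ i j, (φ i j).denom.eval z ≠ 0) → q.eval z ≠ 0 := by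
  refine ⟨∏ i, ∏ j, (φ i j).denom, ?_, ?_, ?_⟩
  · exact Finset.prod_ne_zero_iff.2 fun i _ => Finset.prod_ne_zero_iff.2 fun j _ =>
      RatFunc.denom_ne_zero _
  · intro i j
    exact (Finset.dvd_prod_of_mem (fun j => (φ i j).denom) (Finset.mem_univ j)).trans
      (Finset.dvd_prod_of_mem (fun i => ∏ j, (φ i j).denom) (Finset.mem_univ i))
  · intro z hz
    simp only [eval_prod]
    exact Finset.prod_ne_zero_iff.2 fun i _ => Finset.prod_ne_zero_iff.2 fun j _ => hz i j

theorem growth_of_aeval {Y : Matrix (Fin m) (Fin n) ℂ} {q : ℂ[X]} (hq : q ≠ 0)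
    (him : ∀ z : ℂ, 0 < z.im → q.eval z ≠ 0) (h : ∀ k, Y * aeval β q * β ^ k * Θ₂ = 0)
    {ε : ℝ} (hε : 0 < ε) (i : Fin m) (j : Fin p) : ∃ K : ℝ, 0 ≤ K ∧ ∀ u : ℝ, 0 ≤ u →
      ‖(Y * NormedSpace.exp (((u : ℂ) * -Complex.I) • β) * Θ₂) i j‖ ≤ K * Real.exp (ε * u) := by
  have hsplit := (IsAlgClosed.splits q).eq_prod_roots
  refine exp_growth q.roots (fun μ hμ => ?_) Y (fun k => ?_) ε hε i j
  · by_contra hlt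
    exact him μ (not_le.1 hlt) ((mem_roots hq).1 hμ)
  · have := h k
    rw [hsplit, map_mul, aeval_C, Algebra.algebraMap_eq_smul_one, smul_mul_assoc, one_mul,
      Matrix.mul_smul, Matrix.smul_mul, Matrix.smul_mul] at this
    exact (smul_eq_zero.1 this).resolve_left (leadingCoeff_ne_zero.2 hq)

theorem kernelExp_growth (hφ : IsAdmissible d φ) (hR : IsRealization d φ β Θ₁ Θ₂)
    {ε : ℝ} (hε : 0 < ε) (i j : Fin p) : ∃ K : ℝ, 0 ≤ K ∧ ∀ u : ℝ, 0 ≤ u →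
      ‖kernelExp β Θ₁ Θ₂ u i j‖ ≤ K * Real.exp (ε * u) := by
  obtain ⟨q, hq, hden, hev⟩ := exists_common_denom φ
  exact growth_of_aeval hq (fun z hz => hev z (hφ.no_pole z hz))
    (hR.aeval_mul_pow_eq_zero hq hden) hε i j

theorem integrableOn_laplace (hφ : IsAdmissible d φ) (hR : IsRealization d φ β Θ₁ Θ₂)
    {z : ℂ} (hz : 0 < z.im) (i j : Fin p) :
    MeasureTheory.IntegrableOn
      (fun u : ℝ => Complex.exp (Complex.I * z * u) * kernelExp β Θ₁ Θ₂ u i j) (Set.Ioi 0) := by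
  obtain ⟨K, hK0, hK⟩ := kernelExp_growth hφ hR (half_pos hz) i j
  refine MeasureTheory.Integrable.mono'
    ((exp_neg_integrableOn_Ioi 0 (half_pos hz)).const_mul K) ?_ ?_
  · refine Continuous.aestronglyMeasurable ?_
    exact (by fun_prop : Continuous fun u : ℝ => Complex.exp (Complex.I * z * u)).mul
      ((continuous_kernelExp β Θ₁ Θ₂).matrix_elem i j)
  · refine (MeasureTheory.ae_restrict_iff' measurableSet_Ioi).2 (Eventually.of_forall fun u hu => ?_)
    rw [norm_mul, Complex.norm_exp]
    have h1 : (Complex.I * z * (u : ℂ)).re = -z.im * u := by simp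
    rw [h1]
    calc _ ≤ Real.exp (-z.im * u) * (K * Real.exp (z.im / 2 * u)) := by
          gcongr; exact hK u (le_of_lt hu)
      _ = K * (Real.exp (-z.im * u) * Real.exp (z.im / 2 * u)) := by ring
      _ = _ := by rw [← Real.exp_add]; congr 2; ring

/-- The integrand has the antiderivative i e^{izu} Θ₁* (β - z)⁻¹ e^{-iuβ} Θ₂. The exponential alone
may blow up, but between these two factors it is annihilated by q(β), grows subexponentially, and
loses against e^{izu}. Only the value at 0 survives. -/
theorem integral_laplace (hφ : IsAdmissible d φ) (hR : IsRealization d φ β Θ₁ Θ₂)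
    {z : ℂ} (hz : 0 < z.im) (hzs : z ∉ spectrum ℂ β) (i j : Fin p) :
    ∫ u in Set.Ioi (0 : ℝ), Complex.exp (Complex.I * z * u) * kernelExp β Θ₁ Θ₂ u i j =
      -Complex.I * (Θ₁ᴴ * (β - z • (1 : Matrix (Fin n) (Fin n) ℂ))⁻¹ * Θ₂) i j := by
  obtain ⟨q, hq, hden, hev⟩ := exists_common_denom φ
  have him : ∀ z : ℂ, 0 < z.im → q.eval z ≠ 0 := fun z hz => hev z (hφ.no_pole z hz)
  set R := (β - z • (1 : Matrix (Fin n) (Fin n) ℂ))⁻¹ with hRdef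
  obtain ⟨K, hK0, hK⟩ := growth_of_aeval hq him
    (hR.inv_mul_aeval_mul_pow_eq_zero hq hden hzs (him z hz)) (half_pos hz) i j
  have hRinv : R * (β - z • (1 : Matrix (Fin n) (Fin n) ℂ)) = 1 :=
    Matrix.nonsing_inv_mul _ ((Matrix.isUnit_iff_isUnit_det _).1 ((isUnit_sub_smul_one_iff β z).1 hzs))
  set G : ℝ → ℂ := fun u => Complex.exp (Complex.I * z * u) * (Complex.I *
    (Θ₁ᴴ * R * NormedSpace.exp (((u : ℂ) * -Complex.I) • β) * Θ₂) i j) with hG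
  have hGd : ∀ u : ℝ, HasDerivAt G
      (Complex.exp (Complex.I * z * u) * kernelExp β Θ₁ Θ₂ u i j) u := by
    intro u
    have h1 : HasDerivAt (fun u : ℝ => Complex.exp (Complex.I * z * u))
        (Complex.exp (Complex.I * z * u) * (Complex.I * z)) u := by
      have := ((Complex.ofRealCLM.hasDerivAt (x := u)).const_mul (Complex.I * z)).cexp
      simpa using this
    have h2 := ((entryDeriv_exp_smul β (-Complex.I) u).const_mul (Θ₁ᴴ * R)).mul_const Θ₂ i j
    refine (h1.mul (h2.const_mul Complex.I)).congr_deriv ?_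
    have h3 : kernelExp β Θ₁ Θ₂ u = Θ₁ᴴ * R * (β * NormedSpace.exp (((u : ℂ) * -Complex.I) • β)) * Θ₂
        - z • (Θ₁ᴴ * R * NormedSpace.exp (((u : ℂ) * -Complex.I) • β) * Θ₂) := by
      have : Θ₁ᴴ = Θ₁ᴴ * R * β - z • (Θ₁ᴴ * R) := by
        rw [Matrix.mul_assoc, ← Matrix.mul_smul, ← Matrix.mul_sub]
        conv_lhs => rw [← Matrix.mul_one Θ₁ᴴ, ← hRinv, Matrix.mul_sub, Matrix.mul_smul, Matrix.mul_one]
      unfold kernelExp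
      conv_lhs => rw [this]
      simp only [Matrix.sub_mul, Matrix.smul_mul, Matrix.mul_assoc]
    rw [h3]
    simp only [Matrix.sub_apply, Matrix.smul_apply, Matrix.smul_mul, Matrix.mul_smul, smul_eq_mul]
    ring_nf
    simp only [Complex.I_sq]
    ring
  have hlim : Tendsto G atTop (𝓝 0) := by
    have hb : Tendsto (fun u : ℝ => K * Real.exp (-(z.im / 2) * u)) atTop (𝓝 0) := by
      have : Tendsto (fun u : ℝ => -(z.im / 2) * u) atTop atBot :=
        tendsto_id.const_mul_atTop_of_neg (by linarith)
      simpa using (Real.tendsto_exp_atBot.comp this).const_mul K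
    refine squeeze_zero_norm' ?_ hb
    filter_upwards [eventually_ge_atTop (0 : ℝ)] with u hu
    rw [hG, norm_mul, norm_mul, Complex.norm_I, one_mul, Complex.norm_exp]
    have h1 : (Complex.I * z * (u : ℂ)).re = -z.im * u := by simp
    rw [h1]
    calc _ ≤ Real.exp (-z.im * u) * (K * Real.exp (z.im / 2 * u)) := by
          gcongr; exact hK u hu
      _ = K * (Real.exp (-z.im * u) * Real.exp (z.im / 2 * u)) := by ring
      _ = _ := by rw [← Real.exp_add]; congr 2; ring
  rw [MeasureTheory.integral_Ioi_of_hasDerivAt_of_tendsto (hGd 0).continuousAt.continuousWithinAt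
    (fun u _ => hGd u) (integrableOn_laplace hφ hR hz i j) hlim]
  simp [hG]

end Growth

/-! ### Fourier transforms of bounded functions supported in [0, a]. -/

section Positivity

open MeasureTheory FourierTransform

/-- Measurable, bounded, and zero off `[0, a]`. -/
structure BddSupp (a : ℝ) (f : ℝ → ℂ) : Prop where
  meas : Measurable f
  bdd : ∃ M : ℝ, 0 ≤ M ∧ ∀ y, ‖f y‖ ≤ M
  supp : ∀ y, y ∉ Set.Icc 0 a → f y = 0

theorem BddSupp.exists_le_indicator {a : ℝ} {f : ℝ → ℂ} (hf : BddSupp a f) :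
    ∃ M : ℝ, 0 ≤ M ∧ ∀ y, ‖f y‖ ≤ (Set.Icc 0 a).indicator (fun _ => M) y := by
  obtain ⟨M, hM0, hM⟩ := hf.bdd
  refine ⟨M, hM0, fun y => ?_⟩
  by_cases hy : y ∈ Set.Icc 0 a
  · rw [Set.indicator_of_mem hy]; exact hM y
  · rw [Set.indicator_of_notMem hy, hf.supp y hy, norm_zero]

theorem integrable_indicator_Icc_const (a b M : ℝ) :
    Integrable ((Set.Icc a b).indicator fun _ => M) :=
  (integrable_indicator_iff measurableSet_Icc).2 (integrableOn_const (by simp))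

theorem BddSupp.integrable {a : ℝ} {f : ℝ → ℂ} (hf : BddSupp a f) : Integrable f := by
  obtain ⟨M, _, hM⟩ := hf.exists_le_indicator
  exact (integrable_indicator_Icc_const 0 a M).mono' hf.meas.aestronglyMeasurable
    (Eventually.of_forall hM)

theorem memLp_two_of_bounded {f : ℝ → ℂ} (hf : Integrable f) {M : ℝ} (hM : ∀ y, ‖f y‖ ≤ M) :
    MemLp f 2 := by
  have h1 : MemLp f 1 := memLp_one_iff_integrable.2 hf
  have h2 : MemLp f ⊤ := memLp_top_of_bound hf.1 M (Eventually.of_forall hM)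
  refine (memLp_two_iff_integrable_sq_norm hf.1).2 ((hf.norm.const_mul M).mono'
    (hf.1.norm.pow 2) (Eventually.of_forall fun y => ?_))
  rw [Real.norm_of_nonneg (sq_nonneg _), sq]
  exact mul_le_mul_of_nonneg_right (hM y) (norm_nonneg _)

theorem BddSupp.memLp {a : ℝ} {f : ℝ → ℂ} (hf : BddSupp a f) : MemLp f 2 := by
  obtain ⟨M, _, hM⟩ := hf.bdd
  exact memLp_two_of_bounded hf.integrable hM

theorem fourier_eq_integral (f : ℝ → ℂ) (ξ : ℝ) :
    𝓕 f ξ = ∫ t : ℝ, Complex.exp (-2 * Real.pi * Complex.I * t * ξ) * f t := by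
  rw [Real.fourier_real_eq_integral_exp_smul]
  refine integral_congr_ae (Eventually.of_forall fun t => ?_)
  simp only [smul_eq_mul]
  congr 2
  push_cast
  ring

/-- The Fourier transform of a bounded function with compact support extends to an entire function. -/
theorem BddSupp.differentiable_fourierLaplace {a : ℝ} {f : ℝ → ℂ} (hf : BddSupp a f) :
    Differentiable ℂ fun ζ : ℂ => ∫ t : ℝ, Complex.exp (-2 * Real.pi * Complex.I * t * ζ) * f t := by
  obtain ⟨M, hM0, hM⟩ := hf.exists_le_indicator
  intro ζ₀
  set B : ℝ := 2 * Real.pi * |a| * (Real.exp (2 * Real.pi * |a| * (‖ζ₀‖ + 1)) * M) with hB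
  have hexp : ∀ ζ : ℂ, Continuous fun t : ℝ => Complex.exp (-2 * Real.pi * Complex.I * t * ζ) :=
    fun ζ => by fun_prop
  have hmeas : ∀ ζ : ℂ, AEStronglyMeasurable
      (fun t : ℝ => Complex.exp (-2 * Real.pi * Complex.I * t * ζ) * f t) volume := fun ζ =>
    (hexp ζ).aestronglyMeasurable.mul hf.meas.aestronglyMeasurable
  have hnorm : ∀ t ∈ Set.Icc (0 : ℝ) a, ∀ ζ : ℂ, ‖ζ‖ ≤ ‖ζ₀‖ + 1 →
      ‖Complex.exp (-2 * Real.pi * Complex.I * t * ζ)‖ ≤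
        Real.exp (2 * Real.pi * |a| * (‖ζ₀‖ + 1)) := by
    intro t ht ζ hζ
    refine (Complex.norm_exp_le_exp_norm _).trans (Real.exp_le_exp.2 ?_)
    have h1 : |t| ≤ |a| := by
      rw [abs_of_nonneg ht.1]; exact ht.2.trans (le_abs_self a)
    have h2 : ‖(-2 * Real.pi * Complex.I * t * ζ : ℂ)‖ = 2 * Real.pi * |t| * ‖ζ‖ := by
      simp [abs_of_pos Real.pi_pos]
    rw [h2]
    have := Real.pi_pos
    gcongr
  have key := hasDerivAt_integral_of_dominated_loc_of_deriv_le (μ := volume)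
    (F := fun (ζ : ℂ) (t : ℝ) => Complex.exp (-2 * Real.pi * Complex.I * t * ζ) * f t)
    (F' := fun (ζ : ℂ) (t : ℝ) => (-2 * Real.pi * Complex.I * t) *
      (Complex.exp (-2 * Real.pi * Complex.I * t * ζ) * f t))
    (x₀ := ζ₀) (bound := (Set.Icc 0 a).indicator fun _ => B)
    (Metric.ball_mem_nhds ζ₀ one_pos) (Eventually.of_forall hmeas) ?_ ?_ ?_ ?_ ?_
  · exact key.2.differentiableAt
  · refine (integrable_indicator_Icc_const 0 a
      (Real.exp (2 * Real.pi * |a| * (‖ζ₀‖ + 1)) * M)).mono' (hmeas ζ₀) ?_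
    refine Eventually.of_forall fun t => ?_
    by_cases ht : t ∈ Set.Icc 0 a
    · rw [Set.indicator_of_mem ht, norm_mul]
      have := hM t
      rw [Set.indicator_of_mem ht] at this
      exact mul_le_mul (hnorm t ht ζ₀ (by linarith)) this (norm_nonneg _) (Real.exp_pos _).le
    · rw [Set.indicator_of_notMem ht, hf.supp t ht, mul_zero, norm_zero]
  · exact (by fun_prop : Continuous fun t : ℝ =>
      (-2 * Real.pi * Complex.I * t : ℂ)).aestronglyMeasurable.mul (hmeas ζ₀)
  · refine Eventually.of_forall fun t ζ hζ => ?_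
    by_cases ht : t ∈ Set.Icc 0 a
    · rw [Set.indicator_of_mem ht, norm_mul]
      have h0 := hM t
      rw [Set.indicator_of_mem ht] at h0
      have h1 : |t| ≤ |a| := by
        rw [abs_of_nonneg ht.1]; exact ht.2.trans (le_abs_self a)
      have h2 : ‖(-2 * Real.pi * Complex.I * t : ℂ)‖ = 2 * Real.pi * |t| := by
        simp [abs_of_pos Real.pi_pos]
      have hζ' : ‖ζ‖ ≤ ‖ζ₀‖ + 1 := by
        have := norm_le_norm_add_norm_sub' ζ ζ₀
        rw [Metric.mem_ball, dist_eq_norm] at hζ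
        linarith
      rw [h2, norm_mul, hB]
      have := Real.pi_pos
      exact mul_le_mul (by gcongr) (mul_le_mul (hnorm t ht ζ hζ') h0 (norm_nonneg _)
        (Real.exp_pos _).le) (by positivity) (by positivity)
    · rw [Set.indicator_of_notMem ht, hf.supp t ht, mul_zero, mul_zero, norm_zero]
  · exact integrable_indicator_Icc_const 0 a B
  · refine Eventually.of_forall fun t ζ _ => ?_
    have h1 : HasDerivAt (fun ζ : ℂ => Complex.exp (-2 * Real.pi * Complex.I * t * ζ))
        (Complex.exp (-2 * Real.pi * Complex.I * t * ζ) * (-2 * Real.pi * Complex.I * t)) ζ := by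
      have := ((hasDerivAt_id ζ).const_mul (-2 * Real.pi * Complex.I * t : ℂ)).cexp
      simpa using this
    refine (h1.mul_const (f t)).congr_deriv ?_
    ring

/-- A bounded function with compact support whose Fourier transform vanishes on a half-line is zero
almost everywhere. -/
theorem BddSupp.ae_eq_zero {a : ℝ} {f : ℝ → ℂ} (hf : BddSupp a f) {R : ℝ}
    (h : ∀ ξ, R < ξ → 𝓕 f ξ = 0) : f =ᵐ[volume] 0 := by
  set F : ℂ → ℂ := fun ζ => ∫ t : ℝ, Complex.exp (-2 * Real.pi * Complex.I * t * ζ) * f t with hF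
  have hFan : AnalyticOnNhd ℂ F Set.univ := fun ζ _ =>
    hf.differentiable_fourierLaplace.analyticAt ζ
  have hFξ : ∀ ξ : ℝ, 𝓕 f ξ = F ξ := fun ξ => fourier_eq_integral f ξ
  -- The zeros on the half-line accumulate at R + 1, so the identity theorem makes the entire
  -- extension vanish.
  have hfreq : ∃ᶠ ζ in 𝓝[≠] ((R + 1 : ℝ) : ℂ), F ζ = 0 := by
    have h1 : Tendsto (fun ξ : ℝ => (ξ : ℂ)) (𝓝[≠] (R + 1)) (𝓝[≠] ((R + 1 : ℝ) : ℂ)) := by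
      refine tendsto_nhdsWithin_iff.2
        ⟨(Complex.continuous_ofReal.tendsto _).mono_left nhdsWithin_le_nhds, ?_⟩
      filter_upwards [self_mem_nhdsWithin] with ξ hξ
      exact fun e => hξ (Complex.ofReal_injective e)
    refine h1.frequently (Eventually.frequently ?_)
    have : Set.Ioi R ∈ 𝓝 (R + 1) := Ioi_mem_nhds (by linarith)
    filter_upwards [mem_nhdsWithin_of_mem_nhds this] with ξ hξ
    rw [← hFξ]; exact h ξ hξ
  have hzero : ∀ ζ, F ζ = 0 := fun ζ =>
    congrFun (hFan.eq_of_frequently_eq (g := fun _ => 0) (fun _ _ => analyticAt_const) hfreq) ζ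
  have hpl := integral_star_fourier_mul_fourier hf.integrable hf.memLp hf.integrable hf.memLp
  have h0 : ∫ x, ‖f x‖ ^ 2 = 0 := by
    have e : ∫ x, star (f x) * f x = ∫ x, ((‖f x‖ ^ 2 : ℝ) : ℂ) := by
      refine integral_congr_ae (Eventually.of_forall fun x => ?_)
      simp only [Complex.star_def, Complex.conj_mul']
      push_cast; rfl
    rw [e, integral_complex_ofReal] at hpl
    have : ∫ ξ, star (𝓕 f ξ) * 𝓕 f ξ = 0 := by simp [hFξ, hzero]
    rw [this] at hpl
    exact_mod_cast hpl.symm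
  have hint : Integrable fun x => ‖f x‖ ^ 2 :=
    (memLp_two_iff_integrable_sq_norm hf.integrable.1).1 hf.memLp
  have := (integral_eq_zero_iff_of_nonneg (fun x => sq_nonneg _) hint).1 h0
  filter_upwards [this] with x hx
  simpa using hx

end Positivity

/-! ### Strict positivity of the convolution form. -/

section Positivity

open MeasureTheory FourierTransform

variable {n p : ℕ} {d : Fin p → ℝ} {φ : Matrix (Fin p) (Fin p) (RatFunc ℂ)}
  {β : Matrix (Fin n) (Fin n) ℂ} {Θ₁ Θ₂ : Matrix (Fin n) (Fin p) ℂ}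

/-- The function `e^{ηt} Θ₁* e^{itβ} Θ₂` of `t < 0`, extended by zero. -/
def dampedKernel (β : Matrix (Fin n) (Fin n) ℂ) (Θ₁ Θ₂ : Matrix (Fin n) (Fin p) ℂ) (η : ℝ)
    (i j : Fin p) (t : ℝ) : ℂ :=
  if t < 0 then (Real.exp (η * t) : ℂ) * kernelExp β Θ₁ Θ₂ (-t) i j else 0

theorem dampedKernel_neg (η ξ : ℝ) (i j : Fin p) (u : ℝ) :
    Complex.exp (2 * Real.pi * Complex.I * u * ξ) * dampedKernel β Θ₁ Θ₂ η i j (-u) =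
      (Set.Ioi (0 : ℝ)).indicator (fun u : ℝ =>
        Complex.exp (Complex.I * ((2 * Real.pi * ξ : ℝ) + η * Complex.I) * u) *
          kernelExp β Θ₁ Θ₂ u i j) u := by
  by_cases hu : 0 < u
  · rw [Set.indicator_of_mem (Set.mem_Ioi.2 hu), dampedKernel, if_pos (neg_lt_zero.2 hu), neg_neg,
      ← mul_assoc, Complex.ofReal_exp, ← Complex.exp_add]
    congr 2
    push_cast
    ring_nf
    rw [Complex.I_sq]
    ring
  · rw [Set.indicator_of_notMem (by simpa using hu), dampedKernel,
      if_neg (by simpa using hu), mul_zero]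

theorem integrable_dampedKernel (hφ : IsAdmissible d φ) (hR : IsRealization d φ β Θ₁ Θ₂) {η : ℝ}
    (hη : 0 < η) (i j : Fin p) : Integrable (dampedKernel β Θ₁ Θ₂ η i j) := by
  have h := (integrableOn_laplace hφ hR (z := ((2 * Real.pi * 0 : ℝ) : ℂ) + η * Complex.I)
    (by simpa using hη) i j).integrable_indicator measurableSet_Ioi
  have h2 : Integrable fun u => dampedKernel β Θ₁ Θ₂ η i j (-u) := by
    refine h.congr (Eventually.of_forall fun u => ?_)
    rw [← dampedKernel_neg]
    simp
  simpa using h2.comp_neg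

theorem fourier_dampedKernel (hφ : IsAdmissible d φ) (hR : IsRealization d φ β Θ₁ Θ₂) {η ξ : ℝ}
    (hη : 0 < η) (hs : ((2 * Real.pi * ξ : ℝ) : ℂ) + η * Complex.I ∉ spectrum ℂ β) (i j : Fin p) :
    𝓕 (dampedKernel β Θ₁ Θ₂ η i j) ξ = -Complex.I * (Θ₁ᴴ * (β -
      (((2 * Real.pi * ξ : ℝ) : ℂ) + η * Complex.I) • (1 : Matrix (Fin n) (Fin n) ℂ))⁻¹ * Θ₂) i j := by
  rw [fourier_eq_integral, ← integral_neg_eq_self,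
    ← integral_laplace hφ hR (by simpa using hη) hs i j, ← integral_indicator measurableSet_Ioi]
  refine integral_congr_ae (Eventually.of_forall fun u => ?_)
  simp only
  rw [← dampedKernel_neg]
  congr 2
  push_cast
  ring

/-- The quadratic form of the operator with the kernel `D δ(y - z) + 2 k(y - z)`, where `k` is the
damped kernel. -/
def dampedForm (d : Fin p → ℝ) (β : Matrix (Fin n) (Fin n) ℂ) (Θ₁ Θ₂ : Matrix (Fin n) (Fin p) ℂ)
    (η : ℝ) (h : Fin p → ℝ → ℂ) : ℂ :=
  ∑ i, ∑ j, (D d i j * (∫ y, star (h i y) * h j y) +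
    2 * ∫ y, star (h i y) * ∫ z, dampedKernel β Θ₁ Θ₂ η i j (y - z) * h j z)

/-- Convolution with the damped kernel becomes multiplication by -iΘ₁*(β - z)⁻¹Θ₂ at z = 2πξ + iη.
Hence D plus twice this symbol is -2iφ(z), provided the line Im z = η misses the spectrum of β. The
convolution is both integrable and bounded, so Plancherel's identity applies to it. -/
theorem dampedForm_eq (hφ : IsAdmissible d φ) (hR : IsRealization d φ β Θ₁ Θ₂) {η : ℝ}
    (hη : 0 < η) (hs : ∀ z ∈ spectrum ℂ β, z.im ≠ η) {a : ℝ} {h : Fin p → ℝ → ℂ}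
    (hh : ∀ j, BddSupp a (h j)) :
    Integrable (fun ξ => ∑ i, ∑ j, star (𝓕 (h i) ξ) *
      (-2 * Complex.I * evalAt φ (((2 * Real.pi * ξ : ℝ) : ℂ) + η * Complex.I) i j) * 𝓕 (h j) ξ) ∧
    dampedForm d β Θ₁ Θ₂ η h = ∫ ξ, ∑ i, ∑ j, star (𝓕 (h i) ξ) *
      (-2 * Complex.I * evalAt φ (((2 * Real.pi * ξ : ℝ) : ℂ) + η * Complex.I) i j) *
        𝓕 (h j) ξ := by
  have hns : ∀ ξ : ℝ, ((2 * Real.pi * ξ : ℝ) : ℂ) + η * Complex.I ∉ spectrum ℂ β := by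
    intro ξ hmem
    exact hs _ hmem (by simp)
  set κ := dampedKernel β Θ₁ Θ₂ η with hκ
  have hκi : ∀ i j, Integrable (κ i j) := integrable_dampedKernel hφ hR hη
  set c : Fin p → Fin p → ℝ → ℂ := fun i j y => ∫ z, κ i j (y - z) * h j z with hc
  have hconv : ∀ i j, c i j = MeasureTheory.convolution (κ i j) (h j)
      (ContinuousLinearMap.mul ℂ ℂ) volume := by
    intro i j
    funext y
    rw [MeasureTheory.convolution_mul_swap]
  have hci : ∀ i j, Integrable (c i j) := by
    intro i j
    rw [hconv]
    exact (hκi i j).integrable_convolution _ (hh j).integrable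
  have hcb : ∀ i j, MemLp (c i j) 2 := by
    intro i j
    obtain ⟨M, hM0, hM⟩ := (hh j).bdd
    refine memLp_two_of_bounded (hci i j) (M := ∫ z, ‖κ i j z‖ * M) fun y => ?_
    rw [← integral_sub_left_eq_self (fun z => ‖κ i j z‖ * M) volume y]
    refine norm_integral_le_of_norm_le (((hκi i j).norm.mul_const M).comp_sub_left y)
      (Eventually.of_forall fun z => ?_)
    rw [norm_mul]
    exact mul_le_mul_of_nonneg_left (hM z) (norm_nonneg _)
  have hcF : ∀ i j ξ, 𝓕 (c i j) ξ = 𝓕 (κ i j) ξ * 𝓕 (h j) ξ := by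
    intro i j ξ
    rw [hconv]
    exact Real.fourier_mul_convolution_eq (hκi i j) (hh j).integrable ξ
  have hpt : ∀ i j ξ, star (𝓕 (h i) ξ) *
      (-2 * Complex.I * evalAt φ (((2 * Real.pi * ξ : ℝ) : ℂ) + η * Complex.I) i j) * 𝓕 (h j) ξ =
      D d i j * (star (𝓕 (h i) ξ) * 𝓕 (h j) ξ) + 2 * (star (𝓕 (h i) ξ) * 𝓕 (c i j) ξ) := by
    intro i j ξ
    rw [hcF, hκ, fourier_dampedKernel hφ hR hη (hns ξ), hR _ (hns ξ), Matrix.add_apply,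
      Matrix.smul_apply, smul_eq_mul]
    ring_nf
    rw [Complex.I_sq]
    ring
  have hi1 : ∀ i j, Integrable fun ξ => D d i j * (star (𝓕 (h i) ξ) * 𝓕 (h j) ξ) := fun i j =>
    (integrable_star_mul (memLp_fourier (hh i).integrable (hh i).memLp)
      (memLp_fourier (hh j).integrable (hh j).memLp)).const_mul _
  have hi2 : ∀ i j, Integrable fun ξ => 2 * (star (𝓕 (h i) ξ) * 𝓕 (c i j) ξ) := fun i j =>
    (integrable_star_mul (memLp_fourier (hh i).integrable (hh i).memLp)
      (memLp_fourier (hci i j) (hcb i j))).const_mul _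
  have hi3 : ∀ i j, Integrable fun ξ => star (𝓕 (h i) ξ) *
      (-2 * Complex.I * evalAt φ (((2 * Real.pi * ξ : ℝ) : ℂ) + η * Complex.I) i j) * 𝓕 (h j) ξ := by
    intro i j
    simp only [hpt]
    exact (hi1 i j).add (hi2 i j)
  refine ⟨integrable_finsetSum _ fun i _ => integrable_finsetSum _ fun j _ => hi3 i j, ?_⟩
  rw [integral_finsetSum _ fun i _ => integrable_finsetSum _ fun j _ => hi3 i j]
  refine Finset.sum_congr rfl fun i _ => ?_
  rw [integral_finsetSum _ fun j _ => hi3 i j]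
  refine Finset.sum_congr rfl fun j _ => ?_
  simp only [hpt]
  rw [integral_add (hi1 i j) (hi2 i j), integral_const_mul, integral_const_mul,
    integral_star_fourier_mul_fourier (hh i).integrable (hh i).memLp (hh j).integrable (hh j).memLp,
    integral_star_fourier_mul_fourier (hh i).integrable (hh i).memLp (hci i j) (hcb i j)]

/-- The real part of x*(-2iφ)x is 2 Im(x*φx) = 2 x*(Im φ)x. -/
theorem IsAdmissible.re_form_nonneg (hφ : IsAdmissible d φ) {z : ℂ} (hz : 0 < z.im)
    (x : Fin p → ℂ) :
    0 ≤ (∑ i, ∑ j, star (x i) * (-2 * Complex.I * evalAt φ z i j) * x j).re := by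
  set S := ∑ i, ∑ j, star (x i) * evalAt φ z i j * x j with hS
  have h1 : ∑ i, ∑ j, star (x i) * (-2 * Complex.I * evalAt φ z i j) * x j = -2 * Complex.I * S := by
    simp only [hS, Finset.mul_sum]
    refine Finset.sum_congr rfl fun i _ => Finset.sum_congr rfl fun j _ => ?_
    ring
  have h2 := (hφ.im_nonneg z hz).re_dotProduct_nonneg x
  have h3 : star x ⬝ᵥ (imPart (evalAt φ z) *ᵥ x) = 1 / (2 * Complex.I) * (S - star S) := by
    have hS' : star S = ∑ i, ∑ j, star (x i) * star (evalAt φ z j i) * x j := by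
      rw [hS, star_sum, Finset.sum_comm]
      simp only [star_sum, star_mul', star_star]
      refine Finset.sum_congr rfl fun i _ => Finset.sum_congr rfl fun j _ => ?_
      ring
    rw [hS', hS, ← Finset.sum_sub_distrib, Finset.mul_sum]
    refine Finset.sum_congr rfl fun i _ => ?_
    rw [← Finset.sum_sub_distrib, Finset.mul_sum]
    simp only [Matrix.mulVec, dotProduct, Finset.mul_sum, imPart, Matrix.smul_apply,
      Matrix.sub_apply, Matrix.conjTranspose_apply, smul_eq_mul, Pi.star_apply]
    refine Finset.sum_congr rfl fun j _ => ?_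
    ring
  rw [h3] at h2
  rw [h1]
  have h4 : (1 / (2 * Complex.I) * (S - star S)) = (S.im : ℂ) := by
    rw [Complex.star_def, Complex.sub_conj]
    field_simp
    push_cast
    ring
  rw [h4] at h2
  have h5 : (-2 * Complex.I * S).re = 2 * S.im := by simp
  rw [h5]
  have : 0 ≤ S.im := by simpa using h2
  linarith

/-- Near infinity -2iφ is a small perturbation of the positive definite matrix D. This is what makes
the form strictly positive and not merely nonnegative. -/
theorem IsAdmissible.exists_re_form_ge (hφ : IsAdmissible d φ) (hd : ∀ i, 0 < d i) :
    ∃ c R : ℝ, 0 < c ∧ ∀ z : ℂ, R < ‖z‖ → ∀ x : Fin p → ℂ,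
      c * ∑ i, ‖x i‖ ^ 2 ≤ (∑ i, ∑ j, star (x i) * (-2 * Complex.I * evalAt φ z i j) * x j).re := by
  obtain ⟨c, hc, hcd⟩ : ∃ c : ℝ, 0 < c ∧ ∀ i, c ≤ d i := by
    cases isEmpty_or_nonempty (Fin p) with
    | inl h => exact ⟨1, one_pos, fun i => h.elim i⟩
    | inr h =>
      obtain ⟨i, hi⟩ := Finite.exists_min d
      exact ⟨d i, hd i, hi⟩
  -- The perturbation costs at most 2δp ∑ |x_i|², which must not exceed half of c ∑ |x_i|². The
  -- denominator has p + 1 so that p = 0 is allowed.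
  set δ : ℝ := c / (4 * (p + 1)) with hδ
  have hδ0 : 0 < δ := by positivity
  have hev : ∀ᶠ z in Bornology.cobounded ℂ, ∀ i j,
      ‖evalAt φ z i j - ((Complex.I / 2) • D d) i j‖ < δ := by
    rw [eventually_all]; intro i
    rw [eventually_all]; intro j
    have h1 : Tendsto (fun z => evalAt φ z i j) (Bornology.cobounded ℂ)
        (𝓝 (((Complex.I / 2) • D d) i j)) :=
      ((continuous_id.matrix_elem i j).tendsto _).comp hφ.tendsto_infty
    have := (Metric.tendsto_nhds.1 h1) δ hδ0
    simpa only [dist_eq_norm] using this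
  rw [← comap_norm_atTop, eventually_comap] at hev
  obtain ⟨R, hR⟩ := eventually_atTop.1 hev
  refine ⟨c / 2, R, half_pos hc, fun z hz x => ?_⟩
  have hzδ := hR ‖z‖ hz.le z rfl
  set e : Fin p → Fin p → ℂ := fun i j => evalAt φ z i j - ((Complex.I / 2) • D d) i j with he
  have h1 : ∑ i, ∑ j, star (x i) * (-2 * Complex.I * evalAt φ z i j) * x j =
      ((∑ i, d i * ‖x i‖ ^ 2 : ℝ) : ℂ) +
        ∑ i, ∑ j, star (x i) * (-2 * Complex.I * e i j) * x j := by
    rw [Complex.ofReal_sum, ← Finset.sum_add_distrib]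
    refine Finset.sum_congr rfl fun i _ => ?_
    have : ((d i * ‖x i‖ ^ 2 : ℝ) : ℂ) = ∑ j, star (x i) * D d i j * x j := by
      rw [Finset.sum_eq_single i]
      · simp only [D, Matrix.diagonal_apply_eq, Complex.star_def]
        push_cast
        rw [← Complex.conj_mul']
        ring
      · intro j _ hj
        simp [D, Matrix.diagonal_apply_ne _ hj.symm]
      · simp
    rw [this, ← Finset.sum_add_distrib]
    refine Finset.sum_congr rfl fun j _ => ?_
    simp only [he, Matrix.smul_apply, smul_eq_mul]
    ring_nf
    rw [Complex.I_sq]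
    ring
  have h2 : ‖∑ i, ∑ j, star (x i) * (-2 * Complex.I * e i j) * x j‖ ≤
      ∑ i, ∑ j : Fin p, δ * (‖x i‖ ^ 2 + ‖x j‖ ^ 2) := by
    refine norm_sum_le_of_le _ fun i _ => norm_sum_le_of_le _ fun j _ => ?_
    rw [norm_mul, norm_mul, norm_mul, norm_mul, norm_star, Complex.norm_I, norm_neg]
    have h3 : ‖e i j‖ ≤ δ := (hzδ i j).le
    have h4 := two_mul_le_add_sq ‖x i‖ ‖x j‖
    calc ‖x i‖ * (‖(2 : ℂ)‖ * 1 * ‖e i j‖) * ‖x j‖ = ‖e i j‖ * (2 * ‖x i‖ * ‖x j‖) := by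
          simp; ring
      _ ≤ δ * (‖x i‖ ^ 2 + ‖x j‖ ^ 2) := mul_le_mul h3 h4 (by positivity) hδ0.le
  have h3 : ∑ i, ∑ j : Fin p, δ * (‖x i‖ ^ 2 + ‖x j‖ ^ 2) = 2 * δ * p * ∑ i, ‖x i‖ ^ 2 := by
    simp only [mul_add, Finset.sum_add_distrib, Finset.sum_const, Finset.card_univ, Fintype.card_fin,
      nsmul_eq_mul, ← Finset.mul_sum]
    ring
  have h4 : 2 * δ * p ≤ c / 2 := by
    rw [hδ]
    have : (p : ℝ) / (p + 1) ≤ 1 := by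
      rw [div_le_one (by positivity)]; linarith
    calc 2 * (c / (4 * ((p : ℝ) + 1))) * p = c / 2 * (p / (p + 1)) := by field_simp; ring
      _ ≤ c / 2 * 1 := by gcongr
      _ = _ := mul_one _
  have hX : 0 ≤ ∑ i, ‖x i‖ ^ 2 := Finset.sum_nonneg fun i _ => sq_nonneg _
  have h5 : c * ∑ i, ‖x i‖ ^ 2 ≤ ∑ i, d i * ‖x i‖ ^ 2 := by
    rw [Finset.mul_sum]
    exact Finset.sum_le_sum fun i _ => mul_le_mul_of_nonneg_right (hcd i) (sq_nonneg _)
  rw [h1, Complex.add_re, Complex.ofReal_re]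
  have h6 := (Complex.abs_re_le_norm _).trans h2
  rw [h3] at h6
  have h7 := neg_le_of_abs_le h6
  have h8 := mul_le_mul_of_nonneg_right h4 hX
  linarith

/-- The spectrum is finite, so all small η > 0 give lines that avoid it; real eigenvalues do no
harm. -/
theorem eventually_im_ne (β : Matrix (Fin n) (Fin n) ℂ) :
    ∀ᶠ η in 𝓝[>] (0 : ℝ), 0 < η ∧ ∀ z ∈ spectrum ℂ β, z.im ≠ η := by
  have hfin : ((Complex.im '' spectrum ℂ β) \ {0}).Finite :=
    ((Matrix.finite_spectrum β).image _).sdiff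
  have h1 : ((Complex.im '' spectrum ℂ β) \ {0})ᶜ ∈ 𝓝 (0 : ℝ) :=
    hfin.isClosed.isOpen_compl.mem_nhds (by simp)
  filter_upwards [self_mem_nhdsWithin, mem_nhdsWithin_of_mem_nhds h1] with η hη h2
  exact ⟨hη, fun z hz e => h2 ⟨⟨z, hz, e⟩, (Set.mem_Ioi.1 hη).ne'⟩⟩

theorem measurable_dampedKernel (η : ℝ) (i j : Fin p) :
    Measurable (dampedKernel β Θ₁ Θ₂ η i j) := by
  refine Measurable.ite measurableSet_Iio (Continuous.measurable ?_) measurable_const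
  exact (by fun_prop : Continuous fun t : ℝ => (Real.exp (η * t) : ℂ)).mul
    (((continuous_kernelExp β Θ₁ Θ₂).comp continuous_neg).matrix_elem i j)

/-- The kernel lives on negative arguments, where the damping factor is at most 1. The bound is
therefore uniform in η ≥ 0 and serves as the dominating function for η → 0. -/
theorem exists_bound_dampedKernel_mul {a : ℝ} {g : ℝ → ℂ} (hg : BddSupp a g) (i j : Fin p) :
    ∃ B : ℝ, ∀ η, 0 ≤ η → ∀ y ∈ Set.Icc 0 a, ∀ z,
      ‖dampedKernel β Θ₁ Θ₂ η i j (y - z) * g z‖ ≤ (Set.Icc 0 a).indicator (fun _ => B) z := by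
  obtain ⟨M', hM'0, hM'⟩ := hg.exists_le_indicator
  obtain ⟨K, hK⟩ := (isCompact_Icc (a := (0 : ℝ)) (b := a)).exists_bound_of_continuousOn
    ((continuous_kernelExp β Θ₁ Θ₂).matrix_elem i j).continuousOn
  refine ⟨|K| * M', fun η hη y hy z => ?_⟩
  by_cases hz : z ∈ Set.Icc 0 a
  · rw [Set.indicator_of_mem hz, norm_mul]
    have h1 := hM' z
    rw [Set.indicator_of_mem hz] at h1
    refine mul_le_mul ?_ h1 (norm_nonneg _) (abs_nonneg _)
    unfold dampedKernel
    split_ifs with hlt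
    · rw [norm_mul, Complex.norm_of_nonneg (Real.exp_pos _).le]
      have h2 : Real.exp (η * (y - z)) ≤ 1 :=
        Real.exp_le_one_iff.2 (mul_nonpos_of_nonneg_of_nonpos hη hlt.le)
      have h3 := hK (-(y - z)) ⟨by linarith, by linarith [hy.1, hz.2]⟩
      calc _ ≤ 1 * |K| := mul_le_mul h2 (h3.trans (le_abs_self K)) (norm_nonneg _) zero_le_one
        _ = _ := one_mul _
    · simp
  · rw [Set.indicator_of_notMem hz, hg.supp z hz, mul_zero, norm_zero]

theorem exists_bound_star_mul_dampedKernel {a : ℝ} {f g : ℝ → ℂ} (hf : BddSupp a f)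
    (hg : BddSupp a g) (i j : Fin p) : ∃ B : ℝ, ∀ η, 0 ≤ η → ∀ y,
      ‖star (f y) * ∫ z, dampedKernel β Θ₁ Θ₂ η i j (y - z) * g z‖ ≤
        (Set.Icc 0 a).indicator (fun _ => B) y := by
  obtain ⟨M, hM0, hM⟩ := hf.exists_le_indicator
  obtain ⟨B, hB⟩ := exists_bound_dampedKernel_mul (β := β) (Θ₁ := Θ₁) (Θ₂ := Θ₂) hg i j
  refine ⟨M * ∫ z, (Set.Icc 0 a).indicator (fun _ => B) z, fun η hη y => ?_⟩
  by_cases hy : y ∈ Set.Icc 0 a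
  · rw [Set.indicator_of_mem hy, norm_mul, norm_star]
    have h1 := hM y
    rw [Set.indicator_of_mem hy] at h1
    exact mul_le_mul h1 (norm_integral_le_of_norm_le (integrable_indicator_Icc_const 0 a _)
      (Eventually.of_forall fun z => hB η hη y hy z)) (norm_nonneg _) hM0
  · rw [Set.indicator_of_notMem hy, hf.supp y hy, star_zero, zero_mul, norm_zero]

theorem aestronglyMeasurable_star_mul_dampedKernel {a : ℝ} {f g : ℝ → ℂ} (hf : BddSupp a f)
    (hg : BddSupp a g) (η : ℝ) (i j : Fin p) : AEStronglyMeasurable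
      (fun y => star (f y) * ∫ z, dampedKernel β Θ₁ Θ₂ η i j (y - z) * g z) volume := by
  refine (continuous_star.measurable.comp hf.meas).aestronglyMeasurable.mul ?_
  have : StronglyMeasurable fun q : ℝ × ℝ => dampedKernel β Θ₁ Θ₂ η i j (q.1 - q.2) * g q.2 :=
    (((measurable_dampedKernel η i j).comp (measurable_fst.sub measurable_snd)).mul
      (hg.meas.comp measurable_snd)).stronglyMeasurable
  exact this.integral_prod_right.aestronglyMeasurable

theorem integrable_star_mul_dampedKernel {a : ℝ} {f g : ℝ → ℂ} {η : ℝ} (hη : 0 ≤ η)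
    (hf : BddSupp a f) (hg : BddSupp a g) (i j : Fin p) :
    Integrable fun y => star (f y) * ∫ z, dampedKernel β Θ₁ Θ₂ η i j (y - z) * g z := by
  obtain ⟨B, hB⟩ := exists_bound_star_mul_dampedKernel (β := β) (Θ₁ := Θ₁) (Θ₂ := Θ₂) hf hg i j
  exact (integrable_indicator_Icc_const 0 a B).mono'
    (aestronglyMeasurable_star_mul_dampedKernel hf hg η i j) (Eventually.of_forall (hB η hη))

theorem tendsto_dampedForm {a : ℝ} {h : Fin p → ℝ → ℂ} (hh : ∀ j, BddSupp a (h j)) :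
    Tendsto (fun η => dampedForm d β Θ₁ Θ₂ η h) (𝓝[>] 0) (𝓝 (dampedForm d β Θ₁ Θ₂ 0 h)) := by
  refine tendsto_finsetSum _ fun i _ => tendsto_finsetSum _ fun j _ =>
    tendsto_const_nhds.add (Tendsto.const_mul 2 ?_)
  have hpos : ∀ᶠ η in 𝓝[>] (0 : ℝ), 0 ≤ η := by
    filter_upwards [self_mem_nhdsWithin] with η hη using le_of_lt hη
  obtain ⟨B, hB⟩ := exists_bound_dampedKernel_mul (β := β) (Θ₁ := Θ₁) (Θ₂ := Θ₂) (hh j) i j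
  have hinner : ∀ y ∈ Set.Icc 0 a, Tendsto
      (fun η => ∫ z, dampedKernel β Θ₁ Θ₂ η i j (y - z) * h j z) (𝓝[>] 0)
      (𝓝 (∫ z, dampedKernel β Θ₁ Θ₂ 0 i j (y - z) * h j z)) := by
    intro y hy
    refine tendsto_integral_filter_of_dominated_convergence _ (Eventually.of_forall fun η => ?_)
      (hpos.mono fun η hη => Eventually.of_forall fun z => hB η hη y hy z)
      (integrable_indicator_Icc_const 0 a _) (Eventually.of_forall fun z => ?_)
    · exact ((measurable_dampedKernel η i j).comp (measurable_const.sub measurable_id)).mul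
        (hh j).meas |>.aestronglyMeasurable
    · refine Tendsto.mul_const _ ?_
      unfold dampedKernel
      split_ifs
      · refine Tendsto.mul_const _ ?_
        have : Continuous fun η : ℝ => (Real.exp (η * (y - z)) : ℂ) := by fun_prop
        exact (this.tendsto 0).mono_left nhdsWithin_le_nhds
      · exact tendsto_const_nhds
  obtain ⟨B', hB'⟩ := exists_bound_star_mul_dampedKernel (β := β) (Θ₁ := Θ₁) (Θ₂ := Θ₂)
    (hh i) (hh j) i j
  refine tendsto_integral_filter_of_dominated_convergence
    ((Set.Icc 0 a).indicator fun _ => B') (Eventually.of_forall fun η =>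
      aestronglyMeasurable_star_mul_dampedKernel (hh i) (hh j) η i j)
    (hpos.mono fun η hη => Eventually.of_forall (hB' η hη))
    (integrable_indicator_Icc_const 0 a _) (Eventually.of_forall fun y => ?_)
  by_cases hy : y ∈ Set.Icc 0 a
  · exact (hinner y hy).const_mul _
  · simp only [(hh i).supp y hy, star_zero, zero_mul]
    exact tendsto_const_nhds

/-- Strict positivity of the undamped form. -/
theorem ae_eq_zero_of_dampedForm_nonpos (hφ : IsAdmissible d φ) (hd : ∀ i, 0 < d i)
    (hR : IsRealization d φ β Θ₁ Θ₂) {a : ℝ} {h : Fin p → ℝ → ℂ} (hh : ∀ j, BddSupp a (h j))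
    (hle : (dampedForm d β Θ₁ Θ₂ 0 h).re ≤ 0) (i : Fin p) : h i =ᵐ[volume] 0 := by
  obtain ⟨c, R, hc, hcR⟩ := hφ.exists_re_form_ge hd
  -- On ξ > |R| the point 2πξ + iη has modulus above R whatever η is, so the lower bound by cX does
  -- not depend on η and survives the limit. For the remaining ξ nonnegativity suffices.
  set X : ℝ → ℝ := (Set.Ioi |R|).indicator fun ξ => ∑ i, ‖𝓕 (h i) ξ‖ ^ 2 with hX
  have hXint : Integrable X := by
    refine Integrable.indicator (integrable_finsetSum _ fun i _ => ?_) measurableSet_Ioi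
    have h2 := memLp_fourier (hh i).integrable (hh i).memLp
    exact (memLp_two_iff_integrable_sq_norm h2.1).1 h2
  have hX0 : ∀ ξ, 0 ≤ X ξ := fun ξ =>
    Set.indicator_nonneg (fun _ _ => Finset.sum_nonneg fun i _ => sq_nonneg _) ξ
  have hge : ∀ᶠ η in 𝓝[>] (0 : ℝ), c * ∫ ξ, X ξ ≤ (dampedForm d β Θ₁ Θ₂ η h).re := by
    filter_upwards [eventually_im_ne β] with η hη
    obtain ⟨hint, heq⟩ := dampedForm_eq hφ hR hη.1 hη.2 hh
    rw [heq, ← integral_const_mul]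
    have hre := integral_re hint
    simp only [RCLike.re_to_complex] at hre
    rw [← hre]
    refine integral_mono (hXint.const_mul c) hint.re fun ξ => ?_
    simp only
    by_cases hξ : ξ ∈ Set.Ioi |R|
    · rw [hX, Set.indicator_of_mem hξ]
      refine hcR _ ?_ fun i => 𝓕 (h i) ξ
      have h1 : |R| < ξ := hξ
      have h0 : 0 ≤ ξ := (abs_nonneg R).trans h1.le
      have h2 := Complex.abs_re_le_norm (((2 * Real.pi * ξ : ℝ) : ℂ) + η * Complex.I)
      have h3 : (((2 * Real.pi * ξ : ℝ) : ℂ) + η * Complex.I).re = 2 * Real.pi * ξ := by simp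
      rw [h3] at h2
      have h4 : ξ ≤ 2 * Real.pi * ξ := le_mul_of_one_le_left h0 (by linarith [Real.pi_gt_three])
      calc R ≤ |R| := le_abs_self R
        _ < ξ := h1
        _ ≤ _ := h4
        _ ≤ _ := le_abs_self _
        _ ≤ _ := h2
    · rw [hX, Set.indicator_of_notMem hξ, mul_zero]
      exact hφ.re_form_nonneg (by simpa using hη.1) fun i => 𝓕 (h i) ξ
  have hlim : c * ∫ ξ, X ξ ≤ (dampedForm d β Θ₁ Θ₂ 0 h).re :=
    ge_of_tendsto ((Complex.continuous_re.tendsto _).comp (tendsto_dampedForm hh)) hge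
  have hX1 : ∫ ξ, X ξ = 0 := by
    refine le_antisymm ?_ (integral_nonneg hX0)
    by_contra hlt
    have := mul_pos hc (not_le.1 hlt)
    linarith
  have hX2 := (integral_eq_zero_iff_of_nonneg hX0 hXint).1 hX1
  have hcont : ∀ i, Continuous (𝓕 (h i)) := fun i => VectorFourier.fourierIntegral_continuous
    Real.continuous_fourierChar (by exact continuous_inner) (hh i).integrable
  refine (hh i).ae_eq_zero (R := |R|) fun ξ hξ => ?_
  have hae : ∀ᵐ ξ ∂(volume.restrict (Set.Ioi |R|)), ‖𝓕 (h i) ξ‖ ^ 2 = (fun _ => (0 : ℝ)) ξ := by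
    rw [ae_restrict_iff' measurableSet_Ioi]
    filter_upwards [hX2] with ξ hξ hmem
    rw [hX, Set.indicator_of_mem hmem, Pi.zero_apply] at hξ
    exact (Finset.sum_eq_zero_iff_of_nonneg fun i _ => sq_nonneg _).1 hξ i (Finset.mem_univ i)
  -- Continuity of the transform upgrades vanishing almost everywhere to vanishing on the whole
  -- half-line.
  have := Measure.eqOn_open_of_ae_eq hae isOpen_Ioi (((hcont i).norm.pow 2).continuousOn)
    continuousOn_const hξ
  simpa using this

end Positivity

/-! ### The fundamental matrix e^{y𝒜}U(y) and its differential equation. -/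

section Fundamental

variable {n p : ℕ} {d : Fin p → ℝ} {β : Matrix (Fin n) (Fin n) ℂ} {Θ₁ Θ₂ : Matrix (Fin n) (Fin p) ℂ}
  {l : ℝ}

/-- The product of exponentials `e^{y𝒜} U(y)`. -/
def fund (d : Fin p → ℝ) (β : Matrix (Fin n) (Fin n) ℂ) (Θ₁ Θ₂ : Matrix (Fin n) (Fin p) ℂ)
    (l y : ℝ) : Matrix (Fin n ⊕ Fin n) (Fin n ⊕ Fin n) ℂ :=
  (List.ofFn fun m : Fin p => NormedSpace.exp
      (((min y (node d m * l) - min y (node d (m + 1) * l) : ℝ) : ℂ) • calAx d β Θ₁ Θ₂ m)).prod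

theorem U_eq (l y : ℝ) : U d β Θ₁ Θ₂ l y =
    NormedSpace.exp ((-y : ℂ) • calA β) * fund d β Θ₁ Θ₂ l y := rfl

theorem exp_mul_U (l y : ℝ) : NormedSpace.exp ((y : ℂ) • calA β) * U d β Θ₁ Θ₂ l y =
    fund d β Θ₁ Θ₂ l y := by
  rw [U_eq, ← Matrix.mul_assoc, exp_smul_mul_exp_neg, Matrix.one_mul]

theorem isUnit_fund (y : ℝ) : IsUnit (fund d β Θ₁ Θ₂ l y) := by
  refine List.prod_isUnit fun M hM => ?_
  obtain ⟨m, rfl⟩ := List.mem_ofFn.1 hM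
  exact Matrix.isUnit_exp _

theorem isUnit_U (y : ℝ) : IsUnit (U d β Θ₁ Θ₂ l y) :=
  (Matrix.isUnit_exp _).mul (isUnit_fund y)

theorem continuous_fund : Continuous (fund d β Θ₁ Θ₂ l) := by
  unfold fund
  simp only [List.ofFn_eq_map]
  refine continuous_list_prod _ fun m _ => continuous_matrix_exp.comp ?_
  fun_prop

theorem fund_zero (hd : ∀ i, 0 < d i) (hl : 0 ≤ l) : fund d β Θ₁ Θ₂ l 0 = 1 := by
  have h := U_zero hd β Θ₁ Θ₂ hl
  rw [U_eq] at h
  simpa using h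

theorem fund_step (hd : ∀ i, 0 < d i) (hanti : Antitone d) (hl : 0 ≤ l) (m : Fin p) {y : ℝ}
    (h1 : node d (m + 1) * l ≤ y) (h2 : y ≤ node d m * l) :
    fund d β Θ₁ Θ₂ l y =
      NormedSpace.exp (((y - node d (m + 1) * l : ℝ) : ℂ) • calAx d β Θ₁ Θ₂ m) *
        fund d β Θ₁ Θ₂ l (node d (m + 1) * l) := by
  rw [← exp_mul_U, U_step hd hanti β Θ₁ Θ₂ hl m h1 h2, ← exp_mul_U]
  simp only [← Matrix.mul_assoc]
  rw [exp_smul_mul_exp_neg, Matrix.one_mul]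

/-- The projection onto the coordinates `i` with `y < d_i l`. -/
def cut (d : Fin p → ℝ) (l y : ℝ) : Matrix (Fin p) (Fin p) ℂ :=
  Matrix.diagonal fun i => if y < d i * l then 1 else 0

/-- The coefficient matrix of the differential equation of the fundamental matrix. -/
def coeffA (d : Fin p → ℝ) (β : Matrix (Fin n) (Fin n) ℂ) (Θ₁ Θ₂ : Matrix (Fin n) (Fin p) ℂ)
    (l y : ℝ) : Matrix (Fin n ⊕ Fin n) (Fin n ⊕ Fin n) ℂ :=
  calA β + colΘ Θ₁ Θ₂ * Dinv d * cut d l y * rowΘ Θ₁ Θ₂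

/-- The points at which the coefficient matrix may jump. -/
def jumps (d : Fin p → ℝ) (l : ℝ) : Set ℝ := (fun m => node d m * l) '' Set.Iic p

theorem finite_jumps (d : Fin p → ℝ) (l : ℝ) : (jumps d l).Finite := (Set.finite_Iic p).image _

theorem node_coe (d : Fin p → ℝ) (i : Fin p) : node d i = d i := by simp [node]

theorem mem_jumps (d : Fin p → ℝ) (l : ℝ) (i : Fin p) : d i * l ∈ jumps d l :=
  ⟨i, Set.mem_Iic.2 i.2.le, by simp [node_coe]⟩

theorem le_node_zero (hd : ∀ i, 0 < d i) (hanti : Antitone d) (hl : 0 ≤ l) (i : Fin p) :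
    d i * l ≤ node d 0 * l := by
  rw [← node_coe d i]
  exact mul_le_mul_of_nonneg_right (node_antitone hd hanti (Nat.zero_le _)) hl

theorem mPwCont_cut (d : Fin p → ℝ) (l : ℝ) : MPwCont (jumps d l) (cut d l) := by
  intro i j
  by_cases hij : i = j
  · subst hij
    simp only [cut, Matrix.diagonal_apply_eq]
    exact (PwCont.of_continuous continuous_const).ite (PwCont.of_continuous continuous_const)
      (mem_jumps d l i)
  · simp only [cut, Matrix.diagonal_apply_ne _ hij]
    exact PwCont.of_continuous continuous_const

theorem exists_between_nodes {y : ℝ} (h0 : 0 < y) (ha : y < node d 0 * l) (hy : y ∉ jumps d l) :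
    ∃ m : Fin p, node d (m + 1) * l < y ∧ y < node d m * l := by
  classical
  -- The final node is 0, so a first node not above y exists. Taking the first one skips the empty
  -- intervals between equal d's.
  have hex : ∃ k, node d k * l ≤ y := ⟨p, by simpa [node] using h0.le⟩
  set k := Nat.find hex with hk
  have hk1 : node d k * l ≤ y := Nat.find_spec hex
  have hkp : k ≤ p := Nat.find_min' hex (by simpa [node] using h0.le)
  have hk0 : k ≠ 0 := by
    intro e
    rw [e] at hk1
    exact absurd hk1 (not_le.2 ha)
  obtain ⟨m, hm⟩ := Nat.exists_eq_succ_of_ne_zero hk0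
  have hmk : m < k := by omega
  refine ⟨⟨m, by omega⟩, lt_of_le_of_ne ?_ ?_, ?_⟩
  · change node d (m + 1) * l ≤ y
    rw [← Nat.succ_eq_add_one, ← hm]; exact hk1
  · intro e
    refine hy ⟨m + 1, ?_, e⟩
    rw [Set.mem_Iic]; omega
  · exact not_le.1 (Nat.find_min hex hmk)

/-- By monotonicity of d, the coordinates up to m are those whose endpoint d_i l lies beyond y. The
index of the interval thus disappears from the coefficient matrix, and coordinates can be treated
one at a time. -/
theorem proj_eq_cut (hd : ∀ i, 0 < d i) (hanti : Antitone d) (hl : 0 ≤ l) {m : Fin p} {y : ℝ}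
    (h1 : node d (m + 1) * l ≤ y) (h2 : y < node d m * l) : proj m = cut d l y := by
  unfold proj cut
  congr 1
  funext i
  by_cases hi : i ≤ m
  · rw [if_pos hi, if_pos]
    rw [node_coe] at h2
    exact h2.trans_le (mul_le_mul_of_nonneg_right (hanti hi) hl)
  · rw [if_neg hi, if_neg]
    rw [not_lt, ← node_coe d i]
    refine le_trans (mul_le_mul_of_nonneg_right (node_antitone hd hanti ?_) hl) h1
    exact Nat.succ_le_of_lt (not_le.1 hi)

theorem entryDeriv_fund (hd : ∀ i, 0 < d i) (hanti : Antitone d) (hl : 0 ≤ l) {y : ℝ}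
    (hy : y ∈ Set.Ioo 0 (node d 0 * l) \ jumps d l) :
    EntryDeriv (fund d β Θ₁ Θ₂ l) (coeffA d β Θ₁ Θ₂ l y * fund d β Θ₁ Θ₂ l y) y := by
  obtain ⟨m, h1, h2⟩ := exists_between_nodes hy.1.1 hy.1.2 hy.2
  have hA : coeffA d β Θ₁ Θ₂ l y = calAx d β Θ₁ Θ₂ m := by
    rw [coeffA, ← proj_eq_cut hd hanti hl h1.le h2, calAx]
  set e := node d (m + 1) * l with he
  have h3 : EntryDeriv (fun t => NormedSpace.exp (((t - e : ℝ) : ℂ) • calAx d β Θ₁ Θ₂ m))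
      (calAx d β Θ₁ Θ₂ m * NormedSpace.exp (((y - e : ℝ) : ℂ) • calAx d β Θ₁ Θ₂ m)) y := by
    intro i j
    have := (entryDeriv_exp_smul (calAx d β Θ₁ Θ₂ m) 1 (y - e) i j).comp_sub_const y e
    simpa only [mul_one, one_smul] using this
  have h4 := h3.mul_const (fund d β Θ₁ Θ₂ l e)
  rw [Matrix.mul_assoc, ← fund_step hd hanti hl m h1.le h2.le] at h4
  rw [hA]
  refine h4.congr_of_eventuallyEq ?_
  filter_upwards [Ioo_mem_nhds h1 h2] with t ht
  exact fund_step hd hanti hl m ht.1.le ht.2.le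

end Fundamental

/-! ### Invertibility of U₂₂(d_1 l). -/

section Invertibility

open MeasureTheory

variable {n p : ℕ} {d : Fin p → ℝ} {φ : Matrix (Fin p) (Fin p) (RatFunc ℂ)}
  {β : Matrix (Fin n) (Fin n) ℂ} {Θ₁ Θ₂ : Matrix (Fin n) (Fin p) ℂ} {l : ℝ}

-- Block diagonal embedding is a continuous ring homomorphism from a product ring, and such maps
-- commute with exp.
open Matrix.Norms.Operator in
theorem exp_fromBlocks_diagonal {ι κ : Type*} [Fintype ι] [Fintype κ] [DecidableEq ι]
    [DecidableEq κ] (A : Matrix ι ι ℂ) (B : Matrix κ κ ℂ) :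
    NormedSpace.exp (Matrix.fromBlocks A 0 0 B) =
      Matrix.fromBlocks (NormedSpace.exp A) 0 0 (NormedSpace.exp B) := by
  let f : Matrix ι ι ℂ × Matrix κ κ ℂ →+* Matrix (ι ⊕ κ) (ι ⊕ κ) ℂ :=
    { toFun := fun M => Matrix.fromBlocks M.1 0 0 M.2
      map_one' := by simp
      map_mul' := fun M N => by simp [Matrix.fromBlocks_multiply]
      map_zero' := by simp
      map_add' := fun M N => by simp [Matrix.fromBlocks_add] }
  have hf : Continuous f :=
    Continuous.matrix_fromBlocks continuous_fst continuous_const continuous_const continuous_snd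
  have h : f (NormedSpace.exp (A, B)) = NormedSpace.exp (Matrix.fromBlocks A 0 0 B) :=
    NormedSpace.map_exp f hf (A, B)
  have h1 : (NormedSpace.exp (A, B)).1 = NormedSpace.exp A :=
    NormedSpace.map_exp (RingHom.fst (Matrix ι ι ℂ) (Matrix κ κ ℂ)) continuous_fst (A, B)
  have h2 : (NormedSpace.exp (A, B)).2 = NormedSpace.exp B :=
    NormedSpace.map_exp (RingHom.snd (Matrix ι ι ℂ) (Matrix κ κ ℂ)) continuous_snd (A, B)
  rw [← h, ← h1, ← h2]
  rfl

theorem exp_calA (y : ℂ) : NormedSpace.exp (y • calA β) = Matrix.fromBlocks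
    (NormedSpace.exp ((y * Complex.I) • βᴴ)) 0 0 (NormedSpace.exp ((y * Complex.I) • β)) := by
  rw [← exp_fromBlocks_diagonal]
  congr 1
  simp [calA, Matrix.fromBlocks_smul, smul_smul]

theorem Dinv_mul_D (hd : ∀ i, 0 < d i) : Dinv d * D d = 1 := by
  rw [Dinv, D, Matrix.diagonal_mul_diagonal, ← Matrix.diagonal_one]
  congr 1
  funext i
  exact inv_mul_cancel₀ (by exact_mod_cast (hd i).ne')

theorem D_mul_Dinv (hd : ∀ i, 0 < d i) : D d * Dinv d = 1 := by
  rw [Dinv, D, Matrix.diagonal_mul_diagonal, ← Matrix.diagonal_one]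
  congr 1
  funext i
  exact mul_inv_cancel₀ (by exact_mod_cast (hd i).ne')

theorem Dinv_mul_cut (y : ℝ) : Dinv d * cut d l y = cut d l y * Dinv d := by
  rw [Dinv, cut, Matrix.diagonal_mul_diagonal, Matrix.diagonal_mul_diagonal]
  congr 1
  funext i
  exact mul_comm _ _

theorem cut_mul_cut (y : ℝ) : cut d l y * cut d l y = cut d l y := by
  rw [cut, Matrix.diagonal_mul_diagonal]
  congr 1
  funext i
  split_ifs <;> simp

theorem conjTranspose_cut (y : ℝ) : (cut d l y)ᴴ = cut d l y := by
  rw [cut, Matrix.diagonal_conjTranspose]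
  congr 1
  funext i
  simp only [Pi.star_apply]
  split_ifs <;> simp

theorem conjTranspose_D : (D d)ᴴ = D d := by
  rw [D, Matrix.diagonal_conjTranspose]
  congr 1
  funext i
  simp

theorem conjTranspose_Dinv : (Dinv d)ᴴ = Dinv d := by
  rw [Dinv, Matrix.diagonal_conjTranspose]
  congr 1
  funext i
  simp

/-- If `U₂₂(d₁ l) v = 0`, then `v = 0`. -/
theorem eq_zero_of_toBlocks₂₂_mul (hd : ∀ i, 0 < d i) (hanti : Antitone d)
    (hφ : IsAdmissible d φ) (hR : IsRealization d φ β Θ₁ Θ₂) (hl : 0 ≤ l)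
    {v : Matrix (Fin n) Unit ℂ}
    (hv : (U d β Θ₁ Θ₂ l (node d 0 * l)).toBlocks₂₂ * v = 0) : v = 0 := by
  set a := node d 0 * l with ha
  have ha0 : 0 ≤ a := mul_nonneg (node_nonneg hd 0) hl
  set N := jumps d l with hN
  have hNf : N.Finite := finite_jumps d l
  set v₀ : Matrix (Fin n ⊕ Fin n) Unit ℂ := Matrix.fromRows 0 v with hv₀
  set w : ℝ → Matrix (Fin n ⊕ Fin n) Unit ℂ := fun y => fund d β Θ₁ Θ₂ l y * v₀ with hw
  have hwc : Continuous w := continuous_fund.matrix_mul continuous_const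
  set w₁ : ℝ → Matrix (Fin n) Unit ℂ := fun y => (w y).toRows₁ with hw₁
  set w₂ : ℝ → Matrix (Fin n) Unit ℂ := fun y => (w y).toRows₂ with hw₂
  have hw12 : ∀ y, w y = Matrix.fromRows (w₁ y) (w₂ y) := fun y => (Matrix.fromRows_toRows _).symm
  have hw₁c : Continuous w₁ := continuous_matrix fun i j => hwc.matrix_elem (Sum.inl i) j
  have hw₂c : Continuous w₂ := continuous_matrix fun i j => hwc.matrix_elem (Sum.inr i) j
  -- H is read as an input: w' = 𝒜w + [-Θ₁; Θ₂]H, with w₁(0) = 0 and, by the assumption on v, w₂(a)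
  -- = 0. It is the function to be tested in the quadratic form.
  set H : ℝ → Matrix (Fin p) Unit ℂ := fun y =>
    Dinv d * cut d l y * (rowΘ Θ₁ Θ₂ * w y) with hH
  have hHpw : MPwCont N H := ((MPwCont.const _).mul (mPwCont_cut d l)).mul
    (MPwCont.of_continuous (continuous_const.matrix_mul hwc))
  have hwd : ∀ y ∈ Set.Ioo 0 a \ N, EntryDeriv w (calA β * w y + colΘ Θ₁ Θ₂ * H y) y := by
    intro y hy
    have := (entryDeriv_fund (β := β) (Θ₁ := Θ₁) (Θ₂ := Θ₂) hd hanti hl hy).mul_const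
      (v₀)
    rw [Matrix.mul_assoc, coeffA, Matrix.add_mul] at this
    simpa only [hw, hH, Matrix.mul_assoc] using this
  have hw0 : w 0 = v₀ := by
    simp only [hw, fund_zero hd hl, Matrix.one_mul]
  have hw₁0 : w₁ 0 = 0 := by simp only [hw₁, hw0, hv₀, Matrix.toRows₁_fromRows]
  have hw₂0 : w₂ 0 = v := by simp only [hw₂, hw0, hv₀, Matrix.toRows₂_fromRows]
  have hw₂a : w₂ a = 0 := by
    have h1 : w a = NormedSpace.exp ((a : ℂ) • calA β) *
        (U d β Θ₁ Θ₂ l a * v₀) := by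
      rw [← Matrix.mul_assoc, exp_mul_U]
    rw [← Matrix.fromBlocks_toBlocks (U d β Θ₁ Θ₂ l a), hv₀, Matrix.fromBlocks_mul_fromRows, hv,
      exp_calA, Matrix.fromBlocks_mul_fromRows] at h1
    simp only [hw₂, h1, Matrix.toRows₂_fromRows]
    simp
  have hsplit : ∀ y, calA β * w y + colΘ Θ₁ Θ₂ * H y = Matrix.fromRows
      (Complex.I • (βᴴ * w₁ y) - Θ₁ * H y) (Complex.I • (β * w₂ y) + Θ₂ * H y) := by
    intro y
    rw [hw12, calA, colΘ, Matrix.smul_mul, Matrix.fromBlocks_mul_fromRows, Matrix.fromRows_mul]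
    ext (i | i) j <;> simp [sub_eq_add_neg]
  have hw₁d : ∀ y ∈ Set.Ioo 0 a \ N, EntryDeriv w₁ (Complex.I • (βᴴ * w₁ y) - Θ₁ * H y) y := by
    intro y hy i j
    have := hwd y hy (Sum.inl i) j
    rwa [hsplit] at this
  have hw₂d : ∀ y ∈ Set.Ioo 0 a \ N, EntryDeriv w₂ (Complex.I • (β * w₂ y) + Θ₂ * H y) y := by
    intro y hy i j
    have := hwd y hy (Sum.inr i) j
    rwa [hsplit] at this
  set E : ℝ → Matrix (Fin n) (Fin n) ℂ := fun y => NormedSpace.exp (((y : ℂ) * -Complex.I) • β)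
    with hE
  have hEc : Continuous E := continuous_matrix_exp.comp (by fun_prop)
  -- Variation of constants for w₂, integrated back from a, where w₂ vanishes.
  have hEint : ∀ y ∈ Set.Icc 0 a, entryInt (fun z => E z * (Θ₂ * H z)) y a = -(E y * w₂ y) := by
    intro y hy
    rw [entryInt_eq_sub (F := fun z => E z * w₂ z) hNf hy.2 (hEc.matrix_mul hw₂c)
      ((MPwCont.of_continuous hEc).mul ((MPwCont.const _).mul hHpw)), hw₂a, Matrix.mul_zero,
      zero_sub]
    intro z hz
    have h1 := (entryDeriv_exp_smul β (-Complex.I) z).mul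
      (hw₂d z ⟨⟨hy.1.trans_lt hz.1.1, hz.1.2⟩, hz.2⟩)
    convert h1 using 1
    have h2 : β * E z = E z * β := exp_smul_comm β _
    change E z * (Θ₂ * H z) = -Complex.I • β * E z * w₂ z +
      E z * (Complex.I • (β * w₂ z) + Θ₂ * H z)
    rw [Matrix.smul_mul, h2, Matrix.smul_mul, neg_smul, Matrix.mul_add, Matrix.mul_smul,
      Matrix.mul_assoc]
    abel
  set h : Fin p → ℝ → ℂ := fun i => (Set.Icc 0 a).indicator fun y => H y i () with hh
  have hhb : ∀ j, BddSupp a (h j) := by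
    intro j
    refine ⟨(hHpw j ()).meas.indicator measurableSet_Icc, ?_, fun y hy =>
      Set.indicator_of_notMem hy _⟩
    obtain ⟨C, hC⟩ := (hHpw j ()).bdd a
    refine ⟨max C 0, le_max_right _ _, fun y => ?_⟩
    by_cases hy : y ∈ Set.Icc 0 a
    · simp only [hh, Set.indicator_of_mem hy]
      exact (hC y (by rw [abs_of_nonneg hy.1]; exact hy.2)).trans (le_max_left _ _)
    · simp only [hh, Set.indicator_of_notMem hy, norm_zero]
      exact le_max_right _ _
  have hset : ∀ f : ℝ → ℂ, (∀ y, y ∉ Set.Icc 0 a → f y = 0) → ∫ y, f y = ∫ y in (0 : ℝ)..a, f y := by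
    intro f hf
    rw [intervalIntegral.integral_of_le ha0, ← integral_Icc_eq_integral_Ioc,
      setIntegral_eq_integral_of_forall_compl_eq_zero hf]
  -- The undamped convolution kernel applied to H is just the output -Θ₁*w₂ of the second half of
  -- the state.
  have hinner : ∀ i, ∀ y ∈ Set.Icc 0 a,
      ∑ j, ∫ z, dampedKernel β Θ₁ Θ₂ 0 i j (y - z) * h j z = -(Θ₁ᴴ * w₂ y) i () := by
    intro i y hy
    have h1 : ∀ j, ∫ z, dampedKernel β Θ₁ Θ₂ 0 i j (y - z) * h j z =
        ∫ z in y..a, kernelExp β Θ₁ Θ₂ (z - y) i j * H z j () := by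
      intro j
      rw [intervalIntegral.integral_of_le hy.2, ← integral_indicator measurableSet_Ioc]
      refine integral_congr_ae (Eventually.of_forall fun z => ?_)
      simp only
      by_cases hz : z ∈ Set.Ioc y a
      · have hz' : z ∈ Set.Icc 0 a := ⟨hy.1.trans hz.1.le, hz.2⟩
        rw [Set.indicator_of_mem hz, dampedKernel, if_pos (by linarith [hz.1])]
        simp only [hh, Set.indicator_of_mem hz']
        simp
      · rw [Set.indicator_of_notMem hz]
        by_cases hz1 : y < z
        · have hz' : z ∉ Set.Icc 0 a := fun h' => hz ⟨hz1, h'.2⟩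
          simp only [hh, Set.indicator_of_notMem hz', mul_zero]
        · rw [dampedKernel, if_neg (by linarith [not_lt.1 hz1]), zero_mul]
    have h2 : MPwCont N fun z => kernelExp β Θ₁ Θ₂ (z - y) :=
      MPwCont.of_continuous ((continuous_kernelExp β Θ₁ Θ₂).comp (by fun_prop))
    have h3 : ∑ j, ∫ z in y..a, kernelExp β Θ₁ Θ₂ (z - y) i j * H z j () =
        entryInt (fun z => kernelExp β Θ₁ Θ₂ (z - y) * H z) y a i () := by
      simp only [entryInt, Matrix.of_apply, Matrix.mul_apply]
      rw [intervalIntegral.integral_finsetSum]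
      intro j _
      exact ((h2 i j).mul (hHpw j ())).intervalIntegrable _ _
    have h4 : (fun z => kernelExp β Θ₁ Θ₂ (z - y) * H z) = fun z =>
        (Θ₁ᴴ * NormedSpace.exp (((-y : ℂ) * -Complex.I) • β)) * (E z * (Θ₂ * H z)) := by
      funext z
      have : NormedSpace.exp ((((z - y : ℝ) : ℂ) * -Complex.I) • β) =
          NormedSpace.exp (((-y : ℂ) * -Complex.I) • β) * E z := by
        rw [hE, ← Matrix.exp_add_of_commute _ _
          (((Commute.refl β).smul_left _).smul_right _), ← add_smul]
        congr 2
        push_cast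
        ring
      rw [kernelExp, this]
      simp only [Matrix.mul_assoc]
    simp only [h1]
    rw [h3, h4, MPwCont.entryInt_const_mul (N := N) _
      ((MPwCont.of_continuous hEc).mul ((MPwCont.const _).mul hHpw)), hEint y hy]
    have h5 : NormedSpace.exp (((-y : ℂ) * -Complex.I) • β) * E y = 1 := by
      rw [hE, neg_mul]; exact exp_neg_mul_exp_smul β _
    rw [Matrix.mul_neg, Matrix.neg_apply, Matrix.mul_assoc, ← Matrix.mul_assoc _ (E y), h5,
      Matrix.one_mul]
  -- the quadratic form in terms of the states
  have hHw : MPwCont N fun y => (H y)ᴴ * (Θ₁ᴴ * w₂ y) := hHpw.conjTranspose.mul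
    ((MPwCont.const _).mul (MPwCont.of_continuous hw₂c))
  have hHD : MPwCont N fun y => (H y)ᴴ * (D d * H y) := hHpw.conjTranspose.mul
    ((MPwCont.const _).mul hHpw)
  set c := entryInt (fun y => (H y)ᴴ * (Θ₁ᴴ * w₂ y)) 0 a with hc
  have hform : dampedForm d β Θ₁ Θ₂ 0 h =
      (entryInt (fun y => (H y)ᴴ * (D d * H y)) 0 a - (2 : ℂ) • c) () () := by
    have h1 : ∀ i j, ∫ y, star (h i y) * h j y = ∫ y in (0 : ℝ)..a, star (H y i ()) * H y j () := by
      intro i j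
      rw [hset _ fun y hy => by simp [hh, Set.indicator_of_notMem hy]]
      refine intervalIntegral.integral_congr fun y hy => ?_
      rw [Set.uIcc_of_le ha0] at hy
      simp only [hh, Set.indicator_of_mem hy]
    have hκ : ∀ i j, Integrable fun y => star (h i y) *
        ∫ z, dampedKernel β Θ₁ Θ₂ 0 i j (y - z) * h j z := fun i j =>
      integrable_star_mul_dampedKernel le_rfl (hhb i) (hhb j) i j
    have h2 : ∀ i, ∑ j, ∫ y, star (h i y) * ∫ z, dampedKernel β Θ₁ Θ₂ 0 i j (y - z) * h j z =
        -∫ y in (0 : ℝ)..a, star (H y i ()) * (Θ₁ᴴ * w₂ y) i () := by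
      intro i
      rw [← integral_finsetSum _ fun j _ => hκ i j, ← intervalIntegral.integral_neg,
        hset _ fun y hy => by simp [hh, Set.indicator_of_notMem hy]]
      refine intervalIntegral.integral_congr fun y hy => ?_
      rw [Set.uIcc_of_le ha0] at hy
      rw [← Finset.mul_sum, hinner i y hy, mul_neg]
      simp only [hh, Set.indicator_of_mem hy]
    have h3 : ∀ i y, (D d * H y) i () = ∑ j, D d i j * H y j () := fun i y => by
      rw [Matrix.mul_apply]
    simp only [dampedForm, Finset.sum_add_distrib, ← Finset.mul_sum, h2, h1]
    simp only [Matrix.sub_apply, Matrix.smul_apply, hc, entryInt, Matrix.of_apply,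
      Matrix.mul_apply (M := (H _)ᴴ), Matrix.conjTranspose_apply]
    rw [intervalIntegral.integral_finsetSum fun i _ =>
        ((hHpw i ()).star.mul (((MPwCont.const (D d)).mul hHpw) i ())).intervalIntegrable 0 a,
      intervalIntegral.integral_finsetSum fun i _ => ((hHpw i ()).star.mul
        (((MPwCont.const _).mul (MPwCont.of_continuous hw₂c)) i ())).intervalIntegrable 0 a,
      Finset.sum_neg_distrib, smul_eq_mul, sub_eq_add_neg, ← mul_neg]
    congr 1
    refine Finset.sum_congr rfl fun i _ => ?_
    simp only [h3, Finset.mul_sum]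
    rw [intervalIntegral.integral_finsetSum fun j _ => ((hHpw i ()).star.mul
      ((PwCont.of_continuous continuous_const).mul (hHpw j ()))).intervalIntegrable 0 a]
    refine Finset.sum_congr rfl fun j _ => ?_
    rw [← intervalIntegral.integral_const_mul]
    congr 1
    funext y
    ring
  -- the pairing of the two states
  have hDH : ∀ y, (H y)ᴴ * (D d * H y) =
      (H y)ᴴ * (Θ₂ᴴ * w₁ y) + (H y)ᴴ * (Θ₁ᴴ * w₂ y) := by
    intro y
    have h1 : D d * H y = cut d l y * (rowΘ Θ₁ Θ₂ * w y) := by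
      simp only [hH, ← Matrix.mul_assoc]
      rw [D_mul_Dinv hd, Matrix.one_mul]
    have h2 : (H y)ᴴ * cut d l y = (H y)ᴴ := by
      simp only [hH, Matrix.conjTranspose_mul, conjTranspose_cut, conjTranspose_Dinv,
        Matrix.mul_assoc]
      rw [Dinv_mul_cut, ← Matrix.mul_assoc (cut d l y), cut_mul_cut]
    rw [h1, ← Matrix.mul_assoc, h2, hw12, rowΘ, Matrix.fromCols_mul_fromRows, Matrix.mul_add]
  have hHw1 : MPwCont N fun y => (H y)ᴴ * (Θ₂ᴴ * w₁ y) := hHpw.conjTranspose.mul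
    ((MPwCont.const _).mul (MPwCont.of_continuous hw₁c))
  -- The integrand is the derivative of w₂*w₁: the terms with β cancel, and both boundary values
  -- vanish.
  have hpair : entryInt (fun y => (H y)ᴴ * (Θ₂ᴴ * w₁ y) - ((H y)ᴴ * (Θ₁ᴴ * w₂ y))ᴴ) 0 a = 0 := by
    rw [entryInt_eq_sub (F := fun y => (w₂ y)ᴴ * w₁ y) hNf ha0
      (hw₂c.matrix_conjTranspose.matrix_mul hw₁c) (hHw1.sub hHw.conjTranspose), hw₂a, hw₁0]
    · simp
    · intro y hy
      have h1 := (hw₂d y hy).conjTranspose.mul (hw₁d y hy)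
      convert h1 using 1
      simp only [Matrix.conjTranspose_mul, Matrix.conjTranspose_add, Matrix.conjTranspose_smul,
        Matrix.conjTranspose_conjTranspose, Matrix.add_mul, Matrix.mul_sub,
        Matrix.mul_smul, Complex.star_def, Complex.conj_I, Matrix.mul_assoc, neg_smul,
        Matrix.neg_mul]
      rw [Matrix.smul_mul, Matrix.mul_assoc]
      abel
  rw [hHw1.entryInt_sub hHw.conjTranspose, entryInt_conjTranspose, ← hc] at hpair
  -- The form equals (c̄ + c) - 2c, which is purely imaginary.
  have hre : (dampedForm d β Θ₁ Θ₂ 0 h).re ≤ 0 := by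
    rw [hform]
    simp only [hDH]
    rw [hHw1.entryInt_add hHw, ← hc, sub_eq_zero.1 hpair]
    simp only [Matrix.sub_apply, Matrix.add_apply, Matrix.smul_apply, Matrix.conjTranspose_apply]
    simp
    linarith
  have hzero := ae_eq_zero_of_dampedForm_nonpos hφ hd hR hhb hre
  -- With H = 0 almost everywhere, variation of constants from 0 to a returns v = w₂(0) = 0.
  have h1 := hEint 0 ⟨le_rfl, ha0⟩
  have h2 : entryInt (fun z => E z * (Θ₂ * H z)) 0 a = 0 := by
    ext i j
    simp only [entryInt, Matrix.of_apply, Matrix.zero_apply]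
    refine intervalIntegral.integral_zero_ae ?_
    filter_upwards [eventually_all.2 hzero] with z hz hmem
    rw [Set.uIoc_of_le ha0] at hmem
    have : H z = 0 := by
      ext k u
      have := hz k
      have hz' : z ∈ Set.Icc 0 a := ⟨hmem.1.le, hmem.2⟩
      simp only [hh] at this
      rwa [Set.indicator_of_mem hz'] at this
    rw [this]
    simp
  rw [h2, hw₂0] at h1
  have h3 : E 0 = 1 := by simp [hE]
  rw [h3, Matrix.one_mul] at h1
  exact (neg_eq_zero.1 h1.symm)

theorem isUnit_toBlocks₂₂ (hd : ∀ i, 0 < d i) (hanti : Antitone d)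
    (hφ : IsAdmissible d φ) (hR : IsRealization d φ β Θ₁ Θ₂) (hl : 0 ≤ l) :
    IsUnit (U d β Θ₁ Θ₂ l (node d 0 * l)).toBlocks₂₂ := by
  rw [Matrix.isUnit_iff_isUnit_det, isUnit_iff_ne_zero]
  intro h0
  obtain ⟨v, hv0, hv⟩ := Matrix.exists_mulVec_eq_zero_iff.2 h0
  refine hv0 ?_
  have := eq_zero_of_toBlocks₂₂_mul hd hanti hφ hR hl (v := Matrix.replicateCol Unit v) (by
    rw [← Matrix.replicateCol_mulVec, hv]; rfl)
  funext i
  exact congrFun (congrFun this i) ()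

end Invertibility

theorem EntryDeriv.congr_deriv {ι κ : Type*} {F : ℝ → Matrix ι κ ℂ} {F' G' : Matrix ι κ ℂ} {y : ℝ}
    (h : EntryDeriv F F' y) (e : G' = F') : EntryDeriv F G' y := e ▸ h

/-! ### The skew form on the doubled state space. -/

section Symplectic

variable {n p : ℕ} {β : Matrix (Fin n) (Fin n) ℂ} {Θ₁ Θ₂ : Matrix (Fin n) (Fin p) ℂ}

/-- The projection onto the first half of the state space. -/
def projFst (n : ℕ) : Matrix (Fin n ⊕ Fin n) (Fin n ⊕ Fin n) ℂ := Matrix.fromBlocks 1 0 0 0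

/-- The projection onto the second half of the state space. -/
def projSnd (n : ℕ) : Matrix (Fin n ⊕ Fin n) (Fin n ⊕ Fin n) ℂ := Matrix.fromBlocks 0 0 0 1

/-- The skew matrix `[[0, I], [-I, 0]]`. -/
def skewJ (n : ℕ) : Matrix (Fin n ⊕ Fin n) (Fin n ⊕ Fin n) ℂ := Matrix.fromBlocks 0 1 (-1) 0

theorem projFst_add_projSnd : projFst n + projSnd n = 1 := by
  simp [projFst, projSnd, Matrix.fromBlocks_add, Matrix.fromBlocks_one]

theorem projSnd_mul_projSnd : projSnd n * projSnd n = projSnd n := by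
  simp [projSnd, Matrix.fromBlocks_multiply]

theorem projSnd_mul_projFst : projSnd n * projFst n = 0 := by
  simp [projFst, projSnd, Matrix.fromBlocks_multiply]

theorem projFst_mul_projSnd : projFst n * projSnd n = 0 := by
  simp [projFst, projSnd, Matrix.fromBlocks_multiply]

theorem calA_mul_projFst : calA β * projFst n = projFst n * calA β := by
  simp [projFst, calA, Matrix.fromBlocks_multiply]

theorem calA_mul_projSnd : calA β * projSnd n = projSnd n * calA β := by
  simp [projSnd, calA, Matrix.fromBlocks_multiply]

theorem projFst_mul_skewJ : projFst n * skewJ n = skewJ n * projSnd n := by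
  simp [projSnd, projFst, skewJ, Matrix.fromBlocks_multiply]

theorem projSnd_mul_skewJ : projSnd n * skewJ n = skewJ n * projFst n := by
  simp [projSnd, projFst, skewJ, Matrix.fromBlocks_multiply]

theorem conjTranspose_projFst : (projFst n)ᴴ = projFst n := by
  simp [projFst, Matrix.fromBlocks_conjTranspose]

theorem conjTranspose_projSnd : (projSnd n)ᴴ = projSnd n := by
  simp [projSnd, Matrix.fromBlocks_conjTranspose]

/-- 𝒜 is skew-adjoint for this form, and the two identities below say that it exchanges the row [Θ₂*
Θ₁*] with the adjoint of the column [-Θ₁; Θ₂]. These symmetries carry Green's identity. -/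
theorem skewJ_mul_conjTranspose_calA : skewJ n * (calA β)ᴴ = -(calA β * skewJ n) := by
  simp [skewJ, calA, Matrix.fromBlocks_multiply, Matrix.fromBlocks_conjTranspose,
    Matrix.fromBlocks_smul, Matrix.fromBlocks_neg]

theorem rowΘ_mul_skewJ : rowΘ Θ₁ Θ₂ * skewJ n = (colΘ Θ₁ Θ₂)ᴴ := by
  rw [rowΘ, skewJ, Matrix.fromCols_mul_fromBlocks, colΘ, Matrix.conjTranspose_fromRows_eq_fromCols_conjTranspose]
  rw [Matrix.mul_zero, Matrix.mul_zero, Matrix.mul_one, Matrix.mul_neg, Matrix.mul_one, zero_add,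
    add_zero, Matrix.conjTranspose_neg]

theorem skewJ_mul_conjTranspose_rowΘ : skewJ n * (rowΘ Θ₁ Θ₂)ᴴ = -colΘ Θ₁ Θ₂ := by
  rw [rowΘ, skewJ, Matrix.conjTranspose_fromCols_eq_fromRows_conjTranspose,
    Matrix.fromBlocks_mul_fromRows, colΘ, Matrix.fromRows_neg]
  rw [Matrix.zero_mul, Matrix.zero_mul, Matrix.one_mul, Matrix.neg_mul, Matrix.one_mul, zero_add,
    add_zero, neg_neg, Matrix.conjTranspose_conjTranspose, Matrix.conjTranspose_conjTranspose]

end Symplectic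

/-! ### Integrals with a variable lower endpoint. -/

section TailIntegral

variable {ι κ : Type*} {N : Set ℝ} {F : ℝ → Matrix ι κ ℂ}

theorem MPwCont.entryInt_tail (hF : MPwCont N F) (y a : ℝ) :
    entryInt F y a = entryInt F 0 a - entryInt F 0 y := by
  rw [← hF.entryInt_add_adjacent 0 y a]; abel

theorem MPwCont.continuous_entryInt_left (hF : MPwCont N F) (a : ℝ) :
    Continuous fun y => entryInt F y a := by
  rw [funext fun y => hF.entryInt_tail y a]
  exact continuous_const.sub (hF.continuous_entryInt 0)

theorem MPwCont.entryDeriv_entryInt_left (hF : MPwCont N F) (a : ℝ) {y : ℝ} (hy : y ∉ N) :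
    EntryDeriv (fun y => entryInt F y a) (-F y) y := by
  rw [funext fun y => hF.entryInt_tail y a]
  simpa using (EntryDeriv.const (entryInt F 0 a) y).sub (hF.entryDeriv_entryInt 0 hy)

end TailIntegral

/-! ### Row states, their integrated equation and the bilinear pairing. -/

section RowStates

variable {n p : ℕ} {d : Fin p → ℝ} {β : Matrix (Fin n) (Fin n) ℂ} {Θ₁ Θ₂ : Matrix (Fin n) (Fin p) ℂ}
  {l : ℝ}

/-- The `i`-th unit row. -/
def unitRow (i : Fin p) : Matrix Unit (Fin p) ℂ := Matrix.of fun _ k => if k = i then 1 else 0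

theorem mul_conjTranspose_unitRow (M : Matrix Unit (Fin p) ℂ) (i : Fin p) :
    (M * (unitRow i)ᴴ) () () = M () i := by
  simp [Matrix.mul_apply, unitRow, apply_ite]

theorem unitRow_mul {κ : Type*} (M : Matrix (Fin p) κ ℂ) (i : Fin p) (k : κ) :
    (unitRow i * M) () k = M i k := by
  simp [Matrix.mul_apply, unitRow]

/-- A solution `ρ` of the adjoint equation `ρ' = -ρ 𝒜^×`, consisting of two branches `ρm` and `ρp`,
to be used below and above `d_i l`, with a jump there and with homogeneous boundary conditions. -/
structure RowState (d : Fin p → ℝ) (β : Matrix (Fin n) (Fin n) ℂ)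
    (Θ₁ Θ₂ : Matrix (Fin n) (Fin p) ℂ) (l : ℝ) (i : Fin p)
    (ρm ρp : ℝ → Matrix Unit (Fin n ⊕ Fin n) ℂ) : Prop where
  contm : Continuous ρm
  contp : Continuous ρp
  derivm : ∀ y ∈ Set.Ioo 0 (node d 0 * l) \ jumps d l,
    EntryDeriv ρm (-(ρm y * coeffA d β Θ₁ Θ₂ l y)) y
  derivp : ∀ y ∈ Set.Ioo 0 (node d 0 * l) \ jumps d l,
    EntryDeriv ρp (-(ρp y * coeffA d β Θ₁ Θ₂ l y)) y
  jump : ρm (d i * l) - ρp (d i * l) = unitRow i * rowΘ Θ₁ Θ₂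
  zero : ρm 0 * projSnd n = 0
  final : ρp (node d 0 * l) * projFst n = 0

/-- The two branches put together. -/
def glue (d : Fin p → ℝ) (l : ℝ) (i : Fin p) (ρm ρp : ℝ → Matrix Unit (Fin n ⊕ Fin n) ℂ) (y : ℝ) :
    Matrix Unit (Fin n ⊕ Fin n) ℂ :=
  if y < d i * l then ρm y else ρp y

/-- The density `ρ [-Θ₁; Θ₂] D⁻¹ P`. -/
def density (d : Fin p → ℝ) (Θ₁ Θ₂ : Matrix (Fin n) (Fin p) ℂ) (l : ℝ)
    (ρ : ℝ → Matrix Unit (Fin n ⊕ Fin n) ℂ) (y : ℝ) : Matrix Unit (Fin p) ℂ :=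
  ρ y * colΘ Θ₁ Θ₂ * (Dinv d * cut d l y)

/-- The total mass of the density together with a unit mass. -/
def mass (d : Fin p → ℝ) (Θ₁ Θ₂ : Matrix (Fin n) (Fin p) ℂ) (l : ℝ) (i : Fin p)
    (ρ : ℝ → Matrix Unit (Fin n ⊕ Fin n) ℂ) : Matrix Unit (Fin p) ℂ :=
  unitRow i + entryInt (density d Θ₁ Θ₂ l ρ) 0 (node d 0 * l)

/-- The row `[0 Θ₁*] e^{-y𝒜}`. -/
def freeRow (β : Matrix (Fin n) (Fin n) ℂ) (Θ₁ Θ₂ : Matrix (Fin n) (Fin p) ℂ) (y : ℝ) :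
    Matrix (Fin p) (Fin n ⊕ Fin n) ℂ :=
  rowΘ Θ₁ Θ₂ * projSnd n * NormedSpace.exp ((-y : ℂ) • calA β)

/-- The integrated kernel `∫₀^y Θ₂* e^{iuβ*} Θ₁ du`, in terms of `𝒜`. -/
def intKernel (β : Matrix (Fin n) (Fin n) ℂ) (Θ₁ Θ₂ : Matrix (Fin n) (Fin p) ℂ) (y : ℝ) :
    Matrix (Fin p) (Fin p) ℂ :=
  -(rowΘ Θ₁ Θ₂ * projFst n * entryInt (fun u : ℝ => NormedSpace.exp ((u : ℂ) • calA β)) 0 y *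
    colΘ Θ₁ Θ₂)

/-- The pairing of the integrated kernel with the density and the unit mass. -/
def kernelMass (d : Fin p → ℝ) (β : Matrix (Fin n) (Fin n) ℂ) (Θ₁ Θ₂ : Matrix (Fin n) (Fin p) ℂ)
    (l : ℝ) (i : Fin p) (ρ : ℝ → Matrix Unit (Fin n ⊕ Fin n) ℂ) : Matrix Unit (Fin p) ℂ :=
  unitRow i * intKernel β Θ₁ Θ₂ (d i * l) +
    entryInt (fun y => density d Θ₁ Θ₂ l ρ y * intKernel β Θ₁ Θ₂ y) 0 (node d 0 * l)

/-- An integral of the row state that satisfies the boundary conditions dual to its own. -/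
def integratedRow (d : Fin p → ℝ) (β : Matrix (Fin n) (Fin n) ℂ) (Θ₁ Θ₂ : Matrix (Fin n) (Fin p) ℂ)
    (l : ℝ) (i : Fin p) (ρ : ℝ → Matrix Unit (Fin n ⊕ Fin n) ℂ) (y : ℝ) :
    Matrix Unit (Fin n ⊕ Fin n) ℂ :=
  entryInt ρ y (node d 0 * l) * projFst n -
    entryInt (fun u => ρ u + mass d Θ₁ Θ₂ l i ρ * freeRow β Θ₁ Θ₂ u) 0 y * projSnd n

theorem continuous_exp_calA : Continuous fun y : ℝ => NormedSpace.exp ((y : ℂ) • calA β) :=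
  continuous_matrix_exp.comp (by fun_prop)

theorem continuous_exp_neg_calA : Continuous fun y : ℝ => NormedSpace.exp ((-y : ℂ) • calA β) :=
  continuous_matrix_exp.comp (by fun_prop)

theorem entryDeriv_exp_calA (y : ℝ) : EntryDeriv (fun y : ℝ => NormedSpace.exp ((y : ℂ) • calA β))
    (calA β * NormedSpace.exp ((y : ℂ) • calA β)) y := by
  simpa using entryDeriv_exp_smul (calA β) 1 y

theorem entryDeriv_exp_neg_calA (y : ℝ) :
    EntryDeriv (fun y : ℝ => NormedSpace.exp ((-y : ℂ) • calA β))
      (-(NormedSpace.exp ((-y : ℂ) • calA β) * calA β)) y := by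
  have := entryDeriv_exp_smul (calA β) (-1) y
  simp only [mul_neg_one, neg_one_smul, Matrix.neg_mul, exp_smul_comm] at this
  exact this

theorem continuous_freeRow : Continuous (freeRow β Θ₁ Θ₂) :=
  continuous_const.matrix_mul continuous_exp_neg_calA

theorem entryDeriv_freeRow (y : ℝ) :
    EntryDeriv (freeRow β Θ₁ Θ₂) (-(freeRow β Θ₁ Θ₂ y * calA β)) y := by
  have := (entryDeriv_exp_neg_calA (β := β) y).const_mul (rowΘ Θ₁ Θ₂ * projSnd n)
  rwa [Matrix.mul_neg, ← Matrix.mul_assoc] at this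

theorem freeRow_mul_projSnd (y : ℝ) : freeRow β Θ₁ Θ₂ y * projSnd n = freeRow β Θ₁ Θ₂ y := by
  have h0 : Commute (calA β) (projSnd n) := calA_mul_projSnd
  have h : Commute (NormedSpace.exp ((-y : ℂ) • calA β)) (projSnd n) := (h0.smul_left _).exp_left
  rw [freeRow, Matrix.mul_assoc, h.eq, ← Matrix.mul_assoc, Matrix.mul_assoc _ (projSnd n) (projSnd n),
    projSnd_mul_projSnd]

theorem freeRow_mul_projFst (y : ℝ) : freeRow β Θ₁ Θ₂ y * projFst n = 0 := by
  rw [← freeRow_mul_projSnd, Matrix.mul_assoc, projSnd_mul_projFst, Matrix.mul_zero]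

theorem freeRow_zero : freeRow β Θ₁ Θ₂ 0 = rowΘ Θ₁ Θ₂ * projSnd n := by
  simp [freeRow]

variable {i j : Fin p} {ρm ρp τm τp : ℝ → Matrix Unit (Fin n ⊕ Fin n) ℂ}

theorem RowState.mPwCont_glue (h : RowState d β Θ₁ Θ₂ l i ρm ρp) :
    MPwCont (jumps d l) (glue d l i ρm ρp) :=
  (MPwCont.of_continuous h.contm).ite (MPwCont.of_continuous h.contp) (mem_jumps d l i)

theorem mPwCont_density {ρ : ℝ → Matrix Unit (Fin n ⊕ Fin n) ℂ} (h : MPwCont (jumps d l) ρ) :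
    MPwCont (jumps d l) (density d Θ₁ Θ₂ l ρ) :=
  (h.mul (MPwCont.const _)).mul ((MPwCont.const _).mul (mPwCont_cut d l))

section

variable {ρ : ℝ → Matrix Unit (Fin n ⊕ Fin n) ℂ}

theorem mPwCont_add_freeRow (h : MPwCont (jumps d l) ρ) :
    MPwCont (jumps d l) fun u => ρ u + mass d Θ₁ Θ₂ l i ρ * freeRow β Θ₁ Θ₂ u :=
  h.add ((MPwCont.const _).mul (MPwCont.of_continuous continuous_freeRow))

theorem continuous_integratedRow (h : MPwCont (jumps d l) ρ) :
    Continuous (integratedRow d β Θ₁ Θ₂ l i ρ) :=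
  ((h.continuous_entryInt_left _).matrix_mul continuous_const).sub
    (((mPwCont_add_freeRow h).continuous_entryInt 0).matrix_mul continuous_const)

/-- The halves are integrated from opposite ends to secure the boundary conditions, yet they fit one
formula because the free row has no first half. -/
theorem entryDeriv_integratedRow (h : MPwCont (jumps d l) ρ) {y : ℝ} (hy : y ∉ jumps d l) :
    EntryDeriv (integratedRow d β Θ₁ Θ₂ l i ρ)
      (-(ρ y + mass d Θ₁ Θ₂ l i ρ * freeRow β Θ₁ Θ₂ y)) y := by
  have h1 := ((h.entryDeriv_entryInt_left (node d 0 * l) hy).mul_const (projFst n)).sub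
    (((mPwCont_add_freeRow (β := β) (Θ₁ := Θ₁) (Θ₂ := Θ₂) (i := i) h).entryDeriv_entryInt 0
      hy).mul_const (projSnd n))
  refine EntryDeriv.congr_deriv h1 ?_
  rw [Matrix.add_mul, Matrix.mul_assoc _ (freeRow β Θ₁ Θ₂ y), freeRow_mul_projSnd]
  have h2 : ρ y = ρ y * projFst n + ρ y * projSnd n := by
    rw [← Matrix.mul_add, projFst_add_projSnd, Matrix.mul_one]
  conv_lhs => rw [h2]
  rw [Matrix.neg_mul]
  abel

theorem integratedRow_zero_mul : integratedRow d β Θ₁ Θ₂ l i ρ 0 * projSnd n = 0 := by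
  rw [integratedRow, entryInt_same, Matrix.zero_mul, sub_zero, Matrix.mul_assoc, projFst_mul_projSnd,
    Matrix.mul_zero]

theorem integratedRow_final_mul :
    integratedRow d β Θ₁ Θ₂ l i ρ (node d 0 * l) * projFst n = 0 := by
  rw [integratedRow, entryInt_same, Matrix.zero_mul, zero_sub, Matrix.neg_mul, Matrix.mul_assoc,
    projSnd_mul_projFst, Matrix.mul_zero, neg_zero]

/-- The density integrated from `y`. -/
def tailMass (d : Fin p → ℝ) (Θ₁ Θ₂ : Matrix (Fin n) (Fin p) ℂ) (l : ℝ)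
    (ρ : ℝ → Matrix Unit (Fin n ⊕ Fin n) ℂ) (y : ℝ) : Matrix Unit (Fin p) ℂ :=
  entryInt (density d Θ₁ Θ₂ l ρ) y (node d 0 * l)

theorem continuous_tailMass (h : MPwCont (jumps d l) ρ) : Continuous (tailMass d Θ₁ Θ₂ l ρ) :=
  (mPwCont_density h).continuous_entryInt_left _

theorem entryDeriv_tailMass (h : MPwCont (jumps d l) ρ) {y : ℝ} (hy : y ∉ jumps d l) :
    EntryDeriv (tailMass d Θ₁ Θ₂ l ρ) (-density d Θ₁ Θ₂ l ρ y) y :=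
  (mPwCont_density h).entryDeriv_entryInt_left _ hy

theorem mass_eq : mass d Θ₁ Θ₂ l i ρ = unitRow i + tailMass d Θ₁ Θ₂ l ρ 0 := rfl

theorem tailMass_final : tailMass d Θ₁ Θ₂ l ρ (node d 0 * l) = 0 := entryInt_same _ _

theorem density_apply (y : ℝ) (k : Fin p) : density d Θ₁ Θ₂ l ρ y () k =
    (ρ y * colΘ Θ₁ Θ₂) () k * ((d k : ℂ)⁻¹ * if y < d k * l then 1 else 0) := by
  rw [density, Dinv, cut, Matrix.diagonal_mul_diagonal, Matrix.mul_diagonal]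

/-- The cut switches the k-th coordinate of the density off beyond d_k l. -/
theorem tailMass_apply_eq_zero {y : ℝ} {k : Fin p} (hy : d k * l ≤ y)
    (hya : y ≤ node d 0 * l) : tailMass d Θ₁ Θ₂ l ρ y () k = 0 := by
  simp only [tailMass, entryInt, Matrix.of_apply]
  rw [intervalIntegral.integral_congr (g := fun _ => 0), intervalIntegral.integral_zero]
  intro z hz
  rw [Set.uIcc_of_le hya] at hz
  simp only [density_apply]
  rw [if_neg (not_lt.2 (hy.trans hz.1)), mul_zero, mul_zero]

end

theorem mul_coeffA (ρ : ℝ → Matrix Unit (Fin n ⊕ Fin n) ℂ) (y : ℝ) :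
    ρ y * coeffA d β Θ₁ Θ₂ l y = ρ y * calA β + density d Θ₁ Θ₂ l ρ y * rowΘ Θ₁ Θ₂ := by
  simp only [coeffA, density, Matrix.mul_add, Matrix.mul_assoc]

/-- `θ 𝒜 + s [Θ₂* Θ₁*] - ρ - m [0 Θ₁*] e^{-y𝒜} = 0`, on both sides of the jump. -/
theorem RowState.integratedRow_mul_calA (hd : ∀ i, 0 < d i) (hanti : Antitone d) (hl : 0 ≤ l)
    (h : RowState d β Θ₁ Θ₂ l i ρm ρp) :
    (∀ y ∈ Set.Icc 0 (d i * l), integratedRow d β Θ₁ Θ₂ l i (glue d l i ρm ρp) y * calA β +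
      (unitRow i + tailMass d Θ₁ Θ₂ l (glue d l i ρm ρp) y) * rowΘ Θ₁ Θ₂ - ρm y -
        mass d Θ₁ Θ₂ l i (glue d l i ρm ρp) * freeRow β Θ₁ Θ₂ y = 0) ∧
    (∀ y ∈ Set.Icc (d i * l) (node d 0 * l),
      integratedRow d β Θ₁ Θ₂ l i (glue d l i ρm ρp) y * calA β +
      tailMass d Θ₁ Θ₂ l (glue d l i ρm ρp) y * rowΘ Θ₁ Θ₂ - ρp y -
        mass d Θ₁ Θ₂ l i (glue d l i ρm ρp) * freeRow β Θ₁ Θ₂ y = 0) := by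
  set ρ := glue d l i ρm ρp with hρ
  set a := node d 0 * l with ha
  set c := d i * l with hc
  set m := mass d Θ₁ Θ₂ l i ρ with hm
  have hc0 : 0 ≤ c := mul_nonneg (hd i).le hl
  have hca : c ≤ a := le_node_zero hd hanti hl i
  have hpw : MPwCont (jumps d l) ρ := h.mPwCont_glue
  set Δm : ℝ → Matrix Unit (Fin n ⊕ Fin n) ℂ := fun y =>
    integratedRow d β Θ₁ Θ₂ l i ρ y * calA β +
      (unitRow i + tailMass d Θ₁ Θ₂ l ρ y) * rowΘ Θ₁ Θ₂ - ρm y - m * freeRow β Θ₁ Θ₂ y with hΔm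
  set Δp : ℝ → Matrix Unit (Fin n ⊕ Fin n) ℂ := fun y =>
    integratedRow d β Θ₁ Θ₂ l i ρ y * calA β +
      tailMass d Θ₁ Θ₂ l ρ y * rowΘ Θ₁ Θ₂ - ρp y - m * freeRow β Θ₁ Θ₂ y with hΔp
  have hθc := (continuous_integratedRow (β := β) (Θ₁ := Θ₁) (Θ₂ := Θ₂) (i := i) hpw).matrix_mul
    (continuous_const (y := calA β))
  have htc := continuous_tailMass (Θ₁ := Θ₁) (Θ₂ := Θ₂) hpw
  have hfc := (continuous_const (y := m)).matrix_mul
    (continuous_freeRow (β := β) (Θ₁ := Θ₁) (Θ₂ := Θ₂))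
  have hΔmc : Continuous Δm := ((hθc.add ((continuous_const.add htc).matrix_mul
    continuous_const)).sub h.contm).sub hfc
  have hΔpc : Continuous Δp := ((hθc.add (htc.matrix_mul continuous_const)).sub h.contp).sub hfc
  have hΔmd : ∀ y ∈ Set.Ioo 0 c \ jumps d l, EntryDeriv Δm 0 y := by
    intro y hy
    have hρy : ρ y = ρm y := if_pos hy.1.2
    have hdens : density d Θ₁ Θ₂ l ρm y = density d Θ₁ Θ₂ l ρ y := by
      rw [density, density, hρy]
    have h1 := ((((entryDeriv_integratedRow (β := β) (Θ₁ := Θ₁) (Θ₂ := Θ₂) (i := i) hpw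
      hy.2).mul_const (calA β)).add (((EntryDeriv.const (unitRow i) y).add
        (entryDeriv_tailMass (Θ₁ := Θ₁) (Θ₂ := Θ₂) hpw hy.2)).mul_const (rowΘ Θ₁ Θ₂))).sub
        (h.derivm y ⟨⟨hy.1.1, hy.1.2.trans_le hca⟩, hy.2⟩)).sub
        ((entryDeriv_freeRow (β := β) (Θ₁ := Θ₁) (Θ₂ := Θ₂) y).const_mul m)
    refine EntryDeriv.congr_deriv h1 ?_
    rw [mul_coeffA, hdens, hρy]
    simp only [Matrix.neg_mul, Matrix.add_mul, Matrix.mul_neg, zero_add, Matrix.mul_assoc, ← hm]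
    abel
  have hΔpd : ∀ y ∈ Set.Ioo c a \ jumps d l, EntryDeriv Δp 0 y := by
    intro y hy
    have hρy : ρ y = ρp y := if_neg (not_lt.2 hy.1.1.le)
    have hdens : density d Θ₁ Θ₂ l ρp y = density d Θ₁ Θ₂ l ρ y := by
      rw [density, density, hρy]
    have h1 := ((((entryDeriv_integratedRow (β := β) (Θ₁ := Θ₁) (Θ₂ := Θ₂) (i := i) hpw
      hy.2).mul_const (calA β)).add ((entryDeriv_tailMass (Θ₁ := Θ₁) (Θ₂ := Θ₂) hpw hy.2).mul_const (rowΘ Θ₁ Θ₂))).sub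
        (h.derivp y ⟨⟨hc0.trans_lt hy.1.1, hy.1.2⟩, hy.2⟩)).sub
        ((entryDeriv_freeRow (β := β) (Θ₁ := Θ₁) (Θ₂ := Θ₂) y).const_mul m)
    refine EntryDeriv.congr_deriv h1 ?_
    rw [mul_coeffA, hdens, hρy]
    simp only [Matrix.neg_mul, Matrix.add_mul, Matrix.mul_neg, Matrix.mul_assoc, ← hm]
    abel
  -- The jump of ρ at c is exactly the term that disappears when the unit row is dropped.
  have hΔc : Δm c = Δp c := by
    have := h.jump
    rw [← hc, sub_eq_iff_eq_add] at this
    simp only [hΔm, hΔp, Matrix.add_mul, this]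
    abel
  have hconstm : ∀ y ∈ Set.Icc 0 c, Δm y = Δm c := fun y hy =>
    eq_of_entryDeriv_zero (finite_jumps d l) hΔmc hΔmd hy ⟨hc0, le_rfl⟩
  have hconstp : ∀ y ∈ Set.Icc c a, Δp y = Δp c := fun y hy =>
    eq_of_entryDeriv_zero (finite_jumps d l) hΔpc hΔpd hy ⟨le_rfl, hca⟩
  -- The free row was included in θ for this: at 0 its coefficient is the full mass, which cancels
  -- the unit row plus the whole tail.
  have h0 : Δm 0 * projSnd n = 0 := by
    simp only [hΔm, Matrix.add_mul, Matrix.sub_mul, h.zero, freeRow_zero, hm, mass_eq]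
    rw [Matrix.mul_assoc _ (calA β), calA_mul_projSnd, ← Matrix.mul_assoc, integratedRow_zero_mul,
      Matrix.zero_mul, ← Matrix.mul_assoc, Matrix.mul_assoc _ _ (projSnd n),
      Matrix.mul_assoc _ _ (projSnd n), Matrix.mul_assoc _ _ (projSnd n)]
    simp only [Matrix.mul_assoc, projSnd_mul_projSnd]
    abel
  have ha' : Δp a * projFst n = 0 := by
    simp only [hΔp, Matrix.add_mul, Matrix.sub_mul, h.final, ha, tailMass_final]
    rw [Matrix.mul_assoc _ (calA β), calA_mul_projFst, ← Matrix.mul_assoc, integratedRow_final_mul,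
      Matrix.mul_assoc _ (freeRow β Θ₁ Θ₂ _), freeRow_mul_projFst]
    simp
  -- The common constant has no second half, as seen at 0, and no first half, as seen at a.
  have hzero : Δm c = 0 := by
    rw [← Matrix.mul_one (Δm c), ← projFst_add_projSnd, Matrix.mul_add, ← hconstm 0 ⟨le_rfl, hc0⟩, h0,
      hconstm 0 ⟨le_rfl, hc0⟩, hΔc, ← hconstp a ⟨hca, le_rfl⟩, ha', add_zero]
  exact ⟨fun y hy => (hconstm y hy).trans hzero,
    fun y hy => (hconstp y hy).trans (hΔc ▸ hzero)⟩

theorem calA_mul_entryInt_exp (y : ℝ) :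
    calA β * entryInt (fun u : ℝ => NormedSpace.exp ((u : ℂ) • calA β)) 0 y =
      NormedSpace.exp ((y : ℂ) • calA β) - 1 := by
  have hc := continuous_exp_calA (β := β)
  have hpw : MPwCont ∅ fun u : ℝ => NormedSpace.exp ((u : ℂ) • calA β) := MPwCont.of_continuous hc
  rw [← MPwCont.entryInt_const_mul (N := ∅) _ hpw]
  ext i j
  have h := intervalIntegral.integral_eq_sub_of_hasDerivAt
    (f := fun u : ℝ => NormedSpace.exp ((u : ℂ) • calA β) i j)
    (f' := fun u : ℝ => (calA β * NormedSpace.exp ((u : ℂ) • calA β)) i j) (a := 0) (b := y)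
    (fun u _ => entryDeriv_exp_calA u i j)
    (((MPwCont.const (N := ∅) _).mul hpw).intervalIntegrable 0 y i j)
  simpa [entryInt] using h

theorem continuous_intKernel : Continuous (intKernel β Θ₁ Θ₂) := by
  have hpw : MPwCont ∅ fun u : ℝ => NormedSpace.exp ((u : ℂ) • calA β) :=
    MPwCont.of_continuous continuous_exp_calA
  exact ((continuous_const.matrix_mul (hpw.continuous_entryInt 0)).matrix_mul continuous_const).neg

/-- `κ = -θ(0) [-Θ₁; Θ₂]`. -/
theorem RowState.kernelMass_eq (hd : ∀ i, 0 < d i) (hanti : Antitone d) (hl : 0 ≤ l)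
    (h : RowState d β Θ₁ Θ₂ l i ρm ρp) :
    kernelMass d β Θ₁ Θ₂ l i (glue d l i ρm ρp) =
      -(integratedRow d β Θ₁ Θ₂ l i (glue d l i ρm ρp) 0 * colΘ Θ₁ Θ₂) := by
  set ρ := glue d l i ρm ρp with hρ
  set a := node d 0 * l with ha
  set c := d i * l with hc
  have hc0 : 0 ≤ c := mul_nonneg (hd i).le hl
  have hca : c ≤ a := le_node_zero hd hanti hl i
  have hpw : MPwCont (jumps d l) ρ := h.mPwCont_glue
  set Q : ℝ → Matrix (Fin n ⊕ Fin n) (Fin n ⊕ Fin n) ℂ := fun y =>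
    projFst n * entryInt (fun u : ℝ => NormedSpace.exp ((u : ℂ) • calA β)) 0 y with hQ
  have hepw : MPwCont ∅ fun u : ℝ => NormedSpace.exp ((u : ℂ) • calA β) :=
    MPwCont.of_continuous continuous_exp_calA
  have hQc : Continuous Q := continuous_const.matrix_mul (hepw.continuous_entryInt 0)
  have hQd : ∀ y : ℝ, EntryDeriv Q (projFst n * NormedSpace.exp ((y : ℂ) • calA β)) y := fun y =>
    (hepw.entryDeriv_entryInt 0 (Set.notMem_empty y)).const_mul _
  have hAQ : ∀ y : ℝ, calA β * Q y = projFst n * NormedSpace.exp ((y : ℂ) • calA β) - projFst n := by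
    intro y
    simp only [hQ]
    rw [← Matrix.mul_assoc, calA_mul_projFst, Matrix.mul_assoc, calA_mul_entryInt_exp,
      Matrix.mul_sub, Matrix.mul_one]
  -- I is the derivative of ρQ on each side of the jump. Since Q(0) = 0 and ρQ vanishes at a, its
  -- integral is the jump contribution at c, which gives θ(0) in terms of Q and the density.
  set I : ℝ → Matrix Unit (Fin n ⊕ Fin n) ℂ := fun y =>
    ρ y * projFst n - density d Θ₁ Θ₂ l ρ y * (rowΘ Θ₁ Θ₂ * Q y) with hI
  have hρpi : MPwCont (jumps d l) fun y => ρ y * projFst n := hpw.mul (MPwCont.const _)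
  have hgQ : MPwCont (jumps d l) fun y => density d Θ₁ Θ₂ l ρ y * (rowΘ Θ₁ Θ₂ * Q y) :=
    (mPwCont_density hpw).mul ((MPwCont.const _).mul (MPwCont.of_continuous hQc))
  have hIpw : MPwCont (jumps d l) I := hρpi.sub hgQ
  have hderiv : ∀ (r : ℝ → Matrix Unit (Fin n ⊕ Fin n) ℂ) (y : ℝ), ρ y = r y →
      EntryDeriv r (-(r y * coeffA d β Θ₁ Θ₂ l y)) y → EntryDeriv (fun y => r y * Q y) (I y) y := by
    intro r y hry hr
    have hdens : density d Θ₁ Θ₂ l r y = density d Θ₁ Θ₂ l ρ y := by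
      rw [density, density, hry]
    have h1 := hr.mul (hQd y)
    refine EntryDeriv.congr_deriv h1 ?_
    rw [mul_coeffA, hdens, Matrix.neg_mul, Matrix.add_mul, Matrix.mul_assoc _ _ (Q y), hAQ]
    simp only [hI, hry, Matrix.mul_sub, Matrix.mul_assoc]
    abel
  have hQ0 : Q 0 = 0 := by simp only [hQ, entryInt_same, Matrix.mul_zero]
  have h1 : entryInt I 0 c = ρm c * Q c := by
    rw [entryInt_eq_sub (F := fun y => ρm y * Q y) (finite_jumps d l) hc0
      (h.contm.matrix_mul hQc) hIpw, hQ0, Matrix.mul_zero, sub_zero]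
    intro y hy
    exact hderiv ρm y (if_pos hy.1.2) (h.derivm y ⟨⟨hy.1.1, hy.1.2.trans_le hca⟩, hy.2⟩)
  have h2 : entryInt I c a = -(ρp c * Q c) := by
    rw [entryInt_eq_sub (F := fun y => ρp y * Q y) (finite_jumps d l) hca
      (h.contp.matrix_mul hQc) hIpw]
    · have : ρp a * Q a = 0 := by
        simp only [hQ]
        rw [← Matrix.mul_assoc, h.final, Matrix.zero_mul]
      rw [this, zero_sub]
    · intro y hy
      exact hderiv ρp y (if_neg (not_lt.2 hy.1.1.le))
        (h.derivp y ⟨⟨hc0.trans_lt hy.1.1, hy.1.2⟩, hy.2⟩)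
  have h3 : entryInt I 0 a = unitRow i * rowΘ Θ₁ Θ₂ * Q c := by
    rw [← hIpw.entryInt_add_adjacent 0 c a, h1, h2, ← sub_eq_add_neg, ← Matrix.sub_mul, h.jump]
  rw [hI, hρpi.entryInt_sub hgQ, hpw.entryInt_mul_const] at h3
  have h4 : integratedRow d β Θ₁ Θ₂ l i ρ 0 = entryInt ρ 0 a * projFst n := by
    rw [integratedRow, entryInt_same, Matrix.zero_mul, sub_zero]
  have h5 : ∀ y, intKernel β Θ₁ Θ₂ y = -(rowΘ Θ₁ Θ₂ * Q y * colΘ Θ₁ Θ₂) := fun y => by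
    simp only [intKernel, hQ, Matrix.mul_assoc]
  have h6 : entryInt (fun y => density d Θ₁ Θ₂ l ρ y * intKernel β Θ₁ Θ₂ y) 0 a =
      -(entryInt (fun y => density d Θ₁ Θ₂ l ρ y * (rowΘ Θ₁ Θ₂ * Q y)) 0 a * colΘ Θ₁ Θ₂) := by
    rw [← hgQ.entryInt_mul_const, ← entryInt_neg]
    congr 1
    funext y
    rw [h5, Matrix.mul_neg]
    simp only [Matrix.mul_assoc]
  rw [kernelMass, h6, h5, h4, sub_eq_iff_eq_add.1 h3, Matrix.add_mul, Matrix.mul_neg]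
  simp only [Matrix.mul_assoc]
  abel

/-- Taking adjoints turns Θ₂* e^{iuβ*} Θ₁ into Θ₁* e^{-iuβ} Θ₂, the product of the free row with the
column. The correction put into θ thus produces K*. -/
theorem conjTranspose_intKernel (y : ℝ) : (intKernel β Θ₁ Θ₂ y)ᴴ =
    entryInt (fun u => freeRow β Θ₁ Θ₂ u * colΘ Θ₁ Θ₂) 0 y := by
  have hepw : MPwCont ∅ fun u : ℝ => NormedSpace.exp ((u : ℂ) • calA β) :=
    MPwCont.of_continuous continuous_exp_calA
  rw [intKernel, ← hepw.entryInt_const_mul, ← ((MPwCont.const _).mul hepw).entryInt_mul_const,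
    ← entryInt_neg, ← entryInt_conjTranspose]
  congr 1
  funext u
  rw [exp_calA, freeRow, exp_calA, rowΘ, colΘ, projFst, projSnd, Matrix.fromCols_mul_fromBlocks,
    Matrix.fromCols_mul_fromBlocks, Matrix.fromCols_mul_fromBlocks, Matrix.fromCols_mul_fromBlocks,
    Matrix.fromCols_mul_fromRows, Matrix.fromCols_mul_fromRows]
  simp only [Matrix.mul_zero, Matrix.mul_one, Matrix.zero_mul, add_zero, zero_add, Matrix.mul_neg,
    neg_neg, Matrix.conjTranspose_mul, Matrix.conjTranspose_conjTranspose,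
    ← Matrix.exp_conjTranspose, Matrix.conjTranspose_smul]
  rw [Matrix.mul_assoc]
  simp

/-- The integrated equation, coordinate by coordinate. -/
theorem RowState.tailMass_sub_integratedRow (hd : ∀ i, 0 < d i) (hanti : Antitone d) (hl : 0 ≤ l)
    (h : RowState d β Θ₁ Θ₂ l i ρm ρp) (k : Fin p) {y : ℝ} (hy : y ∈ Set.Icc 0 (d k * l)) :
    (unitRow i + tailMass d Θ₁ Θ₂ l (glue d l i ρm ρp) y) () k * d k -
      (integratedRow d β Θ₁ Θ₂ l i (glue d l i ρm ρp) y * colΘ Θ₁ Θ₂) () k =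
    mass d Θ₁ Θ₂ l i (glue d l i ρm ρp) () k * d k +
      kernelMass d β Θ₁ Θ₂ l i (glue d l i ρm ρp) () k +
      (mass d Θ₁ Θ₂ l i (glue d l i ρm ρp) * (intKernel β Θ₁ Θ₂ y)ᴴ) () k := by
  set ρ := glue d l i ρm ρp with hρ
  set m := mass d Θ₁ Θ₂ l i ρ with hm
  have hpw : MPwCont (jumps d l) ρ := h.mPwCont_glue
  have hk0 : 0 ≤ d k * l := mul_nonneg (hd k).le hl
  -- This quantity is constant up to d_k l: there the cut equals 1, so d_k times the density is
  -- (ρ[-Θ₁; Θ₂])_k and cancels against θ'. Its value at 0 contains κ by `RowState.kernelMass_eq`.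
  set f : ℝ → ℂ := fun y => (unitRow i + tailMass d Θ₁ Θ₂ l ρ y) () k * d k -
    (integratedRow d β Θ₁ Θ₂ l i ρ y * colΘ Θ₁ Θ₂) () k - (m * (intKernel β Θ₁ Θ₂ y)ᴴ) () k with hf
  have hfc : Continuous f := by
    refine Continuous.sub (Continuous.sub (Continuous.mul ?_ continuous_const) ?_) ?_
    · exact (continuous_const.add (continuous_tailMass hpw)).matrix_elem () k
    · exact ((continuous_integratedRow hpw).matrix_mul continuous_const).matrix_elem () k
    · exact (continuous_const.matrix_mul
        continuous_intKernel.matrix_conjTranspose).matrix_elem () k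
  have hfd : ∀ y ∈ Set.Ioo 0 (d k * l) \ jumps d l, HasDerivAt f 0 y := by
    intro y hy
    have hKpw : MPwCont ∅ fun u => freeRow β Θ₁ Θ₂ u * colΘ Θ₁ Θ₂ :=
      MPwCont.of_continuous (continuous_freeRow.matrix_mul continuous_const)
    have hK : EntryDeriv (fun y => m * (intKernel β Θ₁ Θ₂ y)ᴴ)
        (m * (freeRow β Θ₁ Θ₂ y * colΘ Θ₁ Θ₂)) y := by
      simp only [conjTranspose_intKernel]
      exact (hKpw.entryDeriv_entryInt 0 (Set.notMem_empty y)).const_mul m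
    have h1 := (((((EntryDeriv.const (unitRow i) y).add (entryDeriv_tailMass (Θ₁ := Θ₁)
      (Θ₂ := Θ₂) hpw hy.2)) () k).mul_const (d k : ℂ)).sub
      (((entryDeriv_integratedRow (β := β) (Θ₁ := Θ₁) (Θ₂ := Θ₂) (i := i) hpw hy.2).mul_const
        (colΘ Θ₁ Θ₂)) () k)).sub (hK () k)
    refine h1.congr_deriv ?_
    have hdk : (d k : ℂ) ≠ 0 := by exact_mod_cast (hd k).ne'
    rw [zero_add, Matrix.neg_apply, density_apply, if_pos hy.1.2, Matrix.neg_mul, Matrix.neg_apply,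
      Matrix.add_mul, Matrix.add_apply, Matrix.mul_assoc m]
    field_simp
    ring
  have hconst := continuousOn_eq_of_deriv_zero (finite_jumps d l) hfc.continuousOn hfd hy
    (⟨le_rfl, hk0⟩ : (0 : ℝ) ∈ Set.Icc 0 (d k * l))
  have h0 : f 0 = m () k * d k + kernelMass d β Θ₁ Θ₂ l i ρ () k := by
    simp only [hf]
    rw [h.kernelMass_eq hd hanti hl, conjTranspose_intKernel, entryInt_same, Matrix.mul_zero,
      ← mass_eq (i := i), Matrix.neg_apply, Matrix.zero_apply]
    ring
  rw [h0] at hconst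
  rw [← hconst]
  simp only [hf]
  ring

/-- Green's identity for the integrated state of `j` and the state of `i`. -/
theorem RowState.green (hd : ∀ i, 0 < d i) (hanti : Antitone d) (hl : 0 ≤ l)
    (h : RowState d β Θ₁ Θ₂ l i ρm ρp) (h' : RowState d β Θ₁ Θ₂ l j τm τp) :
    entryInt (fun y => ((if y < d j * l then unitRow j else 0) +
        tailMass d Θ₁ Θ₂ l (glue d l j τm τp) y) * ((colΘ Θ₁ Θ₂)ᴴ * (glue d l i ρm ρp y)ᴴ) -
      integratedRow d β Θ₁ Θ₂ l j (glue d l j τm τp) y *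
        (colΘ Θ₁ Θ₂ * (density d Θ₁ Θ₂ l (glue d l i ρm ρp) y)ᴴ)) 0 (node d 0 * l) =
      integratedRow d β Θ₁ Θ₂ l j (glue d l j τm τp) (d i * l) * colΘ Θ₁ Θ₂ * (unitRow i)ᴴ := by
  set ρ := glue d l i ρm ρp with hρ
  set τ := glue d l j τm τp with hτ
  set a := node d 0 * l with ha
  set c := d i * l with hc
  set m := mass d Θ₁ Θ₂ l j τ with hm
  set θ := integratedRow d β Θ₁ Θ₂ l j τ with hθ
  have hc0 : 0 ≤ c := mul_nonneg (hd i).le hl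
  have hca : c ≤ a := le_node_zero hd hanti hl i
  have hpw : MPwCont (jumps d l) ρ := h.mPwCont_glue
  have hpw' : MPwCont (jumps d l) τ := h'.mPwCont_glue
  have hθc : Continuous θ := continuous_integratedRow hpw'
  set s : ℝ → Matrix Unit (Fin p) ℂ := fun y => (if y < d j * l then unitRow j else 0) +
    tailMass d Θ₁ Θ₂ l τ y with hs
  have hspw : MPwCont (jumps d l) s := ((MPwCont.const _).ite (MPwCont.const _)
    (mem_jumps d l j)).add (MPwCont.of_continuous (continuous_tailMass hpw'))
  set I : ℝ → Matrix Unit Unit ℂ := fun y => s y * ((colΘ Θ₁ Θ₂)ᴴ * (ρ y)ᴴ) -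
    θ y * (colΘ Θ₁ Θ₂ * (density d Θ₁ Θ₂ l ρ y)ᴴ) with hI
  have hIpw : MPwCont (jumps d l) I :=
    (hspw.mul ((MPwCont.const _).mul hpw.conjTranspose)).sub
      ((MPwCont.of_continuous hθc).mul ((MPwCont.const _).mul (mPwCont_density hpw).conjTranspose))
  have hsC : ∀ y ∈ Set.Ioo 0 a, s y * rowΘ Θ₁ Θ₂ =
      τ y + m * freeRow β Θ₁ Θ₂ y - θ y * calA β := by
    intro y hy
    obtain ⟨e1, e2⟩ := h'.integratedRow_mul_calA hd hanti hl
    by_cases hyj : y < d j * l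
    · have := e1 y ⟨hy.1.le, hyj.le⟩
      simp only [hs, if_pos hyj]
      rw [hτ, glue, if_pos hyj, ← sub_eq_zero, ← this]
      abel
    · have := e2 y ⟨not_lt.1 hyj, hy.2.le⟩
      simp only [hs, if_neg hyj, zero_add]
      rw [hτ, glue, if_neg hyj, ← sub_eq_zero, ← this]
      abel
  -- The integrand is an exact derivative: `hsC` trades the tail of τ for θ𝒜, and skew-adjointness
  -- of 𝒜 cancels the rest.
  have hderiv : ∀ (r : ℝ → Matrix Unit (Fin n ⊕ Fin n) ℂ) (y : ℝ), ρ y = r y →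
      y ∈ Set.Ioo 0 a \ jumps d l → EntryDeriv r (-(r y * coeffA d β Θ₁ Θ₂ l y)) y →
      EntryDeriv (fun y => -(θ y * (skewJ n * (r y)ᴴ))) (I y) y := by
    intro r y hry hy hr
    have hdens : density d Θ₁ Θ₂ l r y = density d Θ₁ Θ₂ l ρ y := by
      rw [density, density, hry]
    have h1 := ((entryDeriv_integratedRow (β := β) (Θ₁ := Θ₁) (Θ₂ := Θ₂) (i := j) hpw' hy.2).mul
      (hr.conjTranspose.const_mul (skewJ n))).neg
    refine EntryDeriv.congr_deriv h1 ?_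
    rw [mul_coeffA, hdens, ← hm, ← hθ, Matrix.conjTranspose_neg, Matrix.conjTranspose_add,
      Matrix.conjTranspose_mul, Matrix.conjTranspose_mul, Matrix.mul_neg, Matrix.mul_add,
      ← Matrix.mul_assoc (skewJ n), ← Matrix.mul_assoc (skewJ n), skewJ_mul_conjTranspose_calA,
      skewJ_mul_conjTranspose_rowΘ]
    simp only [hI]
    rw [← rowΘ_mul_skewJ, Matrix.mul_assoc (rowΘ Θ₁ Θ₂), ← Matrix.mul_assoc (s y), hsC y hy.1, hry]
    simp only [Matrix.sub_mul, Matrix.add_mul, Matrix.neg_mul, Matrix.mul_add, Matrix.mul_assoc,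
      neg_add, neg_neg]
    abel
  have hcont : ∀ {r : ℝ → Matrix Unit (Fin n ⊕ Fin n) ℂ}, Continuous r →
      Continuous fun y => -(θ y * (skewJ n * (r y)ᴴ)) := fun hr =>
    (hθc.matrix_mul (continuous_const.matrix_mul hr.matrix_conjTranspose)).neg
  -- The skew form pairs first halves only with second halves. Here θ and ρ have only first halves,
  -- and at a only second ones, so no boundary terms remain apart from the jump.
  have hz0 : θ 0 * (skewJ n * (ρm 0)ᴴ) = 0 := by
    have e1 : θ 0 = θ 0 * projFst n := by
      conv_lhs => rw [← Matrix.mul_one (θ 0), ← projFst_add_projSnd, Matrix.mul_add, hθ,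
        integratedRow_zero_mul, add_zero]
    have e2 : projSnd n * (ρm 0)ᴴ = 0 := by
      have := congrArg Matrix.conjTranspose h.zero
      rwa [Matrix.conjTranspose_mul, conjTranspose_projSnd, Matrix.conjTranspose_zero] at this
    rw [e1, Matrix.mul_assoc, ← Matrix.mul_assoc (projFst n), projFst_mul_skewJ, Matrix.mul_assoc,
      e2, Matrix.mul_zero, Matrix.mul_zero]
  have hza : θ a * (skewJ n * (ρp a)ᴴ) = 0 := by
    have e1 : θ a = θ a * projSnd n := by
      conv_lhs => rw [← Matrix.mul_one (θ a), ← projFst_add_projSnd, Matrix.mul_add, hθ,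
        integratedRow_final_mul, zero_add]
    have e2 : projFst n * (ρp a)ᴴ = 0 := by
      have := congrArg Matrix.conjTranspose h.final
      rwa [Matrix.conjTranspose_mul, conjTranspose_projFst, Matrix.conjTranspose_zero] at this
    rw [e1, Matrix.mul_assoc, ← Matrix.mul_assoc (projSnd n), projSnd_mul_skewJ, Matrix.mul_assoc,
      e2, Matrix.mul_zero, Matrix.mul_zero]
  have h1 : entryInt I 0 c = -(θ c * (skewJ n * (ρm c)ᴴ)) := by
    rw [entryInt_eq_sub (finite_jumps d l) hc0 (hcont h.contm) hIpw, hz0]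
    · simp
    · intro y hy
      have hy' : y ∈ Set.Ioo 0 a \ jumps d l := ⟨⟨hy.1.1, hy.1.2.trans_le hca⟩, hy.2⟩
      exact hderiv ρm y (if_pos hy.1.2) hy' (h.derivm y hy')
  have h2 : entryInt I c a = θ c * (skewJ n * (ρp c)ᴴ) := by
    rw [entryInt_eq_sub (finite_jumps d l) hca (hcont h.contp) hIpw, hza]
    · simp
    · intro y hy
      have hy' : y ∈ Set.Ioo 0 a \ jumps d l := ⟨⟨hc0.trans_lt hy.1.1, hy.1.2⟩, hy.2⟩
      exact hderiv ρp y (if_neg (not_lt.2 hy.1.1.le)) hy' (h.derivp y hy')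
  rw [← hIpw.entryInt_add_adjacent 0 c a, h1, h2]
  have h3 : ρm c = unitRow i * rowΘ Θ₁ Θ₂ + ρp c := sub_eq_iff_eq_add.1 h.jump
  rw [h3, Matrix.conjTranspose_add, Matrix.conjTranspose_mul, Matrix.mul_add,
    ← Matrix.mul_assoc (skewJ n) ((rowΘ Θ₁ Θ₂)ᴴ), skewJ_mul_conjTranspose_rowΘ, Matrix.mul_add,
    Matrix.neg_mul, Matrix.mul_neg, Matrix.mul_assoc]
  abel

/-- The bilinear identity behind `γ J γ* = D`. -/
theorem RowState.pairing (hd : ∀ i, 0 < d i) (hanti : Antitone d) (hl : 0 ≤ l)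
    (h : RowState d β Θ₁ Θ₂ l i ρm ρp) (h' : RowState d β Θ₁ Θ₂ l j τm τp) :
    (mass d Θ₁ Θ₂ l j (glue d l j τm τp) * D d * (mass d Θ₁ Θ₂ l i (glue d l i ρm ρp))ᴴ +
      kernelMass d β Θ₁ Θ₂ l j (glue d l j τm τp) * (mass d Θ₁ Θ₂ l i (glue d l i ρm ρp))ᴴ +
      mass d Θ₁ Θ₂ l j (glue d l j τm τp) *
        (kernelMass d β Θ₁ Θ₂ l i (glue d l i ρm ρp))ᴴ) () () = D d j i := by
  have hgreen := h.green hd hanti hl h'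
  set ρ := glue d l i ρm ρp with hρ
  set τ := glue d l j τm τp with hτ
  set a := node d 0 * l with ha
  set c := d i * l with hc
  set m := mass d Θ₁ Θ₂ l j τ with hm
  set κ := kernelMass d β Θ₁ Θ₂ l j τ with hκ
  set θ := integratedRow d β Θ₁ Θ₂ l j τ with hθ
  have hc0 : 0 ≤ c := mul_nonneg (hd i).le hl
  have hca : c ≤ a := le_node_zero hd hanti hl i
  have ha0 : 0 ≤ a := hc0.trans hca
  have hpw : MPwCont (jumps d l) ρ := h.mPwCont_glue
  set g := density d Θ₁ Θ₂ l ρ with hg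
  have hgpw : MPwCont (jumps d l) g := mPwCont_density hpw
  set K : ℝ → Matrix (Fin p) (Fin p) ℂ := fun y => (intKernel β Θ₁ Θ₂ y)ᴴ with hK
  have hKpw : MPwCont (jumps d l) K :=
    MPwCont.of_continuous continuous_intKernel.matrix_conjTranspose
  -- The whole expression is R paired with the unit mass at c plus the density of i. By `hrel`, the
  -- k-th coordinate of R is known only up to d_k l, which is just where the density does not
  -- vanish.
  set R : ℝ → Matrix Unit (Fin p) ℂ := fun y => m * D d + κ + m * K y with hR
  have hRpw : MPwCont (jumps d l) R := (MPwCont.const _).add ((MPwCont.const _).mul hKpw)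
  have hrel : ∀ k, ∀ y ∈ Set.Icc 0 (d k * l), R y () k =
      (unitRow j + tailMass d Θ₁ Θ₂ l τ y) () k * d k - (θ y * colΘ Θ₁ Θ₂) () k := by
    intro k y hy
    rw [h'.tailMass_sub_integratedRow hd hanti hl k hy]
    simp only [hR, hK, Matrix.add_apply, D, Matrix.mul_diagonal, ← hm, ← hκ, ← hτ]
  have h1 : m * D d * (mass d Θ₁ Θ₂ l i ρ)ᴴ + κ * (mass d Θ₁ Θ₂ l i ρ)ᴴ +
      m * (kernelMass d β Θ₁ Θ₂ l i ρ)ᴴ =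
      R c * (unitRow i)ᴴ + entryInt (fun y => R y * (g y)ᴴ) 0 a := by
    have e1 : entryInt (fun y => R y * (g y)ᴴ) 0 a =
        (m * D d + κ) * (entryInt g 0 a)ᴴ +
          m * (entryInt (fun y => g y * intKernel β Θ₁ Θ₂ y) 0 a)ᴴ := by
      rw [← entryInt_conjTranspose, ← entryInt_conjTranspose,
        ← hgpw.conjTranspose.entryInt_const_mul]
      have e2 : MPwCont (jumps d l) fun y => (g y * intKernel β Θ₁ Θ₂ y)ᴴ :=
        (hgpw.mul (MPwCont.of_continuous continuous_intKernel)).conjTranspose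
      rw [← e2.entryInt_const_mul, ← MPwCont.entryInt_add
        ((MPwCont.const _).mul hgpw.conjTranspose) ((MPwCont.const _).mul e2)]
      congr 1
      funext y
      simp only [hR, hK, Matrix.add_mul, Matrix.conjTranspose_mul, Matrix.mul_assoc]
    rw [e1, mass, kernelMass]
    simp only [hR, hK, Matrix.conjTranspose_add, Matrix.conjTranspose_mul, Matrix.mul_add,
      Matrix.add_mul, Matrix.mul_assoc, ← hg, ← ha, ← hc]
    abel
  have h2 : entryInt (fun y => R y * (g y)ᴴ) 0 a = θ c * colΘ Θ₁ Θ₂ * (unitRow i)ᴴ := by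
    rw [← hgreen]
    refine entryInt_congr ha0 (finite_jumps d l) fun y hy => ?_
    ext u v
    obtain rfl : u = () := rfl
    obtain rfl : v = () := rfl
    rw [Matrix.sub_apply, ← Matrix.mul_assoc (θ y), Matrix.mul_apply, Matrix.mul_apply,
      Matrix.mul_apply, ← Finset.sum_sub_distrib]
    refine Finset.sum_congr rfl fun k _ => ?_
    have hdk : (d k : ℂ) ≠ 0 := by exact_mod_cast (hd k).ne'
    have e1 : ((colΘ Θ₁ Θ₂)ᴴ * (ρ y)ᴴ) k () = star ((ρ y * colΘ Θ₁ Θ₂) () k) := by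
      rw [← Matrix.conjTranspose_mul, Matrix.conjTranspose_apply]
    rw [e1, Matrix.conjTranspose_apply, hg, density_apply]
    by_cases hyk : y < d k * l
    · rw [if_pos hyk, hrel k y ⟨hy.1.1.le, hyk.le⟩]
      have e2 : (((if y < d j * l then unitRow j else 0) + tailMass d Θ₁ Θ₂ l τ y :
          Matrix Unit (Fin p) ℂ)) () k = (unitRow j + tailMass d Θ₁ Θ₂ l τ y) () k := by
        rw [Matrix.add_apply, Matrix.add_apply]
        congr 1
        by_cases hkj : k = j
        · subst hkj; rw [if_pos hyk]
        · split_ifs <;> simp [unitRow, hkj]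
      rw [e2]
      simp only [mul_one, star_mul', Complex.star_def, map_inv₀, Complex.conj_ofReal]
      field_simp
    · rw [if_neg hyk]
      have e2 : (((if y < d j * l then unitRow j else 0) + tailMass d Θ₁ Θ₂ l τ y :
          Matrix Unit (Fin p) ℂ)) () k = 0 := by
        rw [Matrix.add_apply, tailMass_apply_eq_zero (not_lt.1 hyk) hy.1.2.le, add_zero]
        by_cases hkj : k = j
        · subst hkj; rw [if_neg hyk]; rfl
        · split_ifs <;> simp [unitRow, hkj]
      rw [e2]
      simp
  -- The values of θ at c cancel, and the i-th coordinate of the tail is 0 at c = d_i l.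
  rw [h1, h2, Matrix.add_apply, mul_conjTranspose_unitRow, mul_conjTranspose_unitRow,
    hrel i c ⟨hc0, le_rfl⟩, Matrix.add_apply, tailMass_apply_eq_zero le_rfl hca]
  by_cases hij : j = i
  · subst hij; simp [unitRow, D]
  · simp [unitRow, D, Matrix.diagonal_apply_ne _ hij, Ne.symm hij]

end RowStates

/-! ### The rows of γ as masses of row states. -/

section GammaFormula

variable {n p : ℕ} {d : Fin p → ℝ} {β : Matrix (Fin n) (Fin n) ℂ} {Θ₁ Θ₂ : Matrix (Fin n) (Fin p) ℂ}
  {x : ℝ}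

/-- The row states `[Θ₂* Θ₁*]_i V(d_i x) K V(y)⁻¹` with `V(y) = e^{y𝒜} U(y)`. -/
def kernelRow (d : Fin p → ℝ) (β : Matrix (Fin n) (Fin n) ℂ) (Θ₁ Θ₂ : Matrix (Fin n) (Fin p) ℂ)
    (x : ℝ) (i : Fin p) (K : Matrix (Fin n ⊕ Fin n) (Fin n ⊕ Fin n) ℂ) (y : ℝ) :
    Matrix Unit (Fin n ⊕ Fin n) ℂ :=
  unitRow i * rowΘ Θ₁ Θ₂ * fund d β Θ₁ Θ₂ x (d i * x) * K * (fund d β Θ₁ Θ₂ x y)⁻¹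

theorem continuous_kernelRow (i : Fin p) (K : Matrix (Fin n ⊕ Fin n) (Fin n ⊕ Fin n) ℂ) :
    Continuous (kernelRow d β Θ₁ Θ₂ x i K) :=
  continuous_const.matrix_mul (continuous_matrix_inv continuous_fund isUnit_fund)

theorem entryDeriv_kernelRow (hd : ∀ i, 0 < d i) (hanti : Antitone d) (hx : 0 ≤ x) (i : Fin p)
    (K : Matrix (Fin n ⊕ Fin n) (Fin n ⊕ Fin n) ℂ) {y : ℝ}
    (hy : y ∈ Set.Ioo 0 (node d 0 * x) \ jumps d x) :
    EntryDeriv (kernelRow d β Θ₁ Θ₂ x i K)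
      (-(kernelRow d β Θ₁ Θ₂ x i K y * coeffA d β Θ₁ Θ₂ x y)) y := by
  refine EntryDeriv.congr_deriv ((entryDeriv_inv (entryDeriv_fund hd hanti hx hy)
    (isUnit_fund y)).const_mul _) ?_
  have h : fund d β Θ₁ Θ₂ x y * (fund d β Θ₁ Θ₂ x y)⁻¹ = 1 :=
    Matrix.mul_nonsing_inv _ ((Matrix.isUnit_iff_isUnit_det _).1 (isUnit_fund y))
  simp only [kernelRow, Matrix.mul_neg, Matrix.mul_assoc, h, Matrix.mul_one]

theorem leftFactor_eq (y : ℝ) :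
    leftFactor d β Θ₁ Θ₂ x y = rowΘ Θ₁ Θ₂ * fund d β Θ₁ Θ₂ x y := by
  rw [leftFactor, Matrix.mul_assoc, exp_mul_U]

theorem rightFactor_eq (y : ℝ) :
    rightFactor d β Θ₁ Θ₂ x y = (fund d β Θ₁ Θ₂ x y)⁻¹ * colΘ Θ₁ Θ₂ := by
  rw [rightFactor, ← exp_mul_U, Matrix.mul_inv_rev, Matrix.inv_eq_left_inv (exp_neg_mul_exp_smul _ _)]

theorem lowerKernel_apply (i j : Fin p) (z : ℝ) : lowerKernel d β Θ₁ Θ₂ x (d i * x) z i j =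
    (kernelRow d β Θ₁ Θ₂ x i (1 - Px d β Θ₁ Θ₂ x) z * colΘ Θ₁ Θ₂) () j := by
  rw [← unitRow_mul (lowerKernel d β Θ₁ Θ₂ x (d i * x) z), lowerKernel, leftFactor_eq,
    rightFactor_eq, kernelRow]
  simp only [Matrix.mul_assoc]

theorem upperKernel_apply (i j : Fin p) (z : ℝ) : upperKernel d β Θ₁ Θ₂ x (d i * x) z i j =
    (kernelRow d β Θ₁ Θ₂ x i (-Px d β Θ₁ Θ₂ x) z * colΘ Θ₁ Θ₂) () j := by
  rw [← unitRow_mul (upperKernel d β Θ₁ Θ₂ x (d i * x) z), upperKernel, leftFactor_eq,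
    rightFactor_eq, kernelRow]
  simp only [Matrix.mul_assoc, Matrix.mul_neg, Matrix.neg_mul]

/-- The two kernel factors 1 - P^× and -P^× differ by the identity, which produces the jump. The
form of P^× is dictated by the two boundary conditions. -/
theorem rowState_kernelRow (hd : ∀ i, 0 < d i) (hanti : Antitone d) (hx : 0 ≤ x)
    (hU : IsUnit (U d β Θ₁ Θ₂ x (node d 0 * x)).toBlocks₂₂) (i : Fin p) :
    RowState d β Θ₁ Θ₂ x i (kernelRow d β Θ₁ Θ₂ x i (1 - Px d β Θ₁ Θ₂ x))
      (kernelRow d β Θ₁ Θ₂ x i (-Px d β Θ₁ Θ₂ x)) where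
  contm := continuous_kernelRow i _
  contp := continuous_kernelRow i _
  derivm _ hy := entryDeriv_kernelRow hd hanti hx i _ hy
  derivp _ hy := entryDeriv_kernelRow hd hanti hx i _ hy
  jump := by
    have h : fund d β Θ₁ Θ₂ x (d i * x) * (fund d β Θ₁ Θ₂ x (d i * x))⁻¹ = 1 :=
      Matrix.mul_nonsing_inv _ ((Matrix.isUnit_iff_isUnit_det _).1 (isUnit_fund _))
    rw [kernelRow, kernelRow, ← Matrix.sub_mul, ← Matrix.mul_sub, sub_neg_eq_add, sub_add_cancel,
      Matrix.mul_one, Matrix.mul_assoc, h, Matrix.mul_one]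
  zero := by
    have h : (1 - Px d β Θ₁ Θ₂ x) * projSnd n = 0 := by
      rw [Px, projSnd, ← Matrix.fromBlocks_one, sub_eq_add_neg, Matrix.fromBlocks_neg,
        Matrix.fromBlocks_add, Matrix.fromBlocks_multiply]
      simp
    rw [kernelRow, fund_zero hd hx, inv_one, Matrix.mul_one, Matrix.mul_assoc, h, Matrix.mul_zero]
  final := by
    set a := node d 0 * x with ha
    -- This factorization is where invertibility of U₂₂ enters: P^×U(a)⁻¹ then has no first column
    -- block.
    have hP : Px d β Θ₁ Θ₂ x = Matrix.fromBlocks 0 0 0 (U d β Θ₁ Θ₂ x a).toBlocks₂₂⁻¹ *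
        U d β Θ₁ Θ₂ x a := by
      rw [Px, ← ha]
      conv_rhs => rw [← Matrix.fromBlocks_toBlocks (U d β Θ₁ Θ₂ x a), Matrix.fromBlocks_multiply]
      simp [Matrix.nonsing_inv_mul _ ((Matrix.isUnit_iff_isUnit_det _).1 hU)]
    have hV : (fund d β Θ₁ Θ₂ x a)⁻¹ = (U d β Θ₁ Θ₂ x a)⁻¹ *
        NormedSpace.exp ((-a : ℂ) • calA β) := by
      rw [← exp_mul_U, Matrix.mul_inv_rev, Matrix.inv_eq_left_inv (exp_neg_mul_exp_smul _ _)]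
    have h : Px d β Θ₁ Θ₂ x * (fund d β Θ₁ Θ₂ x a)⁻¹ * projFst n = 0 := by
      rw [hP, hV, Matrix.mul_assoc _ (U d β Θ₁ Θ₂ x a), ← Matrix.mul_assoc (U d β Θ₁ Θ₂ x a),
        Matrix.mul_nonsing_inv _ ((Matrix.isUnit_iff_isUnit_det _).1 (isUnit_U a)),
        Matrix.one_mul, exp_calA, projFst, Matrix.fromBlocks_multiply, Matrix.fromBlocks_multiply]
      simp
    rw [kernelRow, Matrix.mul_neg, Matrix.neg_mul, Matrix.neg_mul, Matrix.mul_assoc _ (Px _ _ _ _ _),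
      Matrix.mul_assoc, h, Matrix.mul_zero, neg_zero]

/-- `[Φ₁ Φ₂]` as a function of the rescaled variable. -/
def scaledPi (d : Fin p → ℝ) (β : Matrix (Fin n) (Fin n) ℂ) (Θ₁ Θ₂ : Matrix (Fin n) (Fin p) ℂ)
    (y : ℝ) : Matrix (Fin p) (Fin p ⊕ Fin p) ℂ :=
  Matrix.fromCols ((1 / 2 : ℂ) • D d + intKernel β Θ₁ Θ₂ y) 1

theorem continuous_scaledPi : Continuous (scaledPi d β Θ₁ Θ₂) := by
  refine continuous_matrix fun i c => ?_
  rcases c with c | c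
  · simp only [scaledPi, Matrix.fromCols_apply_inl]
    exact (continuous_const.add continuous_intKernel).matrix_elem i c
  · simp only [scaledPi, Matrix.fromCols_apply_inr]
    exact continuous_const

theorem intKernel_eq (y : ℝ) : intKernel β Θ₁ Θ₂ y = Θ₂ᴴ *
    (Matrix.of fun a b => ∫ u in (0 : ℝ)..y, NormedSpace.exp ((Complex.I * u) • βᴴ) a b) * Θ₁ := by
  have h : projFst n * entryInt (fun u : ℝ => NormedSpace.exp ((u : ℂ) • calA β)) 0 y =
      Matrix.fromBlocks (Matrix.of fun a b =>
        ∫ u in (0 : ℝ)..y, NormedSpace.exp ((Complex.I * u) • βᴴ) a b) 0 0 0 := by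
    have e : entryInt (fun u : ℝ => NormedSpace.exp ((u : ℂ) • calA β)) 0 y =
      Matrix.fromBlocks (Matrix.of fun a b =>
        ∫ u in (0 : ℝ)..y, NormedSpace.exp ((Complex.I * u) • βᴴ) a b) 0 0 (Matrix.of fun a b =>
        ∫ u in (0 : ℝ)..y, NormedSpace.exp ((Complex.I * u) • β) a b) := by
      ext (a | a) (b | b) <;> simp only [entryInt, exp_calA, mul_comm Complex.I, Matrix.of_apply,
        Matrix.fromBlocks_apply₁₁, Matrix.fromBlocks_apply₁₂, Matrix.fromBlocks_apply₂₁,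
        Matrix.fromBlocks_apply₂₂, Matrix.zero_apply, intervalIntegral.integral_zero]
    rw [e, projFst, Matrix.fromBlocks_multiply]
    simp
  rw [intKernel, Matrix.mul_assoc (rowΘ Θ₁ Θ₂), h, rowΘ, colΘ, Matrix.fromCols_mul_fromBlocks,
    Matrix.fromCols_mul_fromRows, Matrix.mul_zero, Matrix.mul_zero, add_zero, add_zero,
    Matrix.zero_mul, add_zero, Matrix.mul_neg, neg_neg]

theorem Pi0_apply (hd : ∀ i, 0 < d i) (r : ℝ) (j : Fin p) (c : Fin p ⊕ Fin p) :
    Pi0 d β Θ₁ Θ₂ r j c = scaledPi d β Θ₁ Θ₂ (d j * r) j c := by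
  have hdj : (d j : ℂ) ≠ 0 := by exact_mod_cast (hd j).ne'
  rcases c with c | c
  · simp only [Pi0, scaledPi, Matrix.fromCols_apply_inl, Phi1, s, Matrix.of_apply]
    rw [Matrix.mul_assoc (Dinv d), Matrix.mul_assoc (Dinv d), ← intKernel_eq, Matrix.add_apply,
      Matrix.add_apply, Matrix.smul_apply, Matrix.smul_apply, Dinv, Matrix.diagonal_mul, D,
      Matrix.one_apply, Matrix.diagonal_apply, mul_add, mul_inv_cancel_left₀ hdj]
    simp only [smul_eq_mul]
    split_ifs <;> ring
  · simp only [Pi0, scaledPi, Matrix.fromCols_apply_inr]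

/-- On d_j r = d_i x the kernel is 0 whereas the glued state takes its upper branch. For fixed i
this concerns finitely many r. -/
theorem T_apply_ae (hd : ∀ i, 0 < d i) (i : Fin p) : ∀ᵐ r : ℝ, ∀ j, T d β Θ₁ Θ₂ x x r i j =
    (glue d x i (kernelRow d β Θ₁ Θ₂ x i (1 - Px d β Θ₁ Θ₂ x))
      (kernelRow d β Θ₁ Θ₂ x i (-Px d β Θ₁ Θ₂ x)) (d j * r) * colΘ Θ₁ Θ₂) () j := by
  have hfin : (Set.range fun j => d i * x / d j).Finite := Set.finite_range _
  filter_upwards [hfin.countable.ae_notMem MeasureTheory.volume] with r hr j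
  have hne : d j * r ≠ d i * x := fun e => hr ⟨j, by
    rw [← e]; exact mul_div_cancel_left₀ r (hd j).ne'⟩
  simp only [T, Matrix.of_apply, glue]
  rcases lt_or_gt_of_ne hne with h | h
  · rw [if_pos h, if_pos h, lowerKernel_apply]
  · rw [if_neg h.not_gt, if_pos h, if_neg h.not_gt, upperKernel_apply]

theorem ae_T_mul_Pi0 (hd : ∀ i, 0 < d i) (i : Fin p) (c : Fin p ⊕ Fin p) :
    (fun r => (T d β Θ₁ Θ₂ x x r * Pi0 d β Θ₁ Θ₂ r) i c) =ᵐ[MeasureTheory.volume] fun r : ℝ => ∑ j,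
    (glue d x i (kernelRow d β Θ₁ Θ₂ x i (1 - Px d β Θ₁ Θ₂ x))
      (kernelRow d β Θ₁ Θ₂ x i (-Px d β Θ₁ Θ₂ x)) (d j * r) * colΘ Θ₁ Θ₂) () j *
      scaledPi d β Θ₁ Θ₂ (d j * r) j c := by
  filter_upwards [T_apply_ae (β := β) (Θ₁ := Θ₁) (Θ₂ := Θ₂) (x := x) hd i] with r hr
  rw [Matrix.mul_apply]
  exact Finset.sum_congr rfl fun j _ => by rw [hr j, Pi0_apply hd]

theorem pwCont_summand {i : Fin p} {ρm ρp : ℝ → Matrix Unit (Fin n ⊕ Fin n) ℂ}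
    (h : RowState d β Θ₁ Θ₂ x i ρm ρp) (j : Fin p) (c : Fin p ⊕ Fin p) :
    PwCont (jumps d x) fun y => (glue d x i ρm ρp y * colΘ Θ₁ Θ₂) () j *
      scaledPi d β Θ₁ Θ₂ y j c :=
  ((h.mPwCont_glue.mul (MPwCont.const _)) () j).mul
    (PwCont.of_continuous (continuous_scaledPi.matrix_elem j c))

theorem intervalIntegrable_summand (hd : ∀ i, 0 < d i) {i : Fin p}
    {ρm ρp : ℝ → Matrix Unit (Fin n ⊕ Fin n) ℂ} (h : RowState d β Θ₁ Θ₂ x i ρm ρp) (j : Fin p)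
    (c : Fin p ⊕ Fin p) : IntervalIntegrable (fun r => (glue d x i ρm ρp (d j * r) *
      colΘ Θ₁ Θ₂) () j * scaledPi d β Θ₁ Θ₂ (d j * r) j c) MeasureTheory.volume 0 x := by
  have := ((pwCont_summand h j c).intervalIntegrable 0 (d j * x)).comp_mul_left (c := d j)
  simpa [mul_div_cancel_left₀ x (hd j).ne'] using this

theorem isWellDefined (hd : ∀ i, 0 < d i) (hanti : Antitone d) (hx : 0 ≤ x)
    (hU : IsUnit (U d β Θ₁ Θ₂ x (node d 0 * x)).toBlocks₂₂) : IsWellDefined d β Θ₁ Θ₂ x where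
  isUnit_U₂₂ := hU
  isUnit_U y _ := isUnit_U y
  integrable i c := by
    have hae := ae_T_mul_Pi0 (β := β) (Θ₁ := Θ₁) (Θ₂ := Θ₂) (x := x) hd i c
    refine IntervalIntegrable.congr_ae ?_ (MeasureTheory.ae_restrict_of_ae hae.symm)
    have := IntervalIntegrable.sum Finset.univ fun j _ =>
      intervalIntegrable_summand hd (rowState_kernelRow hd hanti hx hU i) j c
    simpa only [Finset.sum_fn] using this

/-- The substitution y = d_j r yields the factor 1/d_j and the endpoint d_j x. The density encodes
them as D⁻¹ and the cut, so every coordinate can be integrated over the same interval. -/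
theorem integral_summand (hd : ∀ i, 0 < d i) (hanti : Antitone d) (hx : 0 ≤ x) {i : Fin p}
    {ρm ρp : ℝ → Matrix Unit (Fin n ⊕ Fin n) ℂ} (h : RowState d β Θ₁ Θ₂ x i ρm ρp) (j : Fin p)
    (c : Fin p ⊕ Fin p) : ∫ r in (0 : ℝ)..x, (glue d x i ρm ρp (d j * r) *
      colΘ Θ₁ Θ₂) () j * scaledPi d β Θ₁ Θ₂ (d j * r) j c =
      ∫ y in (0 : ℝ)..(node d 0 * x), density d Θ₁ Θ₂ x (glue d x i ρm ρp) y () j *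
        scaledPi d β Θ₁ Θ₂ y j c := by
  set ρ := glue d x i ρm ρp with hρ
  have hpw : PwCont (jumps d x) fun y => density d Θ₁ Θ₂ x ρ y () j *
      scaledPi d β Θ₁ Θ₂ y j c :=
    (mPwCont_density h.mPwCont_glue () j).mul
      (PwCont.of_continuous (continuous_scaledPi.matrix_elem j c))
  have h0 : 0 ≤ d j * x := mul_nonneg (hd j).le hx
  have hca : d j * x ≤ node d 0 * x := le_node_zero hd hanti hx j
  rw [intervalIntegral.integral_comp_mul_left (fun y => (ρ y * colΘ Θ₁ Θ₂) () j *
    scaledPi d β Θ₁ Θ₂ y j c) (hd j).ne', mul_zero,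
    ← intervalIntegral.integral_add_adjacent_intervals (hpw.intervalIntegrable 0 (d j * x))
      (hpw.intervalIntegrable (d j * x) _)]
  have e1 : ∫ y in (d j * x)..(node d 0 * x), density d Θ₁ Θ₂ x ρ y () j *
      scaledPi d β Θ₁ Θ₂ y j c = 0 := by
    rw [intervalIntegral.integral_congr (g := fun _ => 0), intervalIntegral.integral_zero]
    intro y hy
    rw [Set.uIcc_of_le hca] at hy
    simp only [density_apply]
    rw [if_neg (not_lt.2 hy.1), mul_zero, mul_zero, zero_mul]
  rw [e1, add_zero, ← intervalIntegral.integral_smul]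
  refine intervalIntegral.integral_congr_ae ?_
  have hne := (Set.finite_singleton (d j * x)).countable.ae_notMem MeasureTheory.volume
  filter_upwards [hne] with y hyne hy
  rw [Set.uIoc_of_le h0] at hy
  rw [density_apply, if_pos (lt_of_le_of_ne hy.2 hyne), Complex.real_smul]
  push_cast
  ring

/-- The rows of `γ`, in terms of the masses. -/
theorem unitRow_mul_gamma (hd : ∀ i, 0 < d i) (hanti : Antitone d) (hx : 0 ≤ x)
    (hU : IsUnit (U d β Θ₁ Θ₂ x (node d 0 * x)).toBlocks₂₂) (i : Fin p) :
    unitRow i * gamma d β Θ₁ Θ₂ x = Matrix.fromCols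
      ((1 / 2 : ℂ) • (mass d Θ₁ Θ₂ x i (glue d x i (kernelRow d β Θ₁ Θ₂ x i (1 - Px d β Θ₁ Θ₂ x))
        (kernelRow d β Θ₁ Θ₂ x i (-Px d β Θ₁ Θ₂ x))) * D d) +
        kernelMass d β Θ₁ Θ₂ x i (glue d x i (kernelRow d β Θ₁ Θ₂ x i (1 - Px d β Θ₁ Θ₂ x))
        (kernelRow d β Θ₁ Θ₂ x i (-Px d β Θ₁ Θ₂ x))))
      (mass d Θ₁ Θ₂ x i (glue d x i (kernelRow d β Θ₁ Θ₂ x i (1 - Px d β Θ₁ Θ₂ x))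
        (kernelRow d β Θ₁ Θ₂ x i (-Px d β Θ₁ Θ₂ x)))) := by
  have h := rowState_kernelRow hd hanti hx hU i
  have hae := ae_T_mul_Pi0 (β := β) (Θ₁ := Θ₁) (Θ₂ := Θ₂) (x := x) hd i
  set ρ := glue d x i (kernelRow d β Θ₁ Θ₂ x i (1 - Px d β Θ₁ Θ₂ x))
        (kernelRow d β Θ₁ Θ₂ x i (-Px d β Θ₁ Θ₂ x)) with hρ
  set a := node d 0 * x with ha
  set g := density d Θ₁ Θ₂ x ρ with hg
  have hgpw : MPwCont (jumps d x) g := mPwCont_density h.mPwCont_glue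
  have hrow : unitRow i * gamma d β Θ₁ Θ₂ x = unitRow i * scaledPi d β Θ₁ Θ₂ (d i * x) +
      entryInt (fun y => g y * scaledPi d β Θ₁ Θ₂ y) 0 a := by
    ext u c
    obtain rfl : u = () := rfl
    rw [unitRow_mul, gamma, VplusStar, Matrix.add_apply, Matrix.add_apply, unitRow_mul,
      Pi0_apply hd]
    congr 1
    simp only [Matrix.of_apply, entryInt]
    rw [intervalIntegral.integral_congr_ae ((hae c).mono fun r hr _ => hr),
      intervalIntegral.integral_finsetSum fun j _ => intervalIntegrable_summand hd h j c]
    simp only [Matrix.mul_apply (M := g _)]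
    rw [intervalIntegral.integral_finsetSum fun j _ => ((hgpw () j).mul
      (PwCont.of_continuous (continuous_scaledPi.matrix_elem j c))).intervalIntegrable 0 a]
    exact Finset.sum_congr rfl fun j _ => integral_summand hd hanti hx h j c
  have hsplit : ∀ F : ℝ → Matrix Unit (Fin p) ℂ, ∀ G : ℝ → Matrix Unit (Fin p) ℂ,
      entryInt (fun y => Matrix.fromCols (F y) (G y)) 0 a =
        Matrix.fromCols (entryInt F 0 a) (entryInt G 0 a) := by
    intro F G
    ext u (c | c) <;> simp [entryInt]
  have hgK : MPwCont (jumps d x) fun y => g y * intKernel β Θ₁ Θ₂ y :=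
    hgpw.mul (MPwCont.of_continuous continuous_intKernel)
  rw [hrow]
  simp only [scaledPi, Matrix.mul_fromCols, Matrix.mul_add, Matrix.mul_one]
  rw [hsplit, (hgpw.mul (MPwCont.const _)).entryInt_add hgK, hgpw.entryInt_mul_const]
  ext u (c | c)
  · simp only [Matrix.add_apply, Matrix.fromCols_apply_inl, mass, kernelMass, Matrix.mul_smul,
      Matrix.add_mul, smul_add]
    ring
  · simp only [Matrix.add_apply, Matrix.fromCols_apply_inr, mass, hg, ha]

/-- J makes each half mD/2 meet the other mass once; the two contributions add up to the term m_j D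
m_i* of the pairing. -/
theorem gamma_mul_J_mul_conjTranspose (hd : ∀ i, 0 < d i) (hanti : Antitone d) (hx : 0 ≤ x)
    (hU : IsUnit (U d β Θ₁ Θ₂ x (node d 0 * x)).toBlocks₂₂) :
    gamma d β Θ₁ Θ₂ x * J p * (gamma d β Θ₁ Θ₂ x)ᴴ = D d := by
  ext j i
  rw [← (rowState_kernelRow hd hanti hx hU i).pairing hd hanti hx
    (rowState_kernelRow hd hanti hx hU j),
    ← unitRow_mul (gamma d β Θ₁ Θ₂ x * J p * (gamma d β Θ₁ Θ₂ x)ᴴ) j,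
    ← mul_conjTranspose_unitRow (unitRow j * (gamma d β Θ₁ Θ₂ x * J p * (gamma d β Θ₁ Θ₂ x)ᴴ)),
    Matrix.mul_assoc _ _ (unitRow i)ᴴ, Matrix.mul_assoc _ _ (unitRow i)ᴴ,
    ← Matrix.conjTranspose_mul, ← Matrix.mul_assoc, ← Matrix.mul_assoc,
    unitRow_mul_gamma hd hanti hx hU, unitRow_mul_gamma hd hanti hx hU, J,
    Matrix.fromCols_mul_fromBlocks, Matrix.conjTranspose_fromCols_eq_fromRows_conjTranspose,
    Matrix.fromCols_mul_fromRows]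
  simp only [Matrix.mul_zero, Matrix.mul_one, zero_add, add_zero, Matrix.conjTranspose_add,
    Matrix.conjTranspose_smul, Matrix.conjTranspose_mul, conjTranspose_D, Matrix.mul_add,
    Matrix.add_mul, Matrix.mul_smul, Matrix.smul_mul, Matrix.mul_assoc]
  have : star (1 / 2 : ℂ) = 1 / 2 := by simp
  rw [this]
  simp only [Matrix.add_apply, Matrix.smul_apply, smul_eq_mul]
  ring

end GammaFormula

/-! ### From γJγ* = D to the similarity. -/

section Similarity

variable {p : ℕ} {d : Fin p → ℝ}

/-- Both terms of γJγ* contain the second half of γ or its adjoint. A left null vector v of that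
half gives vDv* = 0, so v = 0 by positivity of D. -/
theorem isUnit_toCols₂ (hd : ∀ i, 0 < d i) {γ : Matrix (Fin p) (Fin p ⊕ Fin p) ℂ}
    (h : γ * J p * γᴴ = D d) : IsUnit γ.toCols₂ := by
  rw [Matrix.isUnit_iff_isUnit_det, isUnit_iff_ne_zero]
  intro h0
  obtain ⟨v, hv0, hv⟩ := Matrix.exists_vecMul_eq_zero_iff.2 h0
  refine hv0 (funext fun i => ?_)
  have hR : Matrix.replicateRow Unit v * γ.toCols₂ = 0 := by
    rw [← Matrix.replicateRow_vecMul, hv]; rfl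
  have hD : Matrix.replicateRow Unit v * D d * (Matrix.replicateRow Unit v)ᴴ = 0 := by
    rw [← h, ← Matrix.fromCols_toCols γ, J, Matrix.fromCols_mul_fromBlocks,
      Matrix.conjTranspose_fromCols_eq_fromRows_conjTranspose, Matrix.fromCols_mul_fromRows,
      Matrix.mul_add, Matrix.add_mul]
    simp only [Matrix.mul_zero, Matrix.mul_one, zero_add, add_zero]
    rw [← Matrix.mul_assoc, hR, Matrix.zero_mul, Matrix.zero_mul, zero_add, Matrix.mul_assoc,
      Matrix.mul_assoc, ← Matrix.conjTranspose_mul, hR]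
    simp
  have hsum : ∑ k, d k * Complex.normSq (v k) = 0 := by
    have h1 := congrFun (congrFun hD ()) ()
    rw [Matrix.mul_apply] at h1
    have h2 : ((∑ k, d k * Complex.normSq (v k) : ℝ) : ℂ) = 0 := by
      rw [← Matrix.zero_apply (α := ℂ) () (), ← h1]
      push_cast
      refine Finset.sum_congr rfl fun k _ => ?_
      rw [D, Matrix.mul_diagonal, Matrix.conjTranspose_apply, Matrix.replicateRow_apply,
        Complex.normSq_eq_conj_mul_self, Complex.star_def]
      ring
    exact_mod_cast h2
  have hi := (Finset.sum_eq_zero_iff_of_nonneg fun k _ =>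
    mul_nonneg (hd k).le (Complex.normSq_nonneg (v k))).1 hsum i (Finset.mem_univ i)
  exact Complex.normSq_eq_zero.1 ((mul_eq_zero.1 hi).resolve_left (hd i).ne')

theorem similar_of_mul_J_mul (hd : ∀ i, 0 < d i) {γ : Matrix (Fin p) (Fin p ⊕ Fin p) ℂ}
    (h : γ * J p * γᴴ = D d) : Similar (J p * (γᴴ * γ)) (H0 d) := by
  have hu := (Matrix.isUnit_iff_isUnit_det _).1 (isUnit_toCols₂ hd h)
  set M : Matrix (Fin p ⊕ Fin p) (Fin p) ℂ := J p * γᴴ with hM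
  -- The columns of W span ker γ. Together with those of M they form an eigenbasis of JH = Mγ,
  -- because γM = D.
  set W : Matrix (Fin p ⊕ Fin p) (Fin p) ℂ := Matrix.fromRows 1 (-(γ.toCols₂⁻¹ * γ.toCols₁)) with hW
  set E : Matrix (Fin p) (Fin p ⊕ Fin p) ℂ := Matrix.fromCols 1 0 with hE
  have hγM : γ * M = D d := by rw [hM, ← Matrix.mul_assoc, h]
  have hγW : γ * W = 0 := by
    conv_lhs => enter [1]; rw [← Matrix.fromCols_toCols γ]
    rw [hW, Matrix.fromCols_mul_fromRows, Matrix.mul_one, Matrix.mul_neg,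
      Matrix.mul_nonsing_inv_cancel_left _ _ hu, add_neg_cancel]
  have hEW : E * W = 1 := by
    rw [hE, hW, Matrix.fromCols_mul_fromRows, Matrix.one_mul, Matrix.zero_mul, add_zero]
  -- D⁻¹γ reads off the M-coordinates. Subtracting the M-part leaves a multiple of W, whose
  -- coordinates E reads off.
  set L : Matrix (Fin p ⊕ Fin p) (Fin p ⊕ Fin p) ℂ :=
    Matrix.fromRows (Dinv d * γ) (E - E * M * (Dinv d * γ)) with hL
  have hLM : L * Matrix.fromCols M W = 1 := by
    rw [hL, Matrix.fromRows_mul_fromCols, Matrix.sub_mul, Matrix.sub_mul, Matrix.mul_assoc (Dinv d),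
      Matrix.mul_assoc (Dinv d), Matrix.mul_assoc (E * M), Matrix.mul_assoc (E * M),
      Matrix.mul_assoc (Dinv d), Matrix.mul_assoc (Dinv d), hγM, hγW, hEW, Dinv_mul_D hd,
      Matrix.mul_one, sub_self, Matrix.mul_zero, Matrix.mul_zero, sub_zero, Matrix.fromBlocks_one]
  refine ⟨⟨L, Matrix.fromCols M W, hLM, mul_eq_one_comm.1 hLM⟩, ?_⟩
  have hint : J p * (γᴴ * γ) * Matrix.fromCols M W = Matrix.fromCols M W * H0 d := by
    rw [← Matrix.mul_assoc, ← hM, Matrix.mul_fromCols, Matrix.mul_assoc M, Matrix.mul_assoc M, hγM, hγW,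
      H0, Matrix.fromCols_mul_fromBlocks]
    simp
  calc J p * (γᴴ * γ) = J p * (γᴴ * γ) * (Matrix.fromCols M W * L) := by
        rw [mul_eq_one_comm.1 hLM, Matrix.mul_one]
    _ = Matrix.fromCols M W * H0 d * L := by rw [← Matrix.mul_assoc, hint]

end Similarity

/-! ### Existence of a realization by block companion matrices. -/

section Realization

open Polynomial

variable {p : ℕ} {M : ℕ}

/-- The block companion matrix, with scalar blocks of size `p`, of a monic polynomial of degree
`M + 1`. -/
def blockCompanion (p M : ℕ) (q : ℂ[X]) :
    Matrix (Fin (M + 1) × Fin p) (Fin (M + 1) × Fin p) ℂ :=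
  Matrix.of fun a b => if a.2 = b.2 then
    (if (b.1 : ℕ) = a.1 + 1 then 1 else 0) - (if (a.1 : ℕ) = M then q.coeff b.1 else 0) else 0

/-- The column of blocks `z ^ k`. -/
def powerColumn (p M : ℕ) (z : ℂ) : Matrix (Fin (M + 1) × Fin p) (Fin p) ℂ :=
  Matrix.of fun a j => if a.2 = j then z ^ (a.1 : ℕ) else 0

/-- The last block column. -/
def lastColumn (p M : ℕ) : Matrix (Fin (M + 1) × Fin p) (Fin p) ℂ :=
  Matrix.of fun a j => if a.2 = j then (if (a.1 : ℕ) = M then 1 else 0) else 0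

/-- Each block row but the last shifts z^k to z^{k+1}. The last one gives z^{M+1} - q(z), so only
there a remainder is left. -/
theorem blockCompanion_mul_powerColumn {q : ℂ[X]} (hq : q.Monic) (hdeg : q.natDegree = M + 1)
    (z : ℂ) : (blockCompanion p M q - z • (1 : Matrix (Fin (M + 1) × Fin p) _ ℂ)) *
      powerColumn p M z = -(q.eval z) • lastColumn p M := by
  have hev : q.eval z = ∑ k ∈ Finset.range (M + 1), q.coeff k * z ^ k + z ^ (M + 1) := by
    rw [Polynomial.eval_eq_sum_range, hdeg, Finset.sum_range_succ, ← hdeg, hq.coeff_natDegree,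
      one_mul]
  have hC : ∀ k : Fin (M + 1), ∑ k' : Fin (M + 1), ((if (k' : ℕ) = k + 1 then 1 else 0) -
      (if (k : ℕ) = M then q.coeff k' else 0)) * z ^ (k' : ℕ) =
      z * z ^ (k : ℕ) - if (k : ℕ) = M then q.eval z else 0 := by
    intro k
    rw [Fin.sum_univ_eq_sum_range fun k' : ℕ => ((if k' = k + 1 then 1 else 0) -
      (if (k : ℕ) = M then q.coeff k' else 0)) * z ^ k']
    simp only [sub_mul, Finset.sum_sub_distrib, ite_mul, one_mul, zero_mul, Finset.sum_ite_eq',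
      Finset.mem_range, ← pow_succ']
    have hk := k.2
    by_cases h : (k : ℕ) = M
    · simp only [h, if_true, lt_irrefl, if_false, hev]
      ring
    · rw [if_pos (by omega), if_neg h, Finset.sum_congr rfl fun _ _ => if_neg h]
      simp
  rw [Matrix.sub_mul, Matrix.smul_mul, Matrix.one_mul]
  ext ⟨k, i⟩ j
  have h1 : (blockCompanion p M q * powerColumn p M z) (k, i) j =
      if i = j then z * z ^ (k : ℕ) - (if (k : ℕ) = M then q.eval z else 0) else 0 := by
    rw [Matrix.mul_apply, Fintype.sum_prod_type, ← hC, Finset.sum_comm]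
    simp only [blockCompanion, powerColumn, Matrix.of_apply, mul_ite, mul_zero, ite_mul, zero_mul]
    rw [Finset.sum_eq_single j (fun x _ hx => by simp [hx]) (by simp)]
    by_cases hij : i = j <;> simp [hij]
  rw [Matrix.sub_apply, h1]
  simp only [powerColumn, lastColumn, Matrix.smul_apply, Matrix.of_apply, smul_eq_mul]
  split_ifs <;> ring

theorem blockCompanion_resolvent [NeZero p] {q : ℂ[X]} (hq : q.Monic) (hdeg : q.natDegree = M + 1)
    {z : ℂ} (hz : IsUnit (blockCompanion p M q - z • (1 : Matrix (Fin (M + 1) × Fin p) _ ℂ))) :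
    q.eval z ≠ 0 ∧
      (blockCompanion p M q - z • (1 : Matrix (Fin (M + 1) × Fin p) _ ℂ))⁻¹ * lastColumn p M =
        -(q.eval z)⁻¹ • powerColumn p M z := by
  have h := blockCompanion_mul_powerColumn (p := p) hq hdeg z
  have hdet := (Matrix.isUnit_iff_isUnit_det _).1 hz
  have h2 : powerColumn p M z = -(q.eval z) •
      ((blockCompanion p M q - z • (1 : Matrix (Fin (M + 1) × Fin p) _ ℂ))⁻¹ *
        lastColumn p M) := by
    rw [← Matrix.mul_smul, ← h, Matrix.nonsing_inv_mul_cancel_left _ _ hdet]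
  -- The first block of the power column is the identity, so the column cannot be a zero multiple of
  -- anything. An entry exists since p ≠ 0.
  have hne : q.eval z ≠ 0 := by
    intro h0
    have := congrFun (congrFun h2 (0, 0)) 0
    rw [h0, neg_zero, zero_smul] at this
    simp [powerColumn] at this
  refine ⟨hne, ?_⟩
  rw [h2, smul_smul, neg_mul_neg, inv_mul_cancel₀ hne, one_smul]

/-- For p = 0 the companion construction has size 0, but a positive state dimension is required. -/
theorem exists_isRealization_zero {d : Fin 0 → ℝ} {φ : Matrix (Fin 0) (Fin 0) (RatFunc ℂ)} :
    IsRealization d φ (0 : Matrix (Fin 1) (Fin 1) ℂ) 0 0 := fun _ _ => Subsingleton.elim _ _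

theorem exists_realization_aux [NeZero p] (d : Fin p → ℝ) (φ : Matrix (Fin p) (Fin p) (RatFunc ℂ))
    (hφ : Tendsto (evalAt φ) (Bornology.cobounded ℂ) (𝓝 ((Complex.I / 2) • D d))) :
    ∃ (M : ℕ) (β : Matrix (Fin (M + 1) × Fin p) (Fin (M + 1) × Fin p) ℂ)
      (Θ₁ Θ₂ : Matrix (Fin (M + 1) × Fin p) (Fin p) ℂ), ∀ z : ℂ,
      IsUnit (β - z • (1 : Matrix (Fin (M + 1) × Fin p) _ ℂ)) → evalAt φ z =
        (Complex.I / 2) • D d + Θ₁ᴴ * (β - z • (1 : Matrix (Fin (M + 1) × Fin p) _ ℂ))⁻¹ * Θ₂ := by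
  obtain ⟨q₀, hq₀, hden, -⟩ := exists_common_denom φ
  -- The superfluous factor X makes the degree positive even when φ is constant; dividing by the
  -- leading coefficient makes q monic.
  set q : ℂ[X] := X * q₀ * C (X * q₀).leadingCoeff⁻¹ with hqdef
  have hXq : (X * q₀ : ℂ[X]) ≠ 0 := mul_ne_zero X_ne_zero hq₀
  have hq : q.Monic := monic_mul_leadingCoeff_inv hXq
  have hdeg : q.natDegree = q₀.natDegree + 1 := by
    rw [hqdef, natDegree_mul_leadingCoeff_inv _ hXq, natDegree_X_mul hq₀]
  have hdvd : ∀ i j, (φ i j).denom ∣ q := fun i j =>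
    (hden i j).trans ((dvd_mul_left _ _).trans (dvd_mul_right _ _))
  choose P hP using fun i j => exists_polynomial_of_denom_dvd (hdvd i j)
  set R : Fin p → Fin p → ℂ[X] := fun i j => P i j - C ((Complex.I / 2) * D d i j) * q with hR
  have hRq : ∀ i j z, q.eval z ≠ 0 →
      (R i j).eval z / q.eval z = evalAt φ z i j - (Complex.I / 2) * D d i j := by
    intro i j z hz
    rw [evalAt, Matrix.map_apply, hP i j z hz, hR, eval_sub, eval_mul, eval_C]
    field_simp
  have hRdeg : ∀ i j, (R i j).natDegree < q₀.natDegree + 1 := by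
    intro i j
    have ht : Tendsto (fun z => (R i j).eval z / q.eval z) (Bornology.cobounded ℂ) (𝓝 0) := by
      have h1 := (((continuous_apply_apply i j).tendsto _).comp hφ).sub
        (tendsto_const_nhds (x := (Complex.I / 2) * D d i j))
      rw [Matrix.smul_apply, smul_eq_mul, sub_self] at h1
      refine h1.congr' ?_
      filter_upwards [eventually_eval_ne_zero hq.ne_zero] with z hz
      exact (hRq i j z hz).symm
    have hlt := degree_lt_of_tendsto_div hq.ne_zero ht
    rw [degree_eq_natDegree hq.ne_zero, hdeg] at hlt
    rcases eq_or_ne (R i j) 0 with h0 | h0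
    · rw [h0, natDegree_zero]
      exact Nat.succ_pos _
    · exact (natDegree_lt_iff_degree_lt h0).2 hlt
  -- Θ₁* lists the coefficients of the numerators R_ij of φ - iD/2, with a sign that cancels the one
  -- in the resolvent formula. They fit since deg R_ij < deg q.
  refine ⟨q₀.natDegree, blockCompanion p _ q,
    (Matrix.of fun i (a : Fin (q₀.natDegree + 1) × Fin p) => -(R i a.2).coeff a.1)ᴴ,
    lastColumn p _, fun z hz => ?_⟩
  obtain ⟨hne, hres⟩ := blockCompanion_resolvent hq hdeg hz
  rw [Matrix.conjTranspose_conjTranspose, Matrix.mul_assoc, hres]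
  ext i j
  have hij := hRq i j z hne
  rw [eval_eq_sum_range' (hRdeg i j), eq_sub_iff_add_eq] at hij
  rw [← hij, add_comm, Matrix.add_apply, Matrix.smul_apply, smul_eq_mul, Matrix.mul_smul,
    Matrix.smul_apply, Matrix.mul_apply, Fintype.sum_prod_type]
  congr 1
  simp only [powerColumn, Matrix.of_apply, mul_ite, mul_zero, Finset.sum_ite_eq', Finset.mem_univ,
    if_true, smul_eq_mul]
  rw [Fin.sum_univ_eq_sum_range fun k : ℕ => -(R i j).coeff k * z ^ k, Finset.mul_sum,
    Finset.sum_div]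
  refine Finset.sum_congr rfl fun k _ => ?_
  ring

theorem exists_isRealization (d : Fin p → ℝ) (φ : Matrix (Fin p) (Fin p) (RatFunc ℂ))
    (hφ : Tendsto (evalAt φ) (Bornology.cobounded ℂ) (𝓝 ((Complex.I / 2) • D d))) :
    ∃ n : ℕ, 0 < n ∧ ∃ (β : Matrix (Fin n) (Fin n) ℂ) (Θ₁ Θ₂ : Matrix (Fin n) (Fin p) ℂ),
      IsRealization d φ β Θ₁ Θ₂ := by
  rcases Nat.eq_zero_or_pos p with rfl | hp
  · exact ⟨1, one_pos, 0, 0, 0, exists_isRealization_zero⟩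
  have : NeZero p := ⟨hp.ne'⟩
  obtain ⟨M, β, Θ₁, Θ₂, h⟩ := exists_realization_aux d φ hφ
  let e : Fin ((M + 1) * p) ≃ Fin (M + 1) × Fin p := finProdFinEquiv.symm
  refine ⟨(M + 1) * p, Nat.mul_pos M.succ_pos hp, β.submatrix e e, Θ₁.submatrix e id,
    Θ₂.submatrix e id, fun z hz => ?_⟩
  have hsub : β.submatrix e e - z • (1 : Matrix (Fin ((M + 1) * p)) (Fin ((M + 1) * p)) ℂ) =
      (β - z • (1 : Matrix (Fin (M + 1) × Fin p) _ ℂ)).submatrix e e := by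
    ext a b
    simp [Matrix.one_apply, e.injective.eq_iff]
  rw [isUnit_sub_smul_one_iff, hsub, Matrix.isUnit_submatrix_equiv] at hz
  rw [h z hz, hsub, Matrix.inv_submatrix_equiv, Matrix.conjTranspose_submatrix,
    Matrix.submatrix_mul_equiv, Matrix.submatrix_mul_equiv, Matrix.submatrix_id_id]

end Realization

end

end DKernel

theorem mainTheorem7 {p : ℕ} (d : Fin p → ℝ) (hd : ∀ i, 0 < d i) (hanti : Antitone d)
    (φ : Matrix (Fin p) (Fin p) (RatFunc ℂ)) (hφ : DKernel.IsAdmissible d φ) :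
    (∃ n : ℕ, 0 < n ∧ ∃ (β : Matrix (Fin n) (Fin n) ℂ) (Θ₁ Θ₂ : Matrix (Fin n) (Fin p) ℂ),
      DKernel.IsRealization d φ β Θ₁ Θ₂) ∧
    ∀ (n : ℕ) (β : Matrix (Fin n) (Fin n) ℂ) (Θ₁ Θ₂ : Matrix (Fin n) (Fin p) ℂ),
      DKernel.IsRealization d φ β Θ₁ Θ₂ →
      ∀ x : ℝ, 0 ≤ x →
        DKernel.IsWellDefined d β Θ₁ Θ₂ x ∧
        DKernel.gamma d β Θ₁ Θ₂ x * DKernel.J p * (DKernel.gamma d β Θ₁ Θ₂ x)ᴴ = DKernel.D d ∧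
        DKernel.Similar (DKernel.J p * DKernel.Ham d β Θ₁ Θ₂ x) (DKernel.H0 d) := by
  refine ⟨DKernel.exists_isRealization d φ hφ.tendsto_infty, fun n β Θ₁ Θ₂ hR x hx => ?_⟩
  have hU := DKernel.isUnit_toBlocks₂₂ hd hanti hφ hR hx
  have hγ := DKernel.gamma_mul_J_mul_conjTranspose hd hanti hx hU
  exact ⟨DKernel.isWellDefined hd hanti hx hU, hγ, DKernel.similar_of_mul_J_mul hd hγ⟩
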